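/- Let $K:[0,1]^2\to\mathbb R$ be symmetric and Lipschitz continuous with $|K|\le 1$, and let $T_K$ be the integral operator $(T_Kg)(x)=\int_0^1K(x,y)g(y)\,dy$ on $L^2([0,1])$. Let $\lambda_1(K)\ge\lambda_2(K)\ge\cdots\ge 0$ be the positive eigenvalues of $T_K$ counted with multiplicity (continued by zeros if there are only finitely many), and assume $\lambda_1(K)>\lambda_2(K)$. Let $\phi_1$ be an $L^2$-normalized eigenfunction of $T_K$ for $\lambda_1(K)$. Let $U_1,U_2,\dots$ be i.i.d. uniform on $[0,1]$, let $\mathbf K_n=(K(U_i,U_j))_{i,j=1}^n$ (diagonal included), and let $\lambda_1(\mathbf K_n)$ be its largest eigenvalue. 1. If $K$ is not degenerate, i.e. $\phi_1$ is not almost everywhere constant, then $$\sqrt n\left(\frac{\lambda_1(\mathbf K_n)}{n}-\lambda_1(K)\right)\xrightarrow{d}\mathcal N\left(0,\ \lambda_1(K)^2\operatorname{Var}(\phi_1^2(U))\right),\qquad U\sim\mathrm{Unif}[0,1].$$ 2. Let $\sigma(K)$ be the family of nonzero eigenvalues of $T_K$, positive and negative, repeated according to multiplicity. If $K$ is degenerate,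 i.e. $\phi_1$ is almost everywhere constant, and $\sum_{\lambda\in\sigma(K)}|\lambda|<\infty$, then $$\lambda_1(\mathbf K_n)-n\,\lambda_1(K)\xrightarrow{d}\sum_{\lambda\in\sigma(K)\setminus\{\lambda_1(K)\}}\frac{\lambda_1(K)\,\lambda}{\lambda_1(K)-\lambda}\,Z_\lambda^2,$$ where the $Z_\lambda$ are independent standard normal random variables, one for each member of the family $\sigma(K)$, and the series on the right converges almost surely. -/

import Mathlib

open MeasureTheory ProbabilityTheory Filter Topology
open scoped unitInterval NNReal ENNReal

namespace RandomKernel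

/-- The real Hilbert space `L²([0,1])` (Lebesgue measure). -/
abbrev L2 : Type := Lp ℝ 2 (volume : Measure I)

theorem integrable_coe (g : L2) : Integrable (fun y => g y) (volume : Measure I) :=
  (Lp.memLp g).integrable (by norm_num)

theorem integrable_kernel_mul (K : C(I × I, ℝ)) (g : L2) (x : I) :
    Integrable (fun y => K (x, y) * g y) (volume : Measure I) := by
  refine (integrable_coe g).bdd_mul (c := ‖K‖) ?_ ?_
  · exact (by fun_prop : Continuous fun y => K (x, y)).aestronglyMeasurable
  · exact Eventually.of_forall fun y => K.norm_coe_le_norm (x, y)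

/-- The continuous function `x ↦ ∫₀¹ K(x,y) g(y) dy`. -/
noncomputable def integralFun (K : C(I × I, ℝ)) (g : L2) : C(I, ℝ) where
  toFun x := ∫ y : I, K (x, y) * g y
  continuous_toFun := by
    refine continuous_of_dominated (bound := fun y => ‖K‖ * ‖g y‖) ?_ ?_ ?_ ?_
    · exact fun x => (integrable_kernel_mul K g x).aestronglyMeasurable
    · refine fun x => Eventually.of_forall fun y => ?_
      rw [norm_mul]
      exact mul_le_mul_of_nonneg_right (K.norm_coe_le_norm (x, y)) (norm_nonneg _)
    · exact (integrable_coe g).norm.const_mul _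
    · exact Eventually.of_forall fun y => by fun_prop

theorem norm_integralFun_le (K : C(I × I, ℝ)) (g : L2) : ‖integralFun K g‖ ≤ ‖K‖ * ‖g‖ := by
  rw [ContinuousMap.norm_le _ (by positivity)]
  intro x
  have h1 : ∫ y : I, ‖g y‖ ≤ ‖g‖ := by
    have h := eLpNorm_le_eLpNorm_of_exponent_le (μ := (volume : Measure I)) (p := 1) (q := 2)
      (by norm_num) (Lp.aestronglyMeasurable g)
    rw [integral_norm_eq_lintegral_enorm (Lp.aestronglyMeasurable g), Lp.norm_def,
      ← eLpNorm_one_eq_lintegral_enorm]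
    exact ENNReal.toReal_mono (Lp.eLpNorm_ne_top g) h
  calc ‖∫ y : I, K (x, y) * g y‖ ≤ ∫ y : I, ‖K (x, y) * g y‖ := norm_integral_le_integral_norm _
    _ ≤ ∫ y : I, ‖K‖ * ‖g y‖ := by
        refine integral_mono (integrable_kernel_mul K g x).norm
          ((integrable_coe g).norm.const_mul _) fun y => ?_
        change ‖K (x, y) * g y‖ ≤ ‖K‖ * ‖g y‖
        rw [norm_mul]
        exact mul_le_mul_of_nonneg_right (K.norm_coe_le_norm (x, y)) (norm_nonneg _)
    _ = ‖K‖ * ∫ y : I, ‖g y‖ := integral_const_mul _ _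
    _ ≤ ‖K‖ * ‖g‖ := mul_le_mul_of_nonneg_left h1 (norm_nonneg _)

theorem integralFun_add (K : C(I × I, ℝ)) (g h : L2) :
    integralFun K (g + h) = integralFun K g + integralFun K h := by
  ext x
  change ∫ y : I, K (x, y) * (g + h : L2) y
    = (∫ y : I, K (x, y) * g y) + ∫ y : I, K (x, y) * h y
  rw [← integral_add (integrable_kernel_mul K g x) (integrable_kernel_mul K h x)]
  refine integral_congr_ae ?_
  filter_upwards [Lp.coeFn_add g h] with y hy
  rw [hy, Pi.add_apply, mul_add]

theorem integralFun_smul (K : C(I × I, ℝ)) (c : ℝ) (g : L2) :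
    integralFun K (c • g) = c • integralFun K g := by
  ext x
  change ∫ y : I, K (x, y) * (c • g : L2) y = c * ∫ y : I, K (x, y) * g y
  rw [← integral_const_mul]
  refine integral_congr_ae ?_
  filter_upwards [Lp.coeFn_smul c g] with y hy
  rw [hy, Pi.smul_apply, smul_eq_mul]
  ring

/-- `integralFun` as a linear map in `g`. -/
noncomputable def integralLin (K : C(I × I, ℝ)) : L2 →ₗ[ℝ] C(I, ℝ) where
  toFun := integralFun K
  map_add' := integralFun_add K
  map_smul' := integralFun_smul K

/-- The integral operator `(T_K g)(x) = ∫₀¹ K(x,y) g(y) dy` on `L²([0,1])`. -/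
noncomputable def kernelOp (K : C(I × I, ℝ)) : L2 →L[ℝ] L2 :=
  (ContinuousMap.toLp (E := ℝ) 2 (volume : Measure I) ℝ).comp
    ((integralLin K).mkContinuous ‖K‖ (norm_integralFun_le K))

/-- The operator acts by the stated integral formula. -/
theorem kernelOp_ae_eq (K : C(I × I, ℝ)) (g : L2) :
    ∀ᵐ x : I, kernelOp K g x = ∫ y : I, K (x, y) * g y :=
  ContinuousMap.coeFn_toLp (p := 2) (𝕜 := ℝ) (volume : Measure I) (integralFun K g)

/-- Index set of the nonzero eigenvalues of `T_K`, each repeated according to its multiplicity.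
(For symmetric `K`, nonzero eigenvalues of the compact operator `T_K` have finite multiplicity.) -/
def EigenIndex (K : C(I × I, ℝ)) : Type :=
  Σ μ : {μ : ℝ // μ ≠ 0 ∧ Module.End.HasEigenvalue (kernelOp K).toLinearMap μ},
    Fin (Module.finrank ℝ (Module.End.eigenspace (kernelOp K).toLinearMap μ.1))

/-- The eigenvalue of `T_K` carried by an index. -/
def eigenvalue (K : C(I × I, ℝ)) (i : EigenIndex K) : ℝ := i.1.1

/-- For `j ≥ 1`, the `j`-th term of the enumeration `λ₁(K) ≥ λ₂(K) ≥ ⋯ ≥ 0` of the positive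
eigenvalues of `T_K` with multiplicity, continued by zeros when there are fewer than `j` of them:
the largest `t > 0` such that at least `j` eigenvalues are `≥ t`, and `0` if there is none. -/
noncomputable def posEigenvalue (K : C(I × I, ℝ)) (j : ℕ) : ℝ :=
  sSup ({0} ∪ {t : ℝ | 0 < t ∧ (j : ℕ∞) ≤ {i : EigenIndex K | t ≤ eigenvalue K i}.encard})

/-- The `L²` function `φ` is almost everywhere equal to a constant (the kernel is degenerate when
this holds for the normalized eigenfunction of its largest eigenvalue). -/
def AEConstant (φ : L2) : Prop := ∃ c : ℝ, ∀ᵐ x : I, φ x = c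

/-- The kernel matrix `(K(u_i, u_j))_{1 ≤ i, j ≤ n}`, diagonal included. -/
def kernelMatrix (K : C(I × I, ℝ)) {n : ℕ} (u : Fin n → I) : Matrix (Fin n) (Fin n) ℝ :=
  Matrix.of fun i j => K (u i, u j)

/-- The largest (real) eigenvalue of a symmetric real matrix. -/
noncomputable def largestEigenvalue {n : ℕ} (A : Matrix (Fin n) (Fin n) ℝ) : ℝ :=
  sSup (spectrum ℝ A)

end RandomKernel

open RandomKernel

/-!
Everything rests on perturbation theory of the top eigenvalue of the normalized kernel matrix
`T = K_n / n`, with a trial vector built from sampled eigenfunctions.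

*Deterministic bound.* If `x` is a trial vector with Rayleigh quotient `q`, and the quadratic form
of `T` stays below `q - D` on the orthogonal complement of `x`, then
`q ≤ λ₁(T) ≤ q + ‖T x - θ x‖² / (D ‖x‖²)` for every `θ`
(`topEigenvalue_le_rayleigh_add`, in the spirit of Kato and Temple). To bound the form on that
complement, `K` is split into finitely many eigenfunction terms and a remainder. The Gram matrix of
the finitely many sampled eigenfunctions tends to the identity by the law of large numbers, and the
Hilbert–Schmidt norm of the sampled remainder is as small as desired, because
`∑ λ² = ∫∫ K²` (`hasSum_sq_eigenvalue`). All estimates are therefore made in probability along an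
iterated limit: `n → ∞` for a fixed finite set of eigenvalues, then larger and larger finite sets.

*Non-degenerate case.* With `x = v` the sampled leading eigenfunction `φ`, the remainder
`K - λ₁ φ ⊗ φ` is annihilated by `φ`, so `⟪v, T v⟫ - λ₁ ‖v‖⁴` and `‖T v - λ₁ ‖v‖² v‖²` are
degenerate `V`-statistics of size `O_P(1/n)`. Hence `λ₁(T) = λ₁ n⁻¹ ∑ φ(U_i)² + o_P(n^{-1/2})`
(`IsKernelExpansion.nullInProb_sqrt_mul_sampleTop_sub`), and the central limit theorem applies.

*Degenerate case.* Now `φ = 1` and `‖v‖ = 1`, so the fluctuations come from the next order. The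
trial vector is `v + ∑ d_k ⟪v, e_k⟫ e_k` with `e_k` the sampled eigenfunctions and
`d_k = λ_k / (λ₁ - λ_k)`, the first-order eigenvector correction; it makes `n ‖T x - λ₁ x‖²`
negligible. The Rayleigh quotient then gives
`n (λ₁(T) - λ₁) ≈ ∑_F λ₁ d_k z_k² + ∫ R_F(x, x) dx`, where `z_k = n^{-1/2} ∑ ψ_k(U_i)` and `R_F` is
the remainder beyond the finite set `F`
(`IsKernelExpansion.nullInProb_mul_sampleTop_sub`). The trace term is `∫ K(x, x) dx - λ₁ - ∑_F λ_k`.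
It vanishes as `F` grows by the trace formula `∑ λ = ∫ K(x, x) dx` (`hasSum_eigenvalue`), valid for
continuous `K` with absolutely summable eigenvalues. For fixed `F` the `z_k` converge jointly to
independent standard normal variables (`IsKernelExpansion.tendstoInDistribution_sampleCoord`), and
`tendstoInDistribution_of_approx` lets `F` exhaust the spectrum.
-/

namespace RandomKernel

open scoped RealInnerProductSpace

/-! ### Two-sided bounds for the largest eigenvalue of a symmetric operator -/

/-- **Kato–Temple inequality.** If the quadratic form of `T` is at most `b` on the orthogonal
complement of a trial vector `x`, and `b` lies below the Rayleigh quotient of `x`, then the largest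
eigenvalue exceeds that quotient by at most the square of the residual over the gap. -/
theorem topEigenvalue_le_rayleigh_add {E : Type*} [NormedAddCommGroup E] [InnerProductSpace ℝ E]
    {T : E →ₗ[ℝ] E} (hT : T.IsSymmetric) {ℓ : ℝ} (hℓ : ∀ x, ⟪x, T x⟫ ≤ ℓ * ‖x‖ ^ 2)
    {y : E} (hy : y ≠ 0) (hTy : T y = ℓ • y) {x : E} (hx : x ≠ 0) {b : ℝ}
    (hb : ∀ w, ⟪x, w⟫ = 0 → ⟪w, T w⟫ ≤ b * ‖w‖ ^ 2) (hbρ : b < ⟪x, T x⟫ / ‖x‖ ^ 2) (θ : ℝ) :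
    ℓ ≤ ⟪x, T x⟫ / ‖x‖ ^ 2
      + ‖T x - θ • x‖ ^ 2 / ((⟪x, T x⟫ / ‖x‖ ^ 2 - b) * ‖x‖ ^ 2) := by
  have hs : 0 < ‖x‖ ^ 2 := by positivity
  set s := ‖x‖ ^ 2 with hs'
  set ρ := ⟪x, T x⟫ / s with hρ
  have hq : ⟪x, T x⟫ = ρ * s := by rw [hρ]; field_simp
  set e := ‖T x - θ • x‖ with he
  have hρℓ : ρ ≤ ℓ := by rw [hρ, div_le_iff₀ hs]; exact hℓ x
  -- decompose the eigenvector along the trial vector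
  set a := ⟪x, y⟫ / s with ha
  set w := y - a • x with hw
  have hyw : y = a • x + w := by simp [hw]
  have hxw : ⟪x, w⟫ = 0 := by
    rw [hw, inner_sub_right, inner_smul_right, real_inner_self_eq_norm_sq, ha]
    rw [div_mul_cancel₀ _ hs.ne', sub_self]
  have hwx : ⟪w, x⟫ = 0 := by rw [real_inner_comm, hxw]
  have hny : ‖y‖ ^ 2 = a ^ 2 * s + ‖w‖ ^ 2 := by
    rw [hyw, ← real_inner_self_eq_norm_sq]
    simp only [inner_add_left, inner_add_right, inner_smul_left, inner_smul_right, hxw, hwx,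
      real_inner_self_eq_norm_sq]
    simp only [conj_trivial]; ring
  have hTw : ⟪x, T w⟫ = ⟪w, T x⟫ := by rw [← hT x w, real_inner_comm]
  have hwT : ⟪w, T x⟫ = ⟪w, T x - θ • x⟫ := by
    rw [inner_sub_right, inner_smul_right, hwx]; simp
  have hyT : ⟪y, T y⟫ = a ^ 2 * (ρ * s) + 2 * a * ⟪w, T x - θ • x⟫ + ⟪w, T w⟫ := by
    rw [hyw, map_add, map_smul]
    simp only [inner_add_left, inner_add_right, inner_smul_left, inner_smul_right, hTw, hq]
    simp only [conj_trivial, hwT]; ring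
  have hyT' : ⟪y, T y⟫ = ℓ * ‖y‖ ^ 2 := by
    rw [hTy, inner_smul_right, real_inner_self_eq_norm_sq]
  have hcs : a * ⟪w, T x - θ • x⟫ ≤ |a| * (‖w‖ * e) := by
    refine (le_abs_self _).trans ?_
    rw [abs_mul]
    exact mul_le_mul_of_nonneg_left (abs_real_inner_le_norm _ _) (abs_nonneg _)
  have key : (ℓ - ρ) * (a ^ 2 * s) + (ℓ - b) * ‖w‖ ^ 2 ≤ 2 * (|a| * (‖w‖ * e)) := by
    have := hb w hxw
    rw [hny] at hyT'
    nlinarith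
  have hgap : 0 < ρ - b := by linarith
  have ha0 : a ≠ 0 := by
    intro h0
    have hw0 : ‖w‖ ^ 2 ≤ 0 := by
      rw [h0] at key
      simp only [abs_zero, zero_mul, mul_zero] at key
      nlinarith [sq_nonneg ‖w‖]
    have : ‖y‖ ^ 2 ≤ 0 := by rw [hny, h0]; linarith [hw0]
    exact hy (by simpa using le_antisymm this (sq_nonneg _))
  have hsq : 2 * (|a| * (‖w‖ * e)) ≤ (ρ - b) * ‖w‖ ^ 2 + |a| ^ 2 * e ^ 2 / (ρ - b) := by
    have h1 := sq_nonneg ((ρ - b) * ‖w‖ - |a| * e)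
    have h2 : (ρ - b) * ‖w‖ ^ 2 + |a| ^ 2 * e ^ 2 / (ρ - b) - 2 * (|a| * (‖w‖ * e))
        = ((ρ - b) * ‖w‖ - |a| * e) ^ 2 / (ρ - b) := by
      field_simp; ring
    have h3 := div_nonneg h1 hgap.le
    linarith
  have h4 : (ℓ - ρ) * (a ^ 2 * s) ≤ a ^ 2 * e ^ 2 / (ρ - b) := by
    rw [sq_abs] at hsq
    nlinarith [mul_nonneg (sub_nonneg.2 hρℓ) (sq_nonneg ‖w‖)]
  have ha2 : 0 < a ^ 2 := by positivity
  have h5 : (ℓ - ρ) * s ≤ e ^ 2 / (ρ - b) := by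
    have : a ^ 2 * ((ℓ - ρ) * s) ≤ a ^ 2 * (e ^ 2 / (ρ - b)) := by
      calc a ^ 2 * ((ℓ - ρ) * s) = (ℓ - ρ) * (a ^ 2 * s) := by ring
        _ ≤ a ^ 2 * e ^ 2 / (ρ - b) := h4
        _ = _ := by ring
    exact le_of_mul_le_mul_left this ha2
  have h6 : ℓ - ρ ≤ e ^ 2 / ((ρ - b) * s) := by
    rw [← div_div, le_div_iff₀ hs]; exact h5
  linarith

/-- Bessel's inequality for an almost orthonormal family: `γ` bounds the Hilbert–Schmidt distance
of the Gram matrix to the identity. -/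
theorem sum_inner_sq_le {E ι : Type*} [NormedAddCommGroup E] [InnerProductSpace ℝ E]
    [DecidableEq ι] (F : Finset ι) (e : ι → E) {γ : ℝ} (hγ0 : 0 ≤ γ)
    (hγ : ∑ k ∈ F, ∑ l ∈ F, (⟪e k, e l⟫ - if k = l then 1 else 0) ^ 2 ≤ γ ^ 2) (y : E) :
    ∑ k ∈ F, ⟪e k, y⟫ ^ 2 ≤ (1 + γ) * ‖y‖ ^ 2 := by
  set c : ι → ℝ := fun k => ⟪e k, y⟫ with hc
  set s := ∑ k ∈ F, c k ^ 2 with hs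
  have hs0 : 0 ≤ s := Finset.sum_nonneg fun k _ => sq_nonneg _
  have h1 : s = ⟪∑ k ∈ F, c k • e k, y⟫ := by
    rw [sum_inner, hs]
    refine Finset.sum_congr rfl fun k _ => ?_
    rw [inner_smul_left, conj_trivial, sq]
  have h2 : ‖∑ k ∈ F, c k • e k‖ ^ 2 ≤ (1 + γ) * s := by
    have e1 : ‖∑ k ∈ F, c k • e k‖ ^ 2
        = s + ∑ p ∈ F ×ˢ F, (c p.1 * c p.2) * (⟪e p.1, e p.2⟫ - if p.1 = p.2 then 1 else 0) := by
      rw [← real_inner_self_eq_norm_sq, sum_inner, Finset.sum_product, hs, ← Finset.sum_add_distrib]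
      refine Finset.sum_congr rfl fun k hk => ?_
      rw [inner_sum]
      simp only [mul_sub, Finset.sum_sub_distrib, mul_ite, mul_one, mul_zero, Finset.sum_ite_eq,
        if_pos hk,
        inner_smul_left, inner_smul_right, conj_trivial]
      have : ∀ l, c l * (c k * ⟪e k, e l⟫) = c k * c l * ⟪e k, e l⟫ := fun l => by ring
      simp only [this]
      ring_nf
    have e2 : (∑ p ∈ F ×ˢ F, (c p.1 * c p.2) *
        (⟪e p.1, e p.2⟫ - if p.1 = p.2 then 1 else 0)) ^ 2 ≤ s ^ 2 * γ ^ 2 := by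
      refine (Finset.sum_mul_sq_le_sq_mul_sq _ _ _).trans ?_
      refine mul_le_mul (le_of_eq ?_) ?_ (Finset.sum_nonneg fun _ _ => sq_nonneg _) (sq_nonneg _)
      · rw [Finset.sum_product, hs, sq, Finset.sum_mul_sum]
        simp only [mul_pow]
      · rw [Finset.sum_product]; exact hγ
    rw [← mul_pow] at e2
    have e3 := (le_abs_self _).trans (abs_le_of_sq_le_sq e2 (mul_nonneg hs0 hγ0))
    rw [e1]; linarith
  have h3 : s ^ 2 ≤ (1 + γ) * s * ‖y‖ ^ 2 := by
    have := abs_real_inner_le_norm (∑ k ∈ F, c k • e k) y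
    rw [← h1, abs_of_nonneg hs0] at this
    calc s ^ 2 ≤ (‖∑ k ∈ F, c k • e k‖ * ‖y‖) ^ 2 := by gcongr
      _ = ‖∑ k ∈ F, c k • e k‖ ^ 2 * ‖y‖ ^ 2 := by ring
      _ ≤ _ := by gcongr
  rcases hs0.eq_or_lt with h0 | h0
  · rw [← h0]; positivity
  · have : s * s ≤ s * ((1 + γ) * ‖y‖ ^ 2) := by nlinarith
    exact le_of_mul_le_mul_left this h0

/-- Spectral gap below a perturbation `v + w` of the leading direction `v`, for an operator given
up to a small remainder by an almost orthonormal expansion. -/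
theorem inner_map_le_of_inner_add_eq_zero {E ι : Type*} [NormedAddCommGroup E]
    [InnerProductSpace ℝ E] [DecidableEq ι] (F : Finset ι) {lam : ι → ℝ} {e : ι → E} {v w : E}
    {T R : E →ₗ[ℝ] E} {lam₁ t r γ : ℝ}
    (hT : ∀ x, T x = (lam₁ * ⟪v, x⟫) • v + ∑ k ∈ F, (lam k * ⟪e k, x⟫) • e k + R x)
    (hlam₁ : 0 ≤ lam₁) (ht : 0 ≤ t) (hlam : ∀ k ∈ F, lam k ≤ t)
    (hR : ∀ x, ⟪x, R x⟫ ≤ r * ‖x‖ ^ 2) (hγ0 : 0 ≤ γ)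
    (hγ : ∑ k ∈ F, ∑ l ∈ F, (⟪e k, e l⟫ - if k = l then 1 else 0) ^ 2 ≤ γ ^ 2)
    (y : E) (hy : ⟪v + w, y⟫ = 0) :
    ⟪y, T y⟫ ≤ (lam₁ * ‖w‖ ^ 2 + t * (1 + γ) + r) * ‖y‖ ^ 2 := by
  have h1 : ⟪y, T y⟫ = lam₁ * ⟪v, y⟫ ^ 2 + ∑ k ∈ F, lam k * ⟪e k, y⟫ ^ 2 + ⟪y, R y⟫ := by
    rw [hT, inner_add_right, inner_add_right, inner_smul_right, inner_sum, real_inner_comm v y]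
    congr 2
    · ring
    · refine Finset.sum_congr rfl fun k _ => ?_
      rw [inner_smul_right, real_inner_comm y (e k)]; ring
  have h2 : ⟪v, y⟫ ^ 2 ≤ ‖w‖ ^ 2 * ‖y‖ ^ 2 := by
    have : ⟪v, y⟫ = -⟪w, y⟫ := by rw [inner_add_left] at hy; linarith
    rw [this, neg_sq, ← mul_pow, ← sq_abs]
    gcongr
    exact abs_real_inner_le_norm _ _
  have h3 : ∑ k ∈ F, lam k * ⟪e k, y⟫ ^ 2 ≤ t * ((1 + γ) * ‖y‖ ^ 2) := by
    calc ∑ k ∈ F, lam k * ⟪e k, y⟫ ^ 2 ≤ ∑ k ∈ F, t * ⟪e k, y⟫ ^ 2 :=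
          Finset.sum_le_sum fun k hk => mul_le_mul_of_nonneg_right (hlam k hk) (sq_nonneg _)
      _ = t * ∑ k ∈ F, ⟪e k, y⟫ ^ 2 := by rw [Finset.mul_sum]
      _ ≤ _ := mul_le_mul_of_nonneg_left (sum_inner_sq_le F e hγ0 hγ y) ht
  rw [h1]
  nlinarith [hR y, mul_le_mul_of_nonneg_left h2 hlam₁]

/-! ### The largest eigenvalue of a kernel matrix -/

theorem largestEigenvalue_spec {n : ℕ} (hn : 0 < n) {A : Matrix (Fin n) (Fin n) ℝ}
    (hA : A.IsHermitian) :
    (∀ x, ⟪x, A.toEuclideanLin x⟫ ≤ largestEigenvalue A * ‖x‖ ^ 2) ∧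
      ∃ y, y ≠ 0 ∧ A.toEuclideanLin y = largestEigenvalue A • y := by
  have : Nonempty (Fin n) := ⟨⟨0, hn⟩⟩
  have hℓ : largestEigenvalue A = sSup (Set.range hA.eigenvalues) := by
    rw [largestEigenvalue, hA.spectrum_real_eq_range_eigenvalues]
  have hfin := Set.finite_range hA.eigenvalues
  have hb : ∀ i, A.toEuclideanLin (hA.eigenvectorBasis i)
      = hA.eigenvalues i • hA.eigenvectorBasis i := by
    intro i
    ext j
    have := congrFun (hA.mulVec_eigenvectorBasis i) j
    simpa using this
  constructor
  · intro x
    have hsym : (A.toEuclideanLin).IsSymmetric := Matrix.isSymmetric_toEuclideanLin_iff.2 hA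
    rw [← OrthonormalBasis.sum_inner_mul_inner hA.eigenvectorBasis,
      ← real_inner_self_eq_norm_sq, ← OrthonormalBasis.sum_inner_mul_inner hA.eigenvectorBasis,
      Finset.mul_sum]
    refine Finset.sum_le_sum fun i _ => ?_
    rw [← hsym, hb, inner_smul_left, conj_trivial, real_inner_comm x]
    have : hA.eigenvalues i ≤ largestEigenvalue A := by
      rw [hℓ]; exact le_csSup hfin.bddAbove ⟨i, rfl⟩
    nlinarith [mul_self_nonneg ⟪hA.eigenvectorBasis i, x⟫]
  · obtain ⟨i, hi⟩ := (Set.range_nonempty hA.eigenvalues).csSup_mem hfin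
    refine ⟨hA.eigenvectorBasis i, ?_, ?_⟩
    · exact hA.eigenvectorBasis.orthonormal.ne_zero i
    · rw [hb, hℓ, hi]

theorem isHermitian_kernelMatrix {K : C(I × I, ℝ)} (hsymm : ∀ x y : I, K (x, y) = K (y, x)) {n : ℕ}
    (u : Fin n → I) : (kernelMatrix K u).IsHermitian := by
  ext i j
  simp [kernelMatrix, hsymm (u i) (u j)]

theorem inner_toEuclideanLin_kernelMatrix (K : C(I × I, ℝ)) {n : ℕ} (u : Fin n → I)
    (x : EuclideanSpace ℝ (Fin n)) :
    ⟪x, (kernelMatrix K u).toEuclideanLin x⟫ = ∑ i, ∑ j, x i * (K (u i, u j) * x j) := by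
  simp only [PiLp.inner_apply, Matrix.ofLp_toLpLin, Matrix.toLin'_apply, Matrix.mulVec, dotProduct,
    kernelMatrix, Matrix.of_apply, RCLike.inner_apply, conj_trivial]
  refine Finset.sum_congr rfl fun i _ => ?_
  rw [mul_comm, Finset.mul_sum]

theorem measurable_largestEigenvalue {K : C(I × I, ℝ)} (hsymm : ∀ x y : I, K (x, y) = K (y, x))
    (n : ℕ) : Measurable fun u : Fin n → I => largestEigenvalue (kernelMatrix K u) := by
  rcases Nat.eq_zero_or_pos n with rfl | hn
  · exact Subsingleton.measurable
  -- a sublevel set is cut out by the closed conditions on the quadratic form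
  refine measurable_of_Iic fun c => IsClosed.measurableSet ?_
  have : (fun u : Fin n → I => largestEigenvalue (kernelMatrix K u)) ⁻¹' Set.Iic c
      = ⋂ x : EuclideanSpace ℝ (Fin n),
        {u | ∑ i, ∑ j, x i * (K (u i, u j) * x j) ≤ c * ‖x‖ ^ 2} := by
    ext u
    obtain ⟨h1, y, hy, hTy⟩ := largestEigenvalue_spec hn (isHermitian_kernelMatrix hsymm u)
    simp only [Set.mem_preimage, Set.mem_Iic, Set.mem_iInter, Set.mem_ofPred_eq,
      ← inner_toEuclideanLin_kernelMatrix]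
    constructor
    · intro h x
      exact (h1 x).trans (mul_le_mul_of_nonneg_right h (sq_nonneg _))
    · intro h
      have := h y
      rw [hTy, inner_smul_right, real_inner_self_eq_norm_sq] at this
      exact le_of_mul_le_mul_right this (by positivity)
  rw [this]
  refine isClosed_iInter fun x => isClosed_le ?_ continuous_const
  fun_prop

/-! ### Stochastic order symbols -/

section StochasticOrder

variable {Ω ι : Type*} [MeasurableSpace Ω] {P : Measure Ω} {l : Filter ι} {X Y Z : ι → Ω → ℝ}

/-- The family `X` is bounded in probability along `l`, i.e. `X = O_P(1)`. No measurability is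
required: `P` is used as an outer measure. -/
def BoundedInProb (P : Measure Ω) (l : Filter ι) (X : ι → Ω → ℝ) : Prop :=
  ∀ ε > 0, ∃ C : ℝ, ∀ᶠ i in l, P.real {ω | C < |X i ω|} ≤ ε

/-- The family `X` tends to zero in probability along `l`, i.e. `X = o_P(1)`, with `P` used as an
outer measure. -/
def NullInProb (P : Measure Ω) (l : Filter ι) (X : ι → Ω → ℝ) : Prop :=
  ∀ δ > 0, ∀ ε > 0, ∀ᶠ i in l, P.real {ω | δ < |X i ω|} ≤ ε

theorem NullInProb.boundedInProb (hX : NullInProb P l X) : BoundedInProb P l X :=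
  fun ε hε => ⟨1, hX 1 one_pos ε hε⟩

theorem boundedInProb_const (c : ℝ) : BoundedInProb P l fun _ _ => c :=
  fun ε hε => ⟨|c|, Eventually.of_forall fun i => by simpa using hε.le⟩

theorem nullInProb_zero : NullInProb P l fun _ _ => (0 : ℝ) :=
  fun δ hδ ε hε => Eventually.of_forall fun i => by simpa [hδ.not_gt] using hε.le

theorem nullInProb_of_tendsto {c : ι → ℝ} (hc : Tendsto c l (𝓝 0)) :
    NullInProb P l fun i _ => c i := by
  intro δ hδ ε hε
  have : ∀ᶠ i in l, |c i| < δ := by simpa using (Metric.tendsto_nhds.1 hc) δ hδ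
  filter_upwards [this] with i hi
  simpa [hi.not_gt] using hε.le

theorem NullInProb.curry {κ α : Type*} {l : Filter κ} {l' : Filter α} {X : κ × α → Ω → ℝ}
    (h : ∀ k, NullInProb P l' fun n => X (k, n)) : NullInProb P (l.curry l') X :=
  fun δ hδ ε hε => eventually_curry_iff.2 (Eventually.of_forall fun k => h k δ hδ ε hε)

theorem NullInProb.of_curry {κ α : Type*} {l : Filter κ} [l.NeBot] {l' : Filter α} {X : α → Ω → ℝ}
    (h : NullInProb P (l.curry l') fun p : κ × α => X p.2) : NullInProb P l' X :=
  fun δ hδ ε hε => (eventually_curry_iff.1 (h δ hδ ε hε)).exists.choose_spec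

theorem NullInProb.comp_snd {κ α : Type*} (l : Filter κ) {l' : Filter α} {X : α → Ω → ℝ}
    (h : NullInProb P l' X) : NullInProb P (l.curry l') fun p : κ × α => X p.2 :=
  NullInProb.curry fun _ => h

variable [IsFiniteMeasure P]

theorem NullInProb.mono_of_small {δ : ℝ} (hZ : NullInProb P l Z) (hδ : 0 < δ)
    (hY : NullInProb P l Y) (h : ∀ᶠ i in l, ∀ ω, |Z i ω| ≤ δ → |X i ω| ≤ |Y i ω|) :
    NullInProb P l X := by
  intro η hη ε hε
  filter_upwards [hZ δ hδ (ε / 2) (half_pos hε), hY η hη (ε / 2) (half_pos hε), h] with i h1 h2 h3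
  calc P.real {ω | η < |X i ω|} ≤ P.real ({ω | δ < |Z i ω|} ∪ {ω | η < |Y i ω|}) := by
        refine measureReal_mono fun ω hω => ?_
        by_cases hz : |Z i ω| ≤ δ
        · exact Or.inr (lt_of_lt_of_le hω (h3 ω hz))
        · exact Or.inl (not_le.1 hz)
    _ ≤ _ := measureReal_union_le _ _
    _ ≤ ε := by linarith

theorem NullInProb.mono (hY : NullInProb P l Y) (h : ∀ᶠ i in l, ∀ ω, |X i ω| ≤ |Y i ω|) :
    NullInProb P l X :=
  hY.mono_of_small one_pos hY (h.mono fun _ h ω _ => h ω)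

theorem BoundedInProb.mono (hY : BoundedInProb P l Y) (h : ∀ᶠ i in l, ∀ ω, |X i ω| ≤ |Y i ω|) :
    BoundedInProb P l X := by
  intro ε hε
  obtain ⟨C, hC⟩ := hY ε hε
  refine ⟨C, ?_⟩
  filter_upwards [hC, h] with i h1 h2
  exact (measureReal_mono fun ω hω => lt_of_lt_of_le hω (h2 ω)).trans h1

theorem NullInProb.congr (hY : NullInProb P l Y) (h : ∀ᶠ i in l, ∀ ω, X i ω = Y i ω) :
    NullInProb P l X :=
  hY.mono (h.mono fun _ h ω => by rw [h ω])

theorem BoundedInProb.congr (hY : BoundedInProb P l Y) (h : ∀ᶠ i in l, ∀ ω, X i ω = Y i ω) :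
    BoundedInProb P l X :=
  hY.mono (h.mono fun _ h ω => by rw [h ω])

theorem NullInProb.add (hX : NullInProb P l X) (hY : NullInProb P l Y) :
    NullInProb P l fun i ω => X i ω + Y i ω := by
  intro δ hδ ε hε
  filter_upwards [hX (δ / 2) (half_pos hδ) (ε / 2) (half_pos hε),
    hY (δ / 2) (half_pos hδ) (ε / 2) (half_pos hε)] with i h1 h2
  calc P.real {ω | δ < |X i ω + Y i ω|}
      ≤ P.real ({ω | δ / 2 < |X i ω|} ∪ {ω | δ / 2 < |Y i ω|}) := by
        refine measureReal_mono fun ω hω => ?_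
        by_contra hc
        simp only [Set.mem_union, Set.mem_ofPred_eq, not_or, not_lt] at hc hω
        linarith [abs_add_le (X i ω) (Y i ω)]
    _ ≤ _ := measureReal_union_le _ _
    _ ≤ ε := by linarith

theorem BoundedInProb.add (hX : BoundedInProb P l X) (hY : BoundedInProb P l Y) :
    BoundedInProb P l fun i ω => X i ω + Y i ω := by
  intro ε hε
  obtain ⟨C, hC⟩ := hX (ε / 2) (half_pos hε)
  obtain ⟨D, hD⟩ := hY (ε / 2) (half_pos hε)
  refine ⟨C + D, ?_⟩
  filter_upwards [hC, hD] with i h1 h2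
  calc P.real {ω | C + D < |X i ω + Y i ω|}
      ≤ P.real ({ω | C < |X i ω|} ∪ {ω | D < |Y i ω|}) := by
        refine measureReal_mono fun ω hω => ?_
        by_contra hc
        simp only [Set.mem_union, Set.mem_ofPred_eq, not_or, not_lt] at hc hω
        linarith [abs_add_le (X i ω) (Y i ω)]
    _ ≤ _ := measureReal_union_le _ _
    _ ≤ ε := by linarith

theorem NullInProb.mul_boundedInProb (hX : NullInProb P l X) (hY : BoundedInProb P l Y) :
    NullInProb P l fun i ω => X i ω * Y i ω := by
  intro δ hδ ε hε
  obtain ⟨C, hC⟩ := hY (ε / 2) (half_pos hε)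
  have hD : 0 < |C| + 1 := by positivity
  filter_upwards [hX (δ / (|C| + 1)) (div_pos hδ hD) (ε / 2) (half_pos hε), hC] with i h1 h2
  calc P.real {ω | δ < |X i ω * Y i ω|}
      ≤ P.real ({ω | δ / (|C| + 1) < |X i ω|} ∪ {ω | C < |Y i ω|}) := by
        refine measureReal_mono fun ω hω => ?_
        by_contra hc
        simp only [Set.mem_union, Set.mem_ofPred_eq, not_or, not_lt] at hc hω
        rw [abs_mul] at hω
        have h3 : |Y i ω| ≤ |C| + 1 := by linarith [hc.2, le_abs_self C]
        have h4 := mul_le_mul hc.1 h3 (abs_nonneg _) (div_pos hδ hD).le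
        rw [div_mul_cancel₀ _ hD.ne'] at h4
        linarith
    _ ≤ _ := measureReal_union_le _ _
    _ ≤ ε := by linarith

theorem BoundedInProb.mul (hX : BoundedInProb P l X) (hY : BoundedInProb P l Y) :
    BoundedInProb P l fun i ω => X i ω * Y i ω := by
  intro ε hε
  obtain ⟨C, hC⟩ := hX (ε / 2) (half_pos hε)
  obtain ⟨D, hD⟩ := hY (ε / 2) (half_pos hε)
  refine ⟨|C| * |D|, ?_⟩
  filter_upwards [hC, hD] with i h1 h2
  calc P.real {ω | |C| * |D| < |X i ω * Y i ω|}
      ≤ P.real ({ω | C < |X i ω|} ∪ {ω | D < |Y i ω|}) := by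
        refine measureReal_mono fun ω hω => ?_
        by_contra hc
        simp only [Set.mem_union, Set.mem_ofPred_eq, not_or, not_lt] at hc hω
        rw [abs_mul] at hω
        have := mul_le_mul (hc.1.trans (le_abs_self C)) (hc.2.trans (le_abs_self D))
          (abs_nonneg _) (abs_nonneg C)
        linarith
    _ ≤ _ := measureReal_union_le _ _
    _ ≤ ε := by linarith

theorem NullInProb.const_mul (c : ℝ) (hX : NullInProb P l X) :
    NullInProb P l fun i ω => c * X i ω :=
  (hX.mul_boundedInProb (boundedInProb_const c)).congr
    (Eventually.of_forall fun _ _ => mul_comm _ _)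

theorem BoundedInProb.const_mul (c : ℝ) (hX : BoundedInProb P l X) :
    BoundedInProb P l fun i ω => c * X i ω :=
  (boundedInProb_const c).mul hX

theorem NullInProb.sub (hX : NullInProb P l X) (hY : NullInProb P l Y) :
    NullInProb P l fun i ω => X i ω - Y i ω :=
  (hX.add (hY.const_mul (-1))).congr (Eventually.of_forall fun _ _ => by ring)

theorem NullInProb.sum {κ : Type*} {F : Finset κ} {X : κ → ι → Ω → ℝ}
    (h : ∀ k ∈ F, NullInProb P l (X k)) : NullInProb P l fun i ω => ∑ k ∈ F, X k i ω := by
  classical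
  induction F using Finset.induction_on with
  | empty => simpa using nullInProb_zero
  | insert a s ha ih =>
    simp only [Finset.sum_insert ha]
    exact (h a (by simp)).add (ih fun k hk => h k (by simp [hk]))

theorem NullInProb.abs (hX : NullInProb P l X) : NullInProb P l fun i ω => |X i ω| :=
  hX.mono (Eventually.of_forall fun _ _ => by rw [abs_abs])

theorem NullInProb.sqrt (hX : NullInProb P l X) : NullInProb P l fun i ω => √(X i ω) := by
  intro δ hδ ε hε
  filter_upwards [hX (δ ^ 2) (by positivity) ε hε] with i hi
  refine (measureReal_mono fun ω hω => ?_).trans hi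
  simp only [Set.mem_ofPred_eq] at hω ⊢
  rw [abs_of_nonneg (Real.sqrt_nonneg _)] at hω
  exact ((Real.lt_sqrt hδ.le).1 hω).trans_le (le_abs_self _)

theorem BoundedInProb.sqrt (hX : BoundedInProb P l X) : BoundedInProb P l fun i ω => √(X i ω) := by
  intro ε hε
  obtain ⟨C, hC⟩ := hX ε hε
  refine ⟨√|C|, ?_⟩
  filter_upwards [hC] with i hi
  refine (measureReal_mono fun ω hω => ?_).trans hi
  simp only [Set.mem_ofPred_eq] at hω ⊢
  rw [abs_of_nonneg (Real.sqrt_nonneg _)] at hω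
  have := (Real.sqrt_lt_sqrt_iff (abs_nonneg C)).1 hω
  linarith [le_abs_self C, le_abs_self (X i ω)]

theorem nullInProb_of_sq (hX : NullInProb P l fun i ω => X i ω ^ 2) : NullInProb P l X :=
  hX.sqrt.mono (Eventually.of_forall fun i ω => by
    rw [abs_of_nonneg (Real.sqrt_nonneg _), Real.sqrt_sq_eq_abs])

theorem boundedInProb_of_sq (hX : BoundedInProb P l fun i ω => X i ω ^ 2) : BoundedInProb P l X :=
  hX.sqrt.mono (Eventually.of_forall fun i ω => by
    rw [abs_of_nonneg (Real.sqrt_nonneg _), Real.sqrt_sq_eq_abs])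

theorem NullInProb.sq (hX : NullInProb P l X) : NullInProb P l fun i ω => X i ω ^ 2 :=
  (hX.mul_boundedInProb hX.boundedInProb).congr (Eventually.of_forall fun _ _ => by ring)

/-- `1 / s → 1` in probability when `s → 1` in probability. -/
theorem NullInProb.inv_sub_one (hX : NullInProb P l fun i ω => X i ω - 1) :
    NullInProb P l fun i ω => (X i ω)⁻¹ - 1 := by
  refine hX.mono_of_small one_half_pos (hX.const_mul 2) (Eventually.of_forall fun i ω h => ?_)
  obtain ⟨h1, h2⟩ := abs_le.1 h
  have hpos : 1 / 2 ≤ X i ω := by linarith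
  have h0 : 0 < X i ω := by linarith
  have : (X i ω)⁻¹ - 1 = -((X i ω)⁻¹ * (X i ω - 1)) := by field_simp; ring
  rw [this, abs_neg, abs_mul, abs_mul, abs_two, abs_of_pos (inv_pos.2 h0)]
  refine mul_le_mul_of_nonneg_right ?_ (abs_nonneg _)
  rw [inv_le_comm₀ h0 two_pos]; linarith

theorem measureReal_lt_le_integral_div {X : Ω → ℝ} (h0 : ∀ ω, 0 ≤ X ω) (hX : Integrable X P)
    {δ : ℝ} (hδ : 0 < δ) : P.real {ω | δ < |X ω|} ≤ (∫ ω, X ω ∂P) / δ := by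
  rw [le_div_iff₀ hδ, mul_comm]
  refine le_trans (mul_le_mul_of_nonneg_left (measureReal_mono fun ω hω => ?_) hδ.le)
    (mul_meas_ge_le_integral_of_nonneg (Eventually.of_forall h0) hX δ)
  simp only [Set.mem_ofPred_eq] at hω ⊢
  rw [abs_of_nonneg (h0 ω)] at hω
  exact hω.le

theorem boundedInProb_of_integral_le {C : ℝ} (h0 : ∀ i ω, 0 ≤ X i ω)
    (hX : ∀ᶠ i in l, Integrable (X i) P) (h : ∀ᶠ i in l, ∫ ω, X i ω ∂P ≤ C) :
    BoundedInProb P l X := by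
  intro ε hε
  have hC : 0 < |C| + 1 := by positivity
  refine ⟨(|C| + 1) / ε, ?_⟩
  filter_upwards [hX, h] with i h1 h2
  refine (measureReal_lt_le_integral_div (h0 i) h1 (div_pos hC hε)).trans ?_
  rw [div_div_eq_mul_div, div_le_iff₀ hC, mul_comm]
  exact mul_le_mul_of_nonneg_left (by linarith [le_abs_self C]) hε.le

theorem nullInProb_of_integral_le (h0 : ∀ i ω, 0 ≤ X i ω)
    (hX : ∀ᶠ i in l, Integrable (X i) P) (h : ∀ ε > 0, ∀ᶠ i in l, ∫ ω, X i ω ∂P ≤ ε) :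
    NullInProb P l X := by
  intro δ hδ ε hε
  filter_upwards [hX, h (ε * δ) (by positivity)] with i h1 h2
  refine (measureReal_lt_le_integral_div (h0 i) h1 hδ).trans ?_
  rwa [div_le_iff₀ hδ]

end StochasticOrder

/-! ### Convergence in distribution through approximations -/

section Approximation

variable {Ω Ω' : Type*} [MeasurableSpace Ω] [MeasurableSpace Ω'] {P : Measure Ω} {P' : Measure Ω'}
  [IsProbabilityMeasure P] [IsProbabilityMeasure P']

theorem abs_integral_comp_sub_le {X Y : Ω → ℝ} (hX : AEMeasurable X P) (hY : AEMeasurable Y P)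
    {f : ℝ → ℝ} {M : ℝ} (hM : ∀ x y, dist (f x) (f y) ≤ M) {L : ℝ≥0} (hL : LipschitzWith L f)
    {δ : ℝ} (hδ : 0 ≤ δ) :
    |∫ ω, f (Y ω) ∂P - ∫ ω, f (X ω) ∂P| ≤ L * δ + M * P.real {ω | δ < |Y ω - X ω|} := by
  have hint : ∀ {V : Ω → ℝ}, AEMeasurable V P → Integrable (fun ω => f (V ω)) P := by
    intro V hV
    refine Integrable.of_bound (C := ‖f 0‖ + M)
      (hL.continuous.measurable.comp_aemeasurable hV).aestronglyMeasurable
      (Eventually.of_forall fun ω => ?_)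
    have := norm_sub_norm_le (f (V ω)) (f 0)
    rw [← dist_eq_norm] at this
    linarith [hM (V ω) 0]
  have hA : NullMeasurableSet {ω | δ < |Y ω - X ω|} P :=
    nullMeasurableSet_lt aemeasurable_const (hY.sub hX).abs
  have hM0 : 0 ≤ M := dist_nonneg.trans (hM 0 0)
  have hind : Integrable ({ω | δ < |Y ω - X ω|}.indicator fun _ => M) P :=
    (integrable_const M).indicator₀ hA
  rw [← integral_sub (hint hY) (hint hX), ← Real.norm_eq_abs]
  calc ‖∫ ω, f (Y ω) - f (X ω) ∂P‖
      ≤ ∫ ω, ((L : ℝ) * δ + {ω | δ < |Y ω - X ω|}.indicator (fun _ => M) ω) ∂P := by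
        refine norm_integral_le_of_norm_le ((integrable_const _).add hind)
          (Eventually.of_forall fun ω => ?_)
        rw [← dist_eq_norm]
        by_cases h : δ < |Y ω - X ω|
        · rw [Set.indicator_of_mem (by exact h)]
          exact (hM _ _).trans (le_add_of_nonneg_left (by positivity))
        · rw [Set.indicator_of_notMem (by exact h), add_zero]
          refine (hL.dist_le_mul _ _).trans ?_
          rw [Real.dist_eq]
          exact mul_le_mul_of_nonneg_left (not_lt.1 h) L.coe_nonneg
    _ = _ := by
        rw [integral_add (integrable_const _) hind, integral_indicator₀ hA]
        simp [mul_comm]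

/-- Converging together: if `X k n → V k` in distribution as `n → ∞` for every `k`, `V k → W` in
probability, and `Y n - X k n` is asymptotically negligible as `n → ∞` followed by the limit in
`k`, then `Y n → W` in distribution. -/
theorem tendstoInDistribution_of_approx {κ : Type*} {l : Filter κ} [l.NeBot] {Y : ℕ → Ω → ℝ}
    {X : κ → ℕ → Ω → ℝ} {V : κ → Ω' → ℝ} {W : Ω' → ℝ}
    (hX : ∀ k, TendstoInDistribution (X k) atTop (V k) (fun _ => P) P')
    (hV : NullInProb P' l fun k ω => V k ω - W ω)
    (hXY : NullInProb P (l.curry atTop) fun p ω => Y p.2 ω - X p.1 p.2 ω)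
    (hY : ∀ n, AEMeasurable (Y n) P) (hW : AEMeasurable W P') :
    TendstoInDistribution Y atTop W (fun _ => P) P' := by
  refine ⟨hY, hW, tendsto_iff_forall_lipschitz_integral_tendsto.2 ?_⟩
  rintro f ⟨M, hM⟩ ⟨L, hL⟩
  have hM0 : 0 ≤ M := dist_nonneg.trans (hM 0 0)
  have hXf : ∀ k, Tendsto (fun n => ∫ ω, f (X k n ω) ∂P) atTop (𝓝 (∫ ω, f (V k ω) ∂P')) := by
    intro k
    have h := tendsto_iff_forall_lipschitz_integral_tendsto.1 (hX k).tendsto f ⟨M, hM⟩ ⟨L, hL⟩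
    simp only [ProbabilityMeasure.coe_mk] at h
    rw [integral_map (hX k).aemeasurable_limit hL.continuous.aestronglyMeasurable] at h
    refine h.congr fun n => ?_
    exact integral_map ((hX k).forall_aemeasurable n) hL.continuous.aestronglyMeasurable
  simp only [ProbabilityMeasure.coe_mk]
  rw [integral_map hW hL.continuous.aestronglyMeasurable]
  have hYf : ∀ n, ∫ x, f x ∂(P.map (Y n)) = ∫ ω, f (Y n ω) ∂P := fun n =>
    integral_map (hY n) hL.continuous.aestronglyMeasurable
  simp only [hYf]
  rw [Metric.tendsto_nhds]
  intro ε hε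
  set δ := ε / (5 * (L + 1)) with hδ
  have hL1 : (0 : ℝ) < L + 1 := by positivity
  have hδ0 : 0 < δ := by positivity
  have hLδ : L * δ ≤ ε / 5 := by
    rw [hδ, mul_div_assoc', div_le_div_iff₀ (by positivity) (by norm_num)]
    nlinarith
  set η := ε / (5 * (M + 1)) with hη
  have hη0 : 0 < η := by positivity
  have hMη : M * η < ε / 5 := by
    rw [hη, mul_div_assoc', div_lt_div_iff₀ (by positivity) (by norm_num)]
    nlinarith
  obtain ⟨k, hk1, hk2⟩ := ((hV δ hδ0 η hη0).and
    (eventually_curry_iff.1 (hXY δ hδ0 η hη0))).exists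
  filter_upwards [hk2, (Metric.tendsto_nhds.1 (hXf k)) (ε / 5) (by positivity)] with n h1 h2
  rw [Real.dist_eq] at h2 ⊢
  have h3 := abs_integral_comp_sub_le ((hX k).forall_aemeasurable n) (hY n) hM hL hδ0.le
  have h4 := abs_integral_comp_sub_le hW (hX k).aemeasurable_limit hM hL hδ0.le
  have h5 : M * P.real {ω | δ < |Y n ω - X k n ω|} ≤ M * η := mul_le_mul_of_nonneg_left h1 hM0
  have h6 : M * P'.real {ω | δ < |V k ω - W ω|} ≤ M * η := mul_le_mul_of_nonneg_left hk1 hM0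
  have h7 := abs_sub_le (∫ ω, f (Y n ω) ∂P) (∫ ω, f (X k n ω) ∂P) (∫ ω, f (W ω) ∂P')
  have h8 := abs_sub_le (∫ ω, f (X k n ω) ∂P) (∫ ω, f (V k ω) ∂P') (∫ ω, f (W ω) ∂P')
  linarith

end Approximation

/-! ### Second moments of sums over an i.i.d. uniform sample -/

section Moments

variable {Ω : Type*} [MeasurableSpace Ω] {P : Measure Ω} {U : ℕ → Ω → I}

theorem integral_comp_eq (hU : ∀ i, HasLaw (U i) (volume : Measure I) P) (f : C(I, ℝ)) (i : ℕ) :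
    ∫ ω, f (U i ω) ∂P = ∫ x, f x := by
  rw [← (hU i).map_eq, integral_map (hU i).aemeasurable f.continuous.aestronglyMeasurable]

theorem integral_sq_sum_of_orthogonal {ι : Type*} (s : Finset ι) {X : ι → Ω → ℝ}
    (hX : ∀ i, MemLp (X i) 2 P)
    (h : ∀ i ∈ s, ∀ j ∈ s, i ≠ j → ∫ ω, X i ω * X j ω ∂P = 0) :
    ∫ ω, (∑ i ∈ s, X i ω) ^ 2 ∂P = ∑ i ∈ s, ∫ ω, X i ω ^ 2 ∂P := by
  have hint : ∀ i j, Integrable (fun ω => X i ω * X j ω) P := fun i j =>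
    (hX i).integrable_mul (hX j)
  simp only [sq, Finset.sum_mul_sum]
  rw [integral_finsetSum _ fun i _ => integrable_finsetSum _ fun j _ => hint i j]
  refine Finset.sum_congr rfl fun i hi => ?_
  rw [integral_finsetSum _ fun j _ => hint i j]
  exact Finset.sum_eq_single_of_mem i hi fun j hj hji => h i hi j hj hji.symm

variable [IsProbabilityMeasure P]

theorem memLp_two_comp (hU : ∀ i, Measurable (U i)) (f : C(I, ℝ)) (i : ℕ) :
    MemLp (fun ω => f (U i ω)) 2 P :=
  MemLp.of_bound (f.continuous.measurable.comp (hU i)).aestronglyMeasurable ‖f‖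
    (Eventually.of_forall fun _ => f.norm_coe_le_norm _)

theorem memLp_two_comp_prod (hU : ∀ i, Measurable (U i)) (h : C(I × I, ℝ)) (i j : ℕ) :
    MemLp (fun ω => h (U i ω, U j ω)) 2 P :=
  MemLp.of_bound (h.continuous.measurable.comp ((hU i).prodMk (hU j))).aestronglyMeasurable ‖h‖
    (Eventually.of_forall fun _ => h.norm_coe_le_norm _)

/-- A sample point outside `S` may be integrated out separately from the points in `S`. -/
theorem integral_comp_eq_integral_integral (hU : ∀ i, Measurable (U i))
    (hlaw : ∀ i, HasLaw (U i) (volume : Measure I) P) (hind : iIndepFun U P) {S : Finset ℕ} {j : ℕ}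
    (hj : j ∉ S) {f : (S → I) → I → ℝ} (hf : Continuous fun p : (S → I) × I => f p.1 p.2) :
    ∫ ω, f (fun i => U i ω) (U j ω) ∂P = ∫ ω, (∫ y, f (fun i => U i ω) y) ∂P := by
  have hW : Measurable fun ω (i : S) => U i ω := measurable_pi_lambda _ fun i => hU i
  have h1 : IndepFun (fun ω (i : S) => U i ω) (U j) P := by
    have := hind.indepFun_finset S {j} (by simpa using hj) hU
    exact this.comp (φ := id) (ψ := fun g : ({j} : Finset ℕ) → I => g ⟨j, by simp⟩)
      measurable_id (measurable_pi_apply _)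
  have h2 := (indepFun_iff_map_prod_eq_prod_map_map hW.aemeasurable (hU j).aemeasurable).1 h1
  have := Measure.isProbabilityMeasure_map (μ := P) hW.aemeasurable
  have hint : Integrable (fun p : (S → I) × I => f p.1 p.2)
      ((P.map fun ω (i : S) => U i ω).prod volume) := by
    obtain ⟨C, hC⟩ := (isCompact_range hf).isBounded.exists_norm_le
    exact Integrable.of_bound hf.aestronglyMeasurable C
      (Eventually.of_forall fun p => hC _ ⟨p, rfl⟩)
  calc ∫ ω, f (fun i => U i ω) (U j ω) ∂P
      = ∫ p, f p.1 p.2 ∂(P.map fun ω => ((fun i : S => U i ω), U j ω)) := by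
        rw [integral_map (hW.prodMk (hU j)).aemeasurable hf.aestronglyMeasurable]
    _ = ∫ x, (∫ y, f x y) ∂(P.map fun ω (i : S) => U i ω) := by
        rw [h2, (hlaw j).map_eq, integral_prod _ hint]
    _ = _ := by
        have hc : Continuous fun x : S → I => ∫ y, f x y := by
          simpa using continuous_parametric_integral_of_continuous (μ := (volume : Measure I)) hf
            isCompact_univ
        rw [integral_map hW.aemeasurable hc.aestronglyMeasurable]

theorem integral_comp_prod_eq (hU : ∀ i, Measurable (U i))
    (hlaw : ∀ i, HasLaw (U i) (volume : Measure I) P) (hind : iIndepFun U P) (h : C(I × I, ℝ))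
    {i j : ℕ} (hij : i ≠ j) : ∫ ω, h (U i ω, U j ω) ∂P = ∫ x, ∫ y, h (x, y) := by
  have h1 := integral_comp_eq_integral_integral hU hlaw hind (S := {i}) (j := j)
    (by simpa using hij.symm) (f := fun s y => h (s ⟨i, by simp⟩, y)) (by fun_prop)
  have hc : Continuous fun x => ∫ y, h (x, y) := by
    simpa using continuous_parametric_integral_of_continuous (μ := (volume : Measure I))
      (f := fun x y => h (x, y)) (by fun_prop) isCompact_univ
  rw [h1]
  exact integral_comp_eq hlaw ⟨fun x => ∫ y, h (x, y), hc⟩ i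

theorem integral_sq_sum_comp (hU : ∀ i, Measurable (U i))
    (hlaw : ∀ i, HasLaw (U i) (volume : Measure I) P) (hind : iIndepFun U P) {f : C(I, ℝ)}
    (hf : ∫ x, f x = 0) (n : ℕ) :
    ∫ ω, (∑ i ∈ Finset.range n, f (U i ω)) ^ 2 ∂P = n * ∫ x, f x ^ 2 := by
  rw [integral_sq_sum_of_orthogonal _ (fun i => memLp_two_comp hU f i)]
  · have : ∀ i, ∫ ω, f (U i ω) ^ 2 ∂P = ∫ x, f x ^ 2 := fun i =>
      integral_comp_eq hlaw (f ^ 2) i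
    simp [this]
  · intro i _ j _ hij
    have h1 := integral_comp_eq_integral_integral hU hlaw hind (S := {i}) (j := j)
      (by simpa using hij.symm) (f := fun s y => f (s ⟨i, by simp⟩) * f y) (by fun_prop)
    rw [h1]
    simp [integral_const_mul, hf]

/-- For a kernel centered in its second variable, distinct columns are orthogonal. -/
theorem integral_sum_sq_sum_comp (hU : ∀ i, Measurable (U i))
    (hlaw : ∀ i, HasLaw (U i) (volume : Measure I) P) (hind : iIndepFun U P) {h : C(I × I, ℝ)}
    (hh : ∀ x, ∫ y, h (x, y) = 0) (n : ℕ) :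
    ∫ ω, ∑ i ∈ Finset.range n, (∑ j ∈ Finset.range n, h (U i ω, U j ω)) ^ 2 ∂P
      = ∫ ω, ∑ i ∈ Finset.range n, ∑ j ∈ Finset.range n, h (U i ω, U j ω) ^ 2 ∂P := by
  have hL := memLp_two_comp_prod (P := P) hU h
  rw [integral_finsetSum _ fun i _ => (memLp_finsetSum _ fun j _ => hL i j).integrable_sq,
    integral_finsetSum _ fun i _ => integrable_finsetSum _ fun j _ => (hL i j).integrable_sq]
  refine Finset.sum_congr rfl fun i _ => ?_
  rw [integral_finsetSum _ fun j _ => (hL i j).integrable_sq,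
    integral_sq_sum_of_orthogonal _ (hL i)]
  -- one of the two column indices differs from the row index
  have key : ∀ j l, j ≠ l → j ≠ i → ∫ ω, h (U i ω, U j ω) * h (U i ω, U l ω) ∂P = 0 := by
    intro j l hjl hji
    have h1 := integral_comp_eq_integral_integral hU hlaw hind (S := {i, l}) (j := j)
      (by simp [hjl, hji])
      (f := fun s y => h (s ⟨i, by simp⟩, y) * h (s ⟨i, by simp⟩, s ⟨l, by simp⟩)) (by fun_prop)
    rw [h1]
    simp [integral_mul_const, hh]
  intro j _ l _ hjl
  by_cases hji : j = i
  · simp_rw [mul_comm (h (U i _, U j _))]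
    exact key l j hjl.symm (hji ▸ hjl.symm)
  · exact key j l hjl hji

/-- Second moment of a degenerate `U`-statistic with symmetric kernel. -/
theorem integral_sq_sum_offDiag (hU : ∀ i, Measurable (U i))
    (hlaw : ∀ i, HasLaw (U i) (volume : Measure I) P) (hind : iIndepFun U P) {h : C(I × I, ℝ)}
    (hsymm : ∀ x y, h (x, y) = h (y, x)) (hh : ∀ x, ∫ y, h (x, y) = 0) (n : ℕ) :
    ∫ ω, (∑ p ∈ (Finset.range n).offDiag, h (U p.1 ω, U p.2 ω)) ^ 2 ∂P
      ≤ 2 * (n : ℝ) ^ 2 * ∫ x, ∫ y, h (x, y) ^ 2 := by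
  have hL := memLp_two_comp_prod (P := P) hU h
  have hint : ∀ p q : ℕ × ℕ,
      Integrable (fun ω => h (U p.1 ω, U p.2 ω) * h (U q.1 ω, U q.2 ω)) P := fun p q =>
    (hL p.1 p.2).integrable_mul (hL q.1 q.2)
  -- an index of `(i, j)` that is missing from `(k, l)` is integrated out
  have key : ∀ i j k l, j ≠ i → j ≠ k → j ≠ l →
      ∫ ω, h (U i ω, U j ω) * h (U k ω, U l ω) ∂P = 0 := by
    intro i j k l h1 h2 h3
    have h4 := integral_comp_eq_integral_integral hU hlaw hind (S := {i, k, l}) (j := j)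
      (by simp [h1, h2, h3])
      (f := fun s y => h (s ⟨i, by simp⟩, y) * h (s ⟨k, by simp⟩, s ⟨l, by simp⟩)) (by fun_prop)
    rw [h4]
    simp [integral_mul_const, hh]
  have hsq : ∀ p ∈ (Finset.range n).offDiag,
      ∫ ω, h (U p.1 ω, U p.2 ω) * h (U p.1 ω, U p.2 ω) ∂P = ∫ x, ∫ y, h (x, y) ^ 2 := by
    intro p hp
    have := integral_comp_prod_eq hU hlaw hind (h ^ 2) (Finset.mem_offDiag.1 hp).2.2
    simpa [sq] using this
  have hI : 0 ≤ ∫ x, ∫ y, h (x, y) ^ 2 :=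
    integral_nonneg fun x => integral_nonneg fun y => sq_nonneg _
  have hp : ∀ p ∈ (Finset.range n).offDiag, ∑ q ∈ (Finset.range n).offDiag,
      ∫ ω, h (U p.1 ω, U p.2 ω) * h (U q.1 ω, U q.2 ω) ∂P = 2 * ∫ x, ∫ y, h (x, y) ^ 2 := by
    intro p hp
    have hp' := Finset.mem_offDiag.1 hp
    have hswap : p.swap ∈ (Finset.range n).offDiag :=
      Finset.mem_offDiag.2 ⟨hp'.2.1, hp'.1, hp'.2.2.symm⟩
    have hne : p ≠ p.swap := fun he => hp'.2.2 (congrArg Prod.fst he)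
    have hsub : ({p, p.swap} : Finset (ℕ × ℕ)) ⊆ (Finset.range n).offDiag := by
      intro q hq
      rcases Finset.mem_insert.1 hq with rfl | hq
      · exact hp
      · rwa [Finset.mem_singleton.1 hq]
    rw [← Finset.sum_subset hsub, Finset.sum_pair hne, hsq p hp]
    · have : ∀ ω, h (U p.swap.1 ω, U p.swap.2 ω) = h (U p.1 ω, U p.2 ω) := fun ω => hsymm _ _
      simp_rw [this]
      rw [hsq p hp]; ring
    · rintro ⟨k, l⟩ hq hq'
      obtain ⟨i, j⟩ := p
      simp only [Prod.swap_prod_mk, Finset.mem_insert, Finset.mem_singleton, Prod.mk.injEq,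
        not_or, not_and] at hq'
      have hkl : k ≠ l := (Finset.mem_offDiag.1 hq).2.2
      have hij : i ≠ j := hp'.2.2
      by_cases hj : j ≠ k ∧ j ≠ l
      · exact key i j k l hij.symm hj.1 hj.2
      · have hi : i ≠ k ∧ i ≠ l := by grind
        simp_rw [hsymm (U i _)]
        exact key j i k l hij hi.1 hi.2
  calc ∫ ω, (∑ p ∈ (Finset.range n).offDiag, h (U p.1 ω, U p.2 ω)) ^ 2 ∂P
      = ∑ p ∈ (Finset.range n).offDiag, ∑ q ∈ (Finset.range n).offDiag,
          ∫ ω, h (U p.1 ω, U p.2 ω) * h (U q.1 ω, U q.2 ω) ∂P := by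
        simp only [sq, Finset.sum_mul_sum]
        rw [integral_finsetSum _ fun p _ => integrable_finsetSum _ fun q _ => hint p q]
        exact Finset.sum_congr rfl fun p _ => integral_finsetSum _ fun q _ => hint p q
    _ = ((Finset.range n).offDiag.card : ℝ) * (2 * ∫ x, ∫ y, h (x, y) ^ 2) := by
        rw [Finset.sum_congr rfl hp, Finset.sum_const, nsmul_eq_mul]
    _ ≤ (n : ℝ) ^ 2 * (2 * ∫ x, ∫ y, h (x, y) ^ 2) := by
        refine mul_le_mul_of_nonneg_right ?_ (by positivity)
        rw [Finset.offDiag_card, Finset.card_range, sq]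
        exact_mod_cast Nat.sub_le _ _
    _ = _ := by ring

/-! ### Stochastic orders of sample averages -/

theorem boundedInProb_inv_sqrt_mul_sum (hU : ∀ i, Measurable (U i))
    (hlaw : ∀ i, HasLaw (U i) (volume : Measure I) P) (hind : iIndepFun U P) {f : C(I, ℝ)}
    (hf : ∫ x, f x = 0) :
    BoundedInProb P atTop fun (n : ℕ) ω => (√(n : ℝ))⁻¹ * ∑ i ∈ Finset.range n, f (U i ω) := by
  refine boundedInProb_of_sq (boundedInProb_of_integral_le (C := ∫ x, f x ^ 2)
    (fun _ _ => sq_nonneg _) (Eventually.of_forall fun n => ?_) ?_)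
  · exact ((memLp_finsetSum _ fun i _ => memLp_two_comp hU f i).const_mul _).integrable_sq
  · filter_upwards [eventually_gt_atTop 0] with n hn
    simp only [mul_pow]
    rw [integral_const_mul, integral_sq_sum_comp hU hlaw hind hf, inv_pow,
      Real.sq_sqrt (Nat.cast_nonneg n), inv_mul_cancel_left₀ (by positivity)]

/-- Weak law of large numbers. -/
theorem nullInProb_average_sub (hU : ∀ i, Measurable (U i))
    (hlaw : ∀ i, HasLaw (U i) (volume : Measure I) P) (hind : iIndepFun U P) (f : C(I, ℝ)) :
    NullInProb P atTop fun (n : ℕ) ω =>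
      (n : ℝ)⁻¹ * ∑ i ∈ Finset.range n, f (U i ω) - ∫ x, f x := by
  have h1 := boundedInProb_inv_sqrt_mul_sum hU hlaw hind
    (f := f - ContinuousMap.const I (∫ x, f x)) (by
      simp only [ContinuousMap.sub_apply, ContinuousMap.const_apply]
      rw [integral_sub (f.continuous.integrable_of_hasCompactSupport
        (HasCompactSupport.of_compactSpace _)) (integrable_const _)]
      simp)
  have h2 : Tendsto (fun n : ℕ => (√(n : ℝ))⁻¹) atTop (𝓝 0) :=
    tendsto_inv_atTop_zero.comp (Real.tendsto_sqrt_atTop.comp tendsto_natCast_atTop_atTop)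
  refine ((nullInProb_of_tendsto h2).mul_boundedInProb h1).congr ?_
  filter_upwards [eventually_gt_atTop 0] with n hn ω
  have hn' : (0 : ℝ) < n := by exact_mod_cast hn
  simp only [ContinuousMap.sub_apply, ContinuousMap.const_apply, Finset.sum_sub_distrib,
    Finset.sum_const, Finset.card_range, nsmul_eq_mul]
  rw [← mul_assoc, ← mul_inv, Real.mul_self_sqrt hn'.le, mul_sub, inv_mul_cancel_left₀ hn'.ne']

/-- Mean square of the entries of a kernel matrix, up to the diagonal of relative weight `1 / n`. -/
theorem integral_sum_sum_sq_le (hU : ∀ i, Measurable (U i))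
    (hlaw : ∀ i, HasLaw (U i) (volume : Measure I) P) (hind : iIndepFun U P) (h : C(I × I, ℝ))
    (n : ℕ) :
    ∫ ω, ∑ i ∈ Finset.range n, ∑ j ∈ Finset.range n, h (U i ω, U j ω) ^ 2 ∂P
      ≤ (n : ℝ) ^ 2 * (∫ x, ∫ y, h (x, y) ^ 2) + n * ‖h‖ ^ 2 := by
  have hL := memLp_two_comp_prod (P := P) hU h
  rw [integral_finsetSum _ fun i _ => integrable_finsetSum _ fun j _ => (hL i j).integrable_sq]
  have hI : 0 ≤ ∫ x, ∫ y, h (x, y) ^ 2 :=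
    integral_nonneg fun x => integral_nonneg fun y => sq_nonneg _
  have hentry : ∀ i j, ∫ ω, h (U i ω, U j ω) ^ 2 ∂P
      ≤ (∫ x, ∫ y, h (x, y) ^ 2) + if i = j then ‖h‖ ^ 2 else 0 := by
    intro i j
    split_ifs with hij
    · have : ∫ ω, h (U i ω, U j ω) ^ 2 ∂P ≤ ∫ _ω, ‖h‖ ^ 2 ∂P := by
        refine integral_mono (hL i j).integrable_sq (integrable_const _) fun ω => ?_
        change h (U i ω, U j ω) ^ 2 ≤ ‖h‖ ^ 2
        rw [← sq_abs]
        exact pow_le_pow_left₀ (abs_nonneg _) (h.norm_coe_le_norm _) 2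
      simp only [integral_const, probReal_univ, one_smul] at this
      linarith
    · rw [add_zero]
      exact (integral_comp_prod_eq hU hlaw hind (h ^ 2) hij).le
  calc ∑ i ∈ Finset.range n, ∫ ω, ∑ j ∈ Finset.range n, h (U i ω, U j ω) ^ 2 ∂P
      ≤ ∑ i ∈ Finset.range n, ∑ j ∈ Finset.range n,
          ((∫ x, ∫ y, h (x, y) ^ 2) + if i = j then ‖h‖ ^ 2 else 0) := by
        refine Finset.sum_le_sum fun i _ => ?_
        rw [integral_finsetSum _ fun j _ => (hL i j).integrable_sq]
        exact Finset.sum_le_sum fun j _ => hentry i j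
    _ = _ := by
        simp only [Finset.sum_add_distrib, Finset.sum_const, Finset.card_range, nsmul_eq_mul,
          Finset.sum_ite_eq, Finset.mem_range]
        rw [Finset.sum_ite_of_true (fun i hi => Finset.mem_range.1 hi)]
        simp only [Finset.sum_const, Finset.card_range, nsmul_eq_mul]
        ring

end Moments

/-! ### The integral operator of a symmetric continuous kernel -/

instance isOpenPosMeasure_unitInterval : (volume : Measure I).IsOpenPosMeasure := by
  refine ⟨fun V hV ⟨x, hx⟩ h0 => ?_⟩
  obtain ⟨W, hW, rfl⟩ := isOpen_induced_iff.1 hV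
  have hx' : (x : ℝ) ∈ closure (Set.Ioo (0 : ℝ) 1) := by
    rw [closure_Ioo zero_ne_one]; exact x.2
  have hne : (W ∩ Set.Ioo (0 : ℝ) 1).Nonempty := mem_closure_iff.1 hx' W hW hx
  rw [unitInterval.volume_apply] at h0
  refine ((hW.inter isOpen_Ioo).measure_pos volume hne).ne' (measure_mono_null ?_ h0)
  rintro y ⟨hyW, hy⟩
  exact ⟨⟨y, hy.1.le, hy.2.le⟩, hyW, rfl⟩

theorem integrable_continuous {X : Type*} [TopologicalSpace X] [CompactSpace X] [MeasurableSpace X]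
    [OpensMeasurableSpace X] [SecondCountableTopology X] {μ : Measure X} [IsFiniteMeasure μ]
    {f : X → ℝ} (hf : Continuous f) : Integrable f μ := by
  obtain ⟨C, hC⟩ := (isCompact_range hf).isBounded.exists_norm_le
  exact Integrable.of_bound hf.aestronglyMeasurable C (Eventually.of_forall fun p => hC _ ⟨p, rfl⟩)

/-- The class in `L²` of a continuous function. -/
noncomputable def contLp (f : C(I, ℝ)) : L2 := ContinuousMap.toLp (E := ℝ) 2 (volume : Measure I) ℝ f

theorem contLp_ae_eq (f : C(I, ℝ)) : contLp f =ᵐ[volume] f :=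
  ContinuousMap.coeFn_toLp (p := 2) (𝕜 := ℝ) (volume : Measure I) f

theorem contLp_injective : Function.Injective contLp :=
  ContinuousMap.toLp_injective (volume : Measure I)

theorem kernelOp_eq_contLp (K : C(I × I, ℝ)) (g : L2) : kernelOp K g = contLp (integralFun K g) :=
  rfl

theorem L2_inner_eq (f g : L2) : inner ℝ f g = ∫ x, f x * g x := by
  rw [L2.inner_def]
  exact integral_congr_ae (Eventually.of_forall fun x => by simp [mul_comm])

theorem inner_contLp (f g : C(I, ℝ)) : inner ℝ (contLp f) (contLp g) = ∫ x, f x * g x := by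
  rw [L2_inner_eq]
  refine integral_congr_ae ?_
  filter_upwards [contLp_ae_eq f, contLp_ae_eq g] with x h1 h2
  rw [h1, h2]

theorem integralFun_eq_inner (K : C(I × I, ℝ)) (g : L2) (x : I) :
    integralFun K g x = inner ℝ (contLp (K.curry x)) g := by
  rw [L2_inner_eq]
  refine integral_congr_ae ?_
  filter_upwards [contLp_ae_eq (K.curry x)] with y h1
  rw [h1]; rfl

theorem integralFun_contLp (K : C(I × I, ℝ)) (f : C(I, ℝ)) (x : I) :
    integralFun K (contLp f) x = ∫ y, K (x, y) * f y := by
  refine integral_congr_ae ?_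
  filter_upwards [contLp_ae_eq f] with y h1
  rw [h1]

theorem inner_kernelOp (K : C(I × I, ℝ)) (f g : L2) :
    inner ℝ f (kernelOp K g) = ∫ x, ∫ y, f x * (K (x, y) * g y) := by
  rw [L2_inner_eq]
  refine integral_congr_ae ?_
  filter_upwards [kernelOp_ae_eq K g] with x hx
  rw [hx, integral_const_mul]

theorem kernelOp_isSymmetric {K : C(I × I, ℝ)} (hsymm : ∀ x y : I, K (x, y) = K (y, x)) :
    (kernelOp K).IsSymmetric := by
  intro f g
  change inner ℝ (kernelOp K f) g = inner ℝ f (kernelOp K g)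
  rw [real_inner_comm, inner_kernelOp, inner_kernelOp, integral_integral_swap]
  · refine integral_congr_ae (Eventually.of_forall fun x => integral_congr_ae
      (Eventually.of_forall fun y => ?_))
    simp only [hsymm x y]; ring
  · have h1 : Integrable (fun p : I × I => g p.1 * f p.2) (volume.prod volume) :=
      (integrable_coe g).mul_prod (integrable_coe f)
    refine (h1.bdd_mul (c := ‖K‖) (f := K) K.continuous.aestronglyMeasurable
      (Eventually.of_forall K.norm_coe_le_norm)).congr (Eventually.of_forall fun p => ?_)
    simp only [Function.uncurry]; ring

/-- Compactness by Arzelà–Ascoli: the functions `T_K g`, `‖g‖ ≤ 1`, share the modulus of continuity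
of `x ↦ K(x, ·)` in `L²`. -/
theorem kernelOp_isCompactOperator (K : C(I × I, ℝ)) : IsCompactOperator (kernelOp K) := by
  rw [isCompactOperator_iff_exists_mem_nhds_image_subset_compact]
  refine ⟨Metric.closedBall 0 1, Metric.closedBall_mem_nhds _ one_pos, ?_⟩
  set A : Set (BoundedContinuousFunction I ℝ) :=
    (fun g => BoundedContinuousFunction.mkOfCompact (integralFun K g)) '' Metric.closedBall 0 1
  have hA : IsCompact (closure A) := by
    refine BoundedContinuousFunction.arzela_ascoli (Metric.closedBall 0 ‖K‖)
      (isCompact_closedBall _ _) A ?_ ?_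
    · rintro _ x ⟨g, hg, rfl⟩
      rw [mem_closedBall_zero_iff] at hg ⊢
      refine ((integralFun K g).norm_coe_le_norm x).trans ((norm_integralFun_le K g).trans ?_)
      exact mul_le_of_le_one_right (norm_nonneg _) hg
    · intro x
      refine Metric.equicontinuousAt_of_continuity_modulus
        (fun x' => ‖contLp (K.curry x) - contLp (K.curry x')‖) ?_ _ ?_
      · have h1 : Continuous fun x' => contLp (K.curry x') :=
          (ContinuousMap.toLp (E := ℝ) 2 (volume : Measure I) ℝ).continuous.comp K.curry.continuous
        have h2 : Continuous fun x' => ‖contLp (K.curry x) - contLp (K.curry x')‖ := by fun_prop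
        simpa using h2.tendsto x
      · refine Eventually.of_forall fun x' => ?_
        rintro ⟨_, g, hg, rfl⟩
        rw [mem_closedBall_zero_iff] at hg
        change dist (integralFun K g x) (integralFun K g x') ≤ _
        rw [Real.dist_eq, integralFun_eq_inner, integralFun_eq_inner, ← inner_sub_left]
        exact (abs_real_inner_le_norm _ _).trans (mul_le_of_le_one_right (norm_nonneg _) hg)
  refine ⟨BoundedContinuousFunction.toLp (E := ℝ) (p := 2) (volume : Measure I) ℝ '' closure A,
    hA.image (ContinuousLinearMap.continuous _), ?_⟩
  rintro _ ⟨g, hg, rfl⟩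
  exact ⟨_, subset_closure ⟨g, hg, rfl⟩, rfl⟩

/-! ### Eigenfunctions -/

/-- An orthonormal family of eigenvectors of `T_K` for its nonzero eigenvalues. -/
noncomputable def eigenvec (K : C(I × I, ℝ)) (i : EigenIndex K) : L2 :=
  haveI := (kernelOp K).finite_dimensional_eigenspace (kernelOp_isCompactOperator K) i.1.1 i.1.2.1
  (stdOrthonormalBasis ℝ (Module.End.eigenspace (kernelOp K).toLinearMap i.1.1) i.2 : L2)

theorem kernelOp_eigenvec (K : C(I × I, ℝ)) (i : EigenIndex K) :
    kernelOp K (eigenvec K i) = eigenvalue K i • eigenvec K i := by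
  have := (kernelOp K).finite_dimensional_eigenspace (kernelOp_isCompactOperator K) i.1.1 i.1.2.1
  exact Module.End.mem_eigenspace_iff.1
    (stdOrthonormalBasis ℝ (Module.End.eigenspace (kernelOp K).toLinearMap i.1.1) i.2).2

theorem eigenvalue_ne_zero (K : C(I × I, ℝ)) (i : EigenIndex K) : eigenvalue K i ≠ 0 := i.1.2.1

theorem inner_eq_zero_of_eigenvalue_ne {K : C(I × I, ℝ)}
    (hsymm : ∀ x y : I, K (x, y) = K (y, x)) {f g : L2} {a b : ℝ} (hf : kernelOp K f = a • f)
    (hg : kernelOp K g = b • g) (hab : a ≠ b) : inner ℝ f g = 0 := by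
  have h : inner ℝ (kernelOp K f) g = inner ℝ f (kernelOp K g) := kernelOp_isSymmetric hsymm f g
  rw [hf, hg, inner_smul_left, inner_smul_right, conj_trivial] at h
  have : (a - b) * inner ℝ f g = 0 := by rw [sub_mul, h, sub_self]
  exact (mul_eq_zero.1 this).resolve_left (sub_ne_zero.2 hab)

theorem orthonormal_eigenvec {K : C(I × I, ℝ)} (hsymm : ∀ x y : I, K (x, y) = K (y, x)) :
    Orthonormal ℝ (eigenvec K) := by
  have hfin := fun i : EigenIndex K =>
    (kernelOp K).finite_dimensional_eigenspace (kernelOp_isCompactOperator K) i.1.1 i.1.2.1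
  constructor
  · intro i
    have := hfin i
    exact (stdOrthonormalBasis ℝ
      (Module.End.eigenspace (kernelOp K).toLinearMap i.1.1)).orthonormal.1 i.2
  · rintro ⟨μ, i⟩ ⟨ν, j⟩ hij
    by_cases h : μ = ν
    · subst h
      have := hfin ⟨μ, i⟩
      have hij' : i ≠ j := fun h => hij (by rw [h])
      exact (stdOrthonormalBasis ℝ
        (Module.End.eigenspace (kernelOp K).toLinearMap μ.1)).orthonormal.2 hij'
    · exact inner_eq_zero_of_eigenvalue_ne hsymm (kernelOp_eigenvec K ⟨μ, i⟩)
        (kernelOp_eigenvec K ⟨ν, j⟩) fun h' => h (Subtype.ext h')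

/-- The operator vanishes on the orthogonal complement of its eigenvectors. -/
theorem integralFun_eq_zero_of_orthogonal {K : C(I × I, ℝ)}
    (hsymm : ∀ x y : I, K (x, y) = K (y, x)) {g : L2} (hg : ∀ i, inner ℝ (eigenvec K i) g = 0) :
    integralFun K g = 0 := by
  have hT := kernelOp_isSymmetric hsymm
  have h0 : kernelOp K g ∈
      (⨆ μ, Module.End.eigenspace (kernelOp K : Module.End ℝ L2) μ)ᗮ := by
    rw [← Submodule.iInf_orthogonal, Submodule.mem_iInf]
    intro μ
    rw [Submodule.mem_orthogonal]
    intro h hh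
    have hh' : kernelOp K h = μ • h := Module.End.mem_eigenspace_iff.1 hh
    have h1 : inner ℝ h (kernelOp K g) = μ * inner ℝ h g := by
      have : inner ℝ (kernelOp K h) g = inner ℝ h (kernelOp K g) := hT h g
      rw [← this, hh', inner_smul_left, conj_trivial]
    rw [h1]
    by_cases hμ : μ = 0
    · rw [hμ, zero_mul]
    by_cases hh0 : h = 0
    · rw [hh0, inner_zero_left, mul_zero]
    have hev : Module.End.HasEigenvalue (kernelOp K).toLinearMap μ :=
      Module.End.hasEigenvalue_of_hasEigenvector ⟨hh, hh0⟩
    have := (kernelOp K).finite_dimensional_eigenspace (kernelOp_isCompactOperator K) μ hμ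
    set B := stdOrthonormalBasis ℝ (Module.End.eigenspace (kernelOp K).toLinearMap μ) with hB
    have h2 : h = ∑ i, B.repr ⟨h, hh⟩ i • (B i : L2) := by
      have := congrArg Subtype.val (B.sum_repr ⟨h, hh⟩)
      simpa using this.symm
    rw [h2, sum_inner, Finset.sum_eq_zero, mul_zero]
    intro i _
    have h3 := hg ⟨⟨μ, hμ, hev⟩, i⟩
    rw [inner_smul_left]
    have h4 : inner ℝ ((B i : L2)) g = 0 := h3
    rw [h4, mul_zero]
  rw [(kernelOp K).orthogonalComplement_iSup_eigenspaces_eq_bot (kernelOp_isCompactOperator K) hT,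
    Submodule.mem_bot, kernelOp_eq_contLp] at h0
  exact contLp_injective (h0.trans (map_zero _).symm)

/-- A Hilbert basis of `L²` that contains the eigenvectors. -/
theorem hasSum_inner_eigenvec {K : C(I × I, ℝ)} (hsymm : ∀ x y : I, K (x, y) = K (y, x))
    {f : L2} (hf : ∀ g : L2, (∀ i, inner ℝ (eigenvec K i) g = 0) → inner ℝ f g = 0) (g : L2) :
    HasSum (fun i => inner ℝ f (eigenvec K i) * inner ℝ (eigenvec K i) g) (inner ℝ f g) := by
  have horth := orthonormal_eigenvec hsymm
  obtain ⟨w, b, hw, hb⟩ := horth.toSubtypeRange.exists_hilbertBasis_extension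
  have hmem : ∀ i, eigenvec K i ∈ w := fun i => hw ⟨i, rfl⟩
  have h1 := b.hasSum_inner_mul_inner f g
  have hinj : Function.Injective fun i => (⟨eigenvec K i, hmem i⟩ : w) := fun i j h =>
    horth.linearIndependent.injective (congrArg Subtype.val h)
  rw [← hinj.hasSum_iff] at h1
  · simpa [Function.comp_def, hb] using h1
  · intro y hy
    have : inner ℝ f (b y) = 0 := by
      refine hf _ fun i => ?_
      have hne : (⟨eigenvec K i, hmem i⟩ : w) ≠ y := fun h => hy ⟨i, h⟩
      have := b.orthonormal.2 hne
      simpa [hb] using this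
    rw [this, zero_mul]

/-- The continuous representative of an eigenvector. -/
noncomputable def eigenfun (K : C(I × I, ℝ)) (i : EigenIndex K) : C(I, ℝ) :=
  (eigenvalue K i)⁻¹ • integralFun K (eigenvec K i)

theorem contLp_inv_smul_integralFun {K : C(I × I, ℝ)} {f : L2} {a : ℝ} (ha : a ≠ 0)
    (hf : kernelOp K f = a • f) : contLp (a⁻¹ • integralFun K f) = f := by
  have h : contLp (a⁻¹ • integralFun K f) = a⁻¹ • contLp (integralFun K f) := map_smul _ _ _
  rw [h, ← kernelOp_eq_contLp, hf, inv_smul_smul₀ ha]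

theorem contLp_eigenfun (K : C(I × I, ℝ)) (i : EigenIndex K) :
    contLp (eigenfun K i) = eigenvec K i :=
  contLp_inv_smul_integralFun (eigenvalue_ne_zero K i) (kernelOp_eigenvec K i)

theorem integralFun_eigenvec (K : C(I × I, ℝ)) (i : EigenIndex K) (x : I) :
    integralFun K (eigenvec K i) x = eigenvalue K i * eigenfun K i x := by
  simp [eigenfun, eigenvalue_ne_zero]

/-- Expansion of `T_K g` at every point. -/
theorem hasSum_integralFun {K : C(I × I, ℝ)} (hsymm : ∀ x y : I, K (x, y) = K (y, x)) (g : L2)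
    (x : I) :
    HasSum (fun i => eigenvalue K i * eigenfun K i x * inner ℝ (eigenvec K i) g)
      (integralFun K g x) := by
  have h := hasSum_inner_eigenvec hsymm (f := contLp (K.curry x)) (fun g hg => by
    rw [← integralFun_eq_inner, integralFun_eq_zero_of_orthogonal hsymm hg]; rfl) g
  simpa only [← integralFun_eq_inner, integralFun_eigenvec] using h

theorem hasSum_inner_kernelOp {K : C(I × I, ℝ)} (hsymm : ∀ x y : I, K (x, y) = K (y, x)) (g : L2) :
    HasSum (fun i => eigenvalue K i * inner ℝ (eigenvec K i) g ^ 2) (inner ℝ g (kernelOp K g)) := by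
  have hT := kernelOp_isSymmetric hsymm
  have h := hasSum_inner_eigenvec hsymm (f := kernelOp K g) (fun f hf => by
    have : inner ℝ (kernelOp K g) f = inner ℝ g (kernelOp K f) := hT g f
    rw [this, kernelOp_eq_contLp, integralFun_eq_zero_of_orthogonal hsymm hf]
    rw [show contLp 0 = 0 from map_zero _, inner_zero_right]) g
  rw [real_inner_comm]
  convert h using 2 with i
  have : inner ℝ (kernelOp K g) (eigenvec K i) = inner ℝ g (kernelOp K (eigenvec K i)) :=
    hT g (eigenvec K i)
  rw [this, kernelOp_eigenvec, inner_smul_right, real_inner_comm g]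
  ring

theorem integral_eigenfun_mul (K : C(I × I, ℝ)) (hsymm : ∀ x y : I, K (x, y) = K (y, x))
    [DecidableEq (EigenIndex K)] (i j : EigenIndex K) :
    ∫ x, eigenfun K i x * eigenfun K j x = if i = j then 1 else 0 := by
  rw [← inner_contLp, contLp_eigenfun, contLp_eigenfun,
    orthonormal_iff_ite.1 (orthonormal_eigenvec hsymm) i j]

theorem integral_mul_eigenfun (K : C(I × I, ℝ)) (i : EigenIndex K) (x : I) :
    ∫ y, K (x, y) * eigenfun K i y = eigenvalue K i * eigenfun K i x := by
  rw [← integralFun_contLp, contLp_eigenfun, integralFun_eigenvec]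

theorem hasSum_sq_eigenfun {K : C(I × I, ℝ)} (hsymm : ∀ x y : I, K (x, y) = K (y, x)) (x : I) :
    HasSum (fun i => (eigenvalue K i * eigenfun K i x) ^ 2) (∫ y, K (x, y) ^ 2) := by
  have h := hasSum_integralFun hsymm (contLp (K.curry x)) x
  rw [integralFun_contLp] at h
  convert h using 2 with i
  · rw [real_inner_comm, ← integralFun_eq_inner, integralFun_eigenvec]; ring
  · funext y; rw [sq]; rfl

theorem integral_sq_eigenvalue_mul {K : C(I × I, ℝ)} (hsymm : ∀ x y : I, K (x, y) = K (y, x))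
    (i : EigenIndex K) :
    ∫ x, (eigenvalue K i * eigenfun K i x) ^ 2 = eigenvalue K i ^ 2 := by
  classical
  have := integral_eigenfun_mul K hsymm i i
  simp only [mul_pow, integral_const_mul]
  simp only [if_true, ← sq] at this
  rw [this, mul_one]

theorem summable_sq_eigenvalue {K : C(I × I, ℝ)} (hsymm : ∀ x y : I, K (x, y) = K (y, x)) :
    Summable fun i => eigenvalue K i ^ 2 := by
  refine summable_of_sum_le (c := ∫ x, ∫ y, K (x, y) ^ 2) (fun i => sq_nonneg _) fun F => ?_
  simp only [← integral_sq_eigenvalue_mul hsymm]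
  rw [← integral_finsetSum _ fun i _ => integrable_continuous (by fun_prop)]
  refine integral_mono (integrable_continuous (by fun_prop)) ?_ fun x =>
    sum_le_hasSum F (fun i _ => sq_nonneg _) (hasSum_sq_eigenfun hsymm x)
  exact integrable_continuous (by
    simpa using continuous_parametric_integral_of_continuous (μ := (volume : Measure I))
      (f := fun x y => K (x, y) ^ 2) (by fun_prop) isCompact_univ)

theorem countable_eigenIndex {K : C(I × I, ℝ)} (hsymm : ∀ x y : I, K (x, y) = K (y, x)) :
    Countable (EigenIndex K) := by
  have h := (summable_sq_eigenvalue hsymm).countable_support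
  have h2 : (Function.support fun i => eigenvalue K i ^ 2) = Set.univ := by
    ext i; simp [eigenvalue_ne_zero]
  rwa [h2, Set.countable_univ_iff] at h

/-- The Hilbert–Schmidt norm of `T_K` in terms of its eigenvalues. -/
theorem hasSum_sq_eigenvalue {K : C(I × I, ℝ)} (hsymm : ∀ x y : I, K (x, y) = K (y, x)) :
    HasSum (fun i => eigenvalue K i ^ 2) (∫ x, ∫ y, K (x, y) ^ 2) := by
  have := countable_eigenIndex hsymm
  have h := hasSum_integral_of_summable_integral_norm (μ := (volume : Measure I))
    (F := fun i x => (eigenvalue K i * eigenfun K i x) ^ 2)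
    (fun i => integrable_continuous (by fun_prop)) (by
      simp only [Real.norm_eq_abs, abs_pow, sq_abs]
      simpa only [integral_sq_eigenvalue_mul hsymm] using summable_sq_eigenvalue hsymm)
  simpa only [integral_sq_eigenvalue_mul hsymm, (hasSum_sq_eigenfun hsymm _).tsum_eq] using h

/-! ### The trace formula -/

/-- The `j`-th of `N + 1` half-open intervals that partition `[0, 1)`. -/
def cell (N : ℕ) (j : Fin (N + 1)) : Set I :=
  {x | (j : ℝ) / (N + 1) ≤ x ∧ (x : ℝ) < ((j : ℝ) + 1) / (N + 1)}

theorem measurableSet_cell (N : ℕ) (j : Fin (N + 1)) : MeasurableSet (cell N j) :=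
  (measurableSet_le measurable_const measurable_subtype_coe).inter
    (measurableSet_lt measurable_subtype_coe measurable_const)

theorem volume_cell (N : ℕ) (j : Fin (N + 1)) :
    (volume : Measure I).real (cell N j) = ((N : ℝ) + 1)⁻¹ := by
  have hN : (0 : ℝ) < N + 1 := by positivity
  have hj : (j : ℝ) + 1 ≤ N + 1 := by exact_mod_cast j.2
  have h : cell N j = Set.Ico (⟨(j : ℝ) / (N + 1), by positivity, by
      rw [div_le_one hN]; linarith⟩ : I)
      (⟨((j : ℝ) + 1) / (N + 1), by positivity, by rwa [div_le_one hN]⟩ : I) := by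
    ext x; simp [cell, ← Subtype.coe_le_coe, ← Subtype.coe_lt_coe]
  rw [h, measureReal_def, unitInterval.volume_Ico, ENNReal.toReal_ofReal]
  · simp only [add_div, add_sub_cancel_left, one_div]
  · simp only [add_div, add_sub_cancel_left, one_div]; positivity

theorem disjoint_cell (N : ℕ) {i j : Fin (N + 1)} (hij : i ≠ j) :
    Disjoint (cell N i) (cell N j) := by
  have hN : (0 : ℝ) < N + 1 := by positivity
  have key : ∀ {i j : Fin (N + 1)}, i < j → Disjoint (cell N i) (cell N j) := by
    intro i j h
    rw [Set.disjoint_left]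
    rintro x ⟨_, h1⟩ ⟨h2, _⟩
    have h3 : ((i : ℝ) + 1) / (N + 1) ≤ (j : ℝ) / (N + 1) := by
      gcongr; exact_mod_cast h
    linarith
  rcases lt_or_gt_of_ne hij with h | h
  · exact key h
  · exact (key h).symm

theorem dist_lt_of_mem_cell {N : ℕ} {j : Fin (N + 1)} {x y : I} (hx : x ∈ cell N j)
    (hy : y ∈ cell N j) : dist x y < ((N : ℝ) + 1)⁻¹ := by
  obtain ⟨h1, h2⟩ := hx
  obtain ⟨h3, h4⟩ := hy
  rw [add_div, one_div] at h2 h4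
  rw [Subtype.dist_eq, Real.dist_eq, abs_lt]
  constructor <;> linarith

theorem iUnion_cell_ae (N : ℕ) : (⋃ j, cell N j : Set I) =ᵐ[volume] Set.univ := by
  rw [ae_eq_univ]
  refine measure_mono_null (t := {1}) (fun x hx => ?_) (measure_singleton _)
  by_contra h1
  have hN : (0 : ℝ) < N + 1 := by positivity
  have hx1 : (x : ℝ) < 1 := lt_of_le_of_ne x.2.2 fun h => h1 (Subtype.ext h)
  refine hx (Set.mem_iUnion.2 ⟨⟨⌊(x : ℝ) * (N + 1)⌋₊, ?_⟩, ?_, ?_⟩)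
  · rw [Nat.floor_lt (mul_nonneg x.2.1 hN.le)]
    push_cast
    nlinarith
  · rw [div_le_iff₀ hN]
    exact Nat.floor_le (mul_nonneg x.2.1 hN.le)
  · rw [lt_div_iff₀ hN]
    exact Nat.lt_floor_add_one _

/-- Averages of a continuous kernel over small squares along the diagonal converge to its integral
over the diagonal. -/
theorem tendsto_sum_cell (H : C(I × I, ℝ)) :
    Tendsto (fun N : ℕ => ∑ j : Fin (N + 1),
      ((N : ℝ) + 1) * ∫ x in cell N j, ∫ y in cell N j, H (x, y)) atTop (𝓝 (∫ x, H (x, x))) := by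
  rw [Metric.tendsto_nhds]
  intro ε hε
  obtain ⟨δ, hδ, hH⟩ := Metric.uniformContinuous_iff.1
    (CompactSpace.uniformContinuous_of_continuous H.continuous) (ε / 2) (half_pos hε)
  have hN : ∀ᶠ N : ℕ in atTop, ((N : ℝ) + 1)⁻¹ < δ := by
    have h : Tendsto (fun N : ℕ => ((N : ℝ) + 1)⁻¹) atTop (𝓝 0) := by
      simpa using tendsto_one_div_add_atTop_nhds_zero_nat (𝕜 := ℝ)
    exact h.eventually_lt_const hδ
  filter_upwards [hN] with N hN
  have hN1 : (0 : ℝ) < N + 1 := by positivity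
  have hdiag : ∫ x, H (x, x) = ∑ j : Fin (N + 1), ∫ x in cell N j, H (x, x) := by
    rw [← setIntegral_univ, ← setIntegral_congr_set (iUnion_cell_ae N),
      integral_iUnion_fintype (measurableSet_cell N) (fun i j hij => disjoint_cell N hij)
        fun j => (integrable_continuous (by fun_prop)).integrableOn]
  have hcont : Continuous fun x => H (x, x) := by fun_prop
  rw [hdiag, Real.dist_eq, ← Finset.sum_sub_distrib]
  have hterm : ∀ j : Fin (N + 1), |((N : ℝ) + 1) * (∫ x in cell N j, ∫ y in cell N j, H (x, y))
      - ∫ x in cell N j, H (x, x)| ≤ ε / 2 * ((N : ℝ) + 1)⁻¹ := by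
    intro j
    have hfin : ∀ s : Set I, IsFiniteMeasure ((volume : Measure I).restrict s) := fun s =>
      inferInstance
    have hc2 : Continuous fun x => ∫ y in cell N j, H (x, y) := by
      simpa using continuous_parametric_integral_of_continuous
        (μ := (volume : Measure I).restrict (cell N j)) (f := fun x y => H (x, y)) (by fun_prop)
        isCompact_univ
    rw [← integral_const_mul, ← integral_sub (integrable_continuous (by fun_prop))
      (integrable_continuous hcont), ← volume_cell N j, ← Real.norm_eq_abs]
    refine norm_setIntegral_le_of_norm_le_const (by finiteness) fun x hx => ?_
    have h1 : ((N : ℝ) + 1) * (∫ y in cell N j, H (x, y)) - H (x, x)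
        = ((N : ℝ) + 1) * ∫ y in cell N j, (H (x, y) - H (x, x)) := by
      rw [integral_sub (integrable_continuous (by fun_prop)) (integrable_const _)]
      simp only [integral_const, MeasurableSet.univ, measureReal_restrict_apply, Set.univ_inter,
        volume_cell, smul_eq_mul]
      field_simp
    have h2 : ‖∫ y in cell N j, (H (x, y) - H (x, x))‖ ≤ ε / 2 * ((N : ℝ) + 1)⁻¹ := by
      rw [← volume_cell N j]
      refine norm_setIntegral_le_of_norm_le_const (by finiteness) fun y hy => ?_
      rw [← dist_eq_norm]
      refine (hH ?_).le
      rw [Prod.dist_eq, dist_self, max_lt_iff]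
      exact ⟨hδ, (dist_lt_of_mem_cell hy hx).trans hN⟩
    rw [h1, norm_mul, Real.norm_of_nonneg hN1.le]
    calc ((N : ℝ) + 1) * ‖∫ y in cell N j, (H (x, y) - H (x, x))‖
        ≤ ((N : ℝ) + 1) * (ε / 2 * ((N : ℝ) + 1)⁻¹) := by gcongr
      _ = ε / 2 := by field_simp
  calc |∑ j : Fin (N + 1), (((N : ℝ) + 1) * (∫ x in cell N j, ∫ y in cell N j, H (x, y))
          - ∫ x in cell N j, H (x, x))|
      ≤ ∑ j : Fin (N + 1), ε / 2 * ((N : ℝ) + 1)⁻¹ :=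
        (Finset.abs_sum_le_sum_abs _ _).trans (Finset.sum_le_sum fun j _ => hterm j)
    _ = ε / 2 := by
        simp only [Finset.sum_const, Finset.card_univ, Fintype.card_fin, nsmul_eq_mul]
        push_cast; field_simp
    _ < ε := half_lt_self hε

/-- The normalized indicator of a cell. -/
noncomputable def cellVec (N : ℕ) (j : Fin (N + 1)) : L2 :=
  indicatorConstLp 2 (measurableSet_cell N j) (measure_ne_top _ _) (√((N : ℝ) + 1))

theorem cellVec_ae_eq (N : ℕ) (j : Fin (N + 1)) :
    cellVec N j =ᵐ[volume] (cell N j).indicator fun _ => √((N : ℝ) + 1) :=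
  indicatorConstLp_coeFn

theorem orthonormal_cellVec (N : ℕ) : Orthonormal ℝ (cellVec N) := by
  have hN : (0 : ℝ) < N + 1 := by positivity
  rw [orthonormal_iff_ite]
  intro i j
  have h : inner ℝ (cellVec N i) (cellVec N j)
      = ∫ x, (cell N i ∩ cell N j).indicator (fun _ => (N : ℝ) + 1) x := by
    rw [L2_inner_eq]
    refine integral_congr_ae ?_
    filter_upwards [cellVec_ae_eq N i, cellVec_ae_eq N j] with x h1 h2
    rw [h1, h2]
    by_cases hi : x ∈ cell N i <;> by_cases hj : x ∈ cell N j <;>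
      simp [hi, hj, Real.mul_self_sqrt hN.le]
  rw [h]
  split_ifs with hij
  · subst hij
    rw [Set.inter_self, integral_indicator (measurableSet_cell N i)]
    simp [volume_cell, hN.ne']
  · rw [(disjoint_cell N hij).inter_eq]; simp

theorem inner_cellVec_kernelOp (H : C(I × I, ℝ)) (N : ℕ) (j : Fin (N + 1)) :
    inner ℝ (cellVec N j) (kernelOp H (cellVec N j))
      = ((N : ℝ) + 1) * ∫ x in cell N j, ∫ y in cell N j, H (x, y) := by
  have hN : (0 : ℝ) < N + 1 := by positivity
  have h1 : ∀ x, ∫ y, H (x, y) * cellVec N j y = √((N : ℝ) + 1) * ∫ y in cell N j, H (x, y) := by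
    intro x
    rw [← integral_const_mul, ← integral_indicator (measurableSet_cell N j)]
    refine integral_congr_ae ?_
    filter_upwards [cellVec_ae_eq N j] with y hy
    rw [hy]
    by_cases h : y ∈ cell N j <;> simp [h, mul_comm]
  rw [L2_inner_eq, ← integral_const_mul, ← integral_indicator (measurableSet_cell N j)]
  refine integral_congr_ae ?_
  filter_upwards [cellVec_ae_eq N j, kernelOp_ae_eq H (cellVec N j)] with x h2 h3
  rw [h2, h3, h1]
  by_cases h : x ∈ cell N j
  · simp only [Set.indicator_of_mem h]
    rw [← mul_assoc, Real.mul_self_sqrt hN.le]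
  · simp [h]

theorem sum_sq_inner_cellVec (f : C(I, ℝ)) (N : ℕ) (j : Fin (N + 1)) :
    inner ℝ (cellVec N j) (contLp f) ^ 2 = ((N : ℝ) + 1) *
      ∫ x in cell N j, ∫ y in cell N j, f x * f y := by
  have hN : (0 : ℝ) < N + 1 := by positivity
  have h : inner ℝ (cellVec N j) (contLp f) = √((N : ℝ) + 1) * ∫ x in cell N j, f x := by
    rw [L2_inner_eq, ← integral_const_mul, ← integral_indicator (measurableSet_cell N j)]
    refine integral_congr_ae ?_
    filter_upwards [cellVec_ae_eq N j, contLp_ae_eq f] with x h1 h2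
    rw [h1, h2]
    by_cases h : x ∈ cell N j <;> simp [h]
  simp only [h, integral_const_mul, integral_mul_const, mul_pow, Real.sq_sqrt hN.le]
  ring

/-- **Trace formula** for a continuous kernel with absolutely summable eigenvalues. -/
theorem hasSum_eigenvalue {K : C(I × I, ℝ)} (hsymm : ∀ x y : I, K (x, y) = K (y, x))
    (hsum : Summable fun i => |eigenvalue K i|) :
    HasSum (eigenvalue K) (∫ x, K (x, x)) := by
  classical
  set q : ℕ → EigenIndex K → ℝ := fun N i =>
    ∑ j : Fin (N + 1), inner ℝ (cellVec N j) (eigenvec K i) ^ 2 with hq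
  have hq1 : ∀ N i, q N i ≤ 1 := by
    intro N i
    have := (orthonormal_cellVec N).sum_inner_products_le (eigenvec K i) (s := Finset.univ)
    simpa [(orthonormal_eigenvec hsymm).1 i] using this
  have hq0 : ∀ N i, 0 ≤ q N i := fun N i => Finset.sum_nonneg fun j _ => sq_nonneg _
  have hqt : ∀ i, Tendsto (fun N => q N i) atTop (𝓝 1) := by
    intro i
    have h := tendsto_sum_cell ⟨fun p => eigenfun K i p.1 * eigenfun K i p.2, by fun_prop⟩
    have h1 := integral_eigenfun_mul K hsymm i i
    rw [if_pos rfl] at h1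
    simp only [ContinuousMap.coe_mk, h1] at h
    simpa only [hq, ← contLp_eigenfun, sum_sq_inner_cellVec] using h
  have htr : ∀ N : ℕ, ∑' i, eigenvalue K i * q N i = ∑ j : Fin (N + 1),
      ((N : ℝ) + 1) * ∫ x in cell N j, ∫ y in cell N j, K (x, y) := by
    intro N
    simp only [← inner_cellVec_kernelOp]
    have := hasSum_sum (s := Finset.univ) fun (j : Fin (N + 1)) _ =>
      hasSum_inner_kernelOp hsymm (cellVec N j)
    rw [← this.tsum_eq]
    refine tsum_congr fun i => ?_
    rw [hq, Finset.mul_sum]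
    exact Finset.sum_congr rfl fun j _ => by rw [real_inner_comm]
  have h1 : Tendsto (fun N => ∑' i, eigenvalue K i * q N i) atTop (𝓝 (∑' i, eigenvalue K i)) := by
    refine tendsto_tsum_of_dominated_convergence hsum (fun i => ?_)
      (Eventually.of_forall fun N i => ?_)
    · simpa using (hqt i).const_mul (eigenvalue K i)
    · rw [norm_mul, Real.norm_eq_abs, Real.norm_of_nonneg (hq0 N i)]
      exact mul_le_of_le_one_right (abs_nonneg _) (hq1 N i)
  simp only [htr] at h1
  rw [tendsto_nhds_unique (tendsto_sum_cell K) h1]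
  exact hsum.of_abs.hasSum

/-! ### The leading eigenvalue -/

/-- The spectral gap makes the largest eigenvalue simple and separates it from all others. -/
theorem exists_index_eq_posEigenvalue {K : C(I × I, ℝ)} (hsymm : ∀ x y : I, K (x, y) = K (y, x))
    (hgap : 0 < |posEigenvalue K 1 - posEigenvalue K 2|) :
    ∃ i₀ : EigenIndex K, ∃ t, 0 < t ∧ t < posEigenvalue K 1 ∧ eigenvalue K i₀ = posEigenvalue K 1 ∧
      ∀ i ≠ i₀, eigenvalue K i ≤ t := by
  set S : ℕ → Set ℝ := fun j =>
    {0} ∪ {t : ℝ | 0 < t ∧ (j : ℕ∞) ≤ {i : EigenIndex K | t ≤ eigenvalue K i}.encard} with hS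
  have hpos : ∀ j, posEigenvalue K j = sSup (S j) := fun j => rfl
  have hex : ∀ {t : ℝ}, ((1 : ℕ) : ℕ∞) ≤ {i : EigenIndex K | t ≤ eigenvalue K i}.encard →
      ∃ i, t ≤ eigenvalue K i := by
    intro t ht
    rw [Nat.cast_one, Set.one_le_encard_iff_nonempty] at ht
    exact ht
  have hanti : S 2 ⊆ S 1 := by
    refine Set.union_subset_union_right _ fun t ht => ⟨ht.1, le_trans ?_ ht.2⟩
    norm_num
  have hbdd : BddAbove (S 1) := by
    refine ⟨(∫ x, ∫ y, K (x, y) ^ 2) + 1, ?_⟩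
    have hle : ∀ i, eigenvalue K i ^ 2 ≤ ∫ x, ∫ y, K (x, y) ^ 2 := fun i =>
      le_hasSum (hasSum_sq_eigenvalue hsymm) i fun _ _ => sq_nonneg _
    rintro t (rfl | ht)
    · have : 0 ≤ ∫ x, ∫ y, K (x, y) ^ 2 :=
        integral_nonneg fun x => integral_nonneg fun y => sq_nonneg _
      linarith
    · obtain ⟨i, hi⟩ := hex ht.2
      nlinarith [hle i, sq_nonneg (eigenvalue K i - 1)]
  have h21 : posEigenvalue K 2 ≤ posEigenvalue K 1 :=
    csSup_le_csSup hbdd ⟨0, Or.inl rfl⟩ hanti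
  have h20 : 0 ≤ posEigenvalue K 2 := le_csSup (hbdd.mono hanti) (Or.inl rfl)
  have hlt : posEigenvalue K 2 < posEigenvalue K 1 := by
    rw [abs_of_nonneg (sub_nonneg.2 h21)] at hgap; linarith
  obtain ⟨t, ht2, ht1⟩ := exists_between hlt
  have ht0 : 0 < t := h20.trans_lt ht2
  obtain ⟨t', ht'S, ht'⟩ := exists_lt_of_lt_csSup (⟨0, Or.inl rfl⟩ : (S 1).Nonempty) ht1
  obtain ⟨i₀, hi₀⟩ : ∃ i, t' ≤ eigenvalue K i := by
    rcases ht'S with h | h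
    · exact absurd (ht0.trans ht') (by rw [Set.mem_singleton_iff.1 h]; exact lt_irrefl _)
    · exact hex h.2
  have hsub : ∀ i, t ≤ eigenvalue K i → i = i₀ := by
    have h2 : ¬ ((2 : ℕ) : ℕ∞) ≤ {i : EigenIndex K | t ≤ eigenvalue K i}.encard := fun h =>
      ht2.not_ge (le_csSup (hbdd.mono hanti) (Or.inr ⟨ht0, h⟩))
    have h3 : {i : EigenIndex K | t ≤ eigenvalue K i}.encard ≤ 1 := by
      rw [not_le] at h2
      exact Order.le_of_lt_add_one (by simpa [one_add_one_eq_two] using h2)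
    exact fun i hi => Set.encard_le_one_iff.1 h3 i i₀ hi (ht'.le.trans hi₀)
  refine ⟨i₀, t, ht0, ht1, le_antisymm ?_ ?_, fun i hi => ?_⟩
  · refine le_csSup hbdd (Or.inr ⟨ht0.trans (ht'.trans_le hi₀), ?_⟩)
    rw [Nat.cast_one, Set.one_le_encard_iff_nonempty]
    exact ⟨i₀, le_refl (eigenvalue K i₀)⟩
  · refine csSup_le ⟨0, Or.inl rfl⟩ ?_
    rintro s (rfl | hs)
    · exact (ht0.trans (ht'.trans_le hi₀)).le
    · obtain ⟨i, hi⟩ := hex hs.2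
      by_cases h : t ≤ eigenvalue K i
      · rwa [← hsub i h]
      · exact hi.trans ((not_le.1 h).le.trans (ht'.le.trans hi₀))
  · exact (not_le.1 fun h => hi (hsub i h)).le

/-! ### Eigenfunction expansions -/

/-- The eigenfunction expansion of a symmetric kernel `K` with simple leading eigenvalue `lam₁`,
leading eigenfunction `φ`, and remaining nonzero eigenvalues `lam k` with eigenfunctions `ψ k`; the
number `t` separates the `lam k` from `lam₁`. Completeness of the expansion is expressed by the
Hilbert–Schmidt norm. -/
structure IsKernelExpansion {J : Type*} (K : C(I × I, ℝ)) (lam₁ t : ℝ) (φ : C(I, ℝ)) (lam : J → ℝ)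
    (ψ : J → C(I, ℝ)) : Prop where
  symm : ∀ x y, K (x, y) = K (y, x)
  sep_pos : 0 < t
  sep_lt : t < lam₁
  le_sep : ∀ k, lam k ≤ t
  integral_top_mul_top : ∫ x, φ x * φ x = 1
  integral_top_mul : ∀ k, ∫ x, φ x * ψ k x = 0
  integral_mul_self : ∀ k, ∫ x, ψ k x * ψ k x = 1
  integral_mul_of_ne : ∀ k l, k ≠ l → ∫ x, ψ k x * ψ l x = 0
  integral_kernel_mul_top : ∀ x, ∫ y, K (x, y) * φ y = lam₁ * φ x
  integral_kernel_mul : ∀ k x, ∫ y, K (x, y) * ψ k y = lam k * ψ k x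
  hasSum_sq : HasSum (fun k => lam k ^ 2) ((∫ x, ∫ y, K (x, y) ^ 2) - lam₁ ^ 2)

theorem hasSum_ne_posEigenvalue {K : C(I × I, ℝ)} {i₀ : EigenIndex K}
    (hi₀ : eigenvalue K i₀ = posEigenvalue K 1)
    (hne : ∀ i ≠ i₀, eigenvalue K i ≠ posEigenvalue K 1) {f : ℝ → ℝ} {a : ℝ}
    (h : HasSum (fun i => f (eigenvalue K i)) a) :
    HasSum (fun k : {i : EigenIndex K // eigenvalue K i ≠ posEigenvalue K 1} => f (eigenvalue K k))
      (a - f (posEigenvalue K 1)) := by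
  classical
  have h1 : HasSum (fun k : {i : EigenIndex K // i ∉ ({i₀} : Finset (EigenIndex K))} =>
      f (eigenvalue K k)) (a - f (posEigenvalue K 1)) := by
    rw [Finset.hasSum_compl_iff ({i₀} : Finset (EigenIndex K)) (f := fun i => f (eigenvalue K i))]
    simpa [hi₀] using h
  have e : ∀ i, eigenvalue K i ≠ posEigenvalue K 1 ↔ i ∉ ({i₀} : Finset (EigenIndex K)) := by
    intro i
    rw [Finset.mem_singleton]
    exact ⟨fun h h' => h (h' ▸ hi₀), hne i⟩
  exact (Equiv.subtypeEquivRight e).hasSum_iff.2 h1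

theorem isKernelExpansion_eigenfun {K : C(I × I, ℝ)} (hsymm : ∀ x y : I, K (x, y) = K (y, x))
    (hgap : 0 < |posEigenvalue K 1 - posEigenvalue K 2|) {f : L2} (hf1 : ‖f‖ = 1)
    (hf : kernelOp K f = posEigenvalue K 1 • f) :
    ∃ t, IsKernelExpansion K (posEigenvalue K 1) t ((posEigenvalue K 1)⁻¹ • integralFun K f)
      (fun k : {i : EigenIndex K // eigenvalue K i ≠ posEigenvalue K 1} => eigenvalue K k)
      (fun k => eigenfun K k) := by
  classical
  obtain ⟨i₀, t, ht0, ht1, hi₀, hle⟩ := exists_index_eq_posEigenvalue hsymm hgap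
  have hpos : posEigenvalue K 1 ≠ 0 := (ht0.trans ht1).ne'
  have hφ := contLp_inv_smul_integralFun hpos hf
  set φ : C(I, ℝ) := (posEigenvalue K 1)⁻¹ • integralFun K f with hφdef
  have hne : ∀ i ≠ i₀, eigenvalue K i ≠ posEigenvalue K 1 := fun i hi =>
    ((hle i hi).trans_lt ht1).ne
  refine ⟨t, hsymm, ht0, ht1, fun k => hle k fun h => k.2 (h ▸ hi₀), ?_, fun k => ?_, fun k => ?_,
    fun k l hkl => ?_, fun x => ?_, fun k => integral_mul_eigenfun K k, ?_⟩
  · rw [← inner_contLp, hφ, real_inner_self_eq_norm_sq, hf1, one_pow]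
  · rw [← inner_contLp, hφ, contLp_eigenfun]
    exact inner_eq_zero_of_eigenvalue_ne hsymm hf (kernelOp_eigenvec K k) k.2.symm
  · rw [integral_eigenfun_mul K hsymm, if_pos rfl]
  · rw [integral_eigenfun_mul K hsymm, if_neg fun h => hkl (Subtype.ext h)]
  · rw [← integralFun_contLp, hφ, hφdef]
    simp [hpos]
  · exact hasSum_ne_posEigenvalue hi₀ hne (f := fun x => x ^ 2) (hasSum_sq_eigenvalue hsymm)

theorem hasSum_eigenvalue_ne {K : C(I × I, ℝ)} (hsymm : ∀ x y : I, K (x, y) = K (y, x))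
    (hgap : 0 < |posEigenvalue K 1 - posEigenvalue K 2|)
    (hsum : Summable fun i : EigenIndex K => |eigenvalue K i|) :
    HasSum (fun k : {i : EigenIndex K // eigenvalue K i ≠ posEigenvalue K 1} => eigenvalue K k)
      ((∫ x, K (x, x)) - posEigenvalue K 1) := by
  obtain ⟨i₀, t, ht0, ht1, hi₀, hle⟩ := exists_index_eq_posEigenvalue hsymm hgap
  exact hasSum_ne_posEigenvalue hi₀ (fun i hi => ((hle i hi).trans_lt ht1).ne) (f := id)
    (hasSum_eigenvalue hsymm hsum)

/-- The remainder of the eigenfunction expansion after the leading term and the terms in `F`. -/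
def remainder {J : Type*} (K : C(I × I, ℝ)) (lam₁ : ℝ) (φ : C(I, ℝ)) (lam : J → ℝ)
    (ψ : J → C(I, ℝ)) (F : Finset J) : C(I × I, ℝ) where
  toFun p := K p - lam₁ * (φ p.1 * φ p.2) - ∑ k ∈ F, lam k * (ψ k p.1 * ψ k p.2)

section Remainder

variable {J : Type*} {K : C(I × I, ℝ)} {lam₁ t : ℝ} {φ : C(I, ℝ)} {lam : J → ℝ}
  {ψ : J → C(I, ℝ)}

theorem IsKernelExpansion.remainder_symm (h : IsKernelExpansion K lam₁ t φ lam ψ)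
    (F : Finset J) (x y : I) :
    remainder K lam₁ φ lam ψ F (x, y) = remainder K lam₁ φ lam ψ F (y, x) := by
  simp only [remainder, ContinuousMap.coe_mk, h.symm x y, mul_comm (φ x), mul_comm (ψ _ x)]

theorem integral_remainder_mul (F : Finset J) (g : C(I, ℝ)) (x : I) :
    ∫ y, remainder K lam₁ φ lam ψ F (x, y) * g y = (∫ y, K (x, y) * g y)
      - lam₁ * (φ x * ∫ y, φ y * g y) - ∑ k ∈ F, lam k * (ψ k x * ∫ y, ψ k y * g y) := by
  have hint : ∀ {f : I → ℝ}, Continuous f → Integrable f (volume : Measure I) :=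
    fun hf => integrable_continuous hf
  simp only [remainder, ContinuousMap.coe_mk, sub_mul, Finset.sum_mul]
  rw [integral_sub (hint (by fun_prop)) (hint (by fun_prop)),
    integral_sub (hint (by fun_prop)) (hint (by fun_prop)),
    integral_finsetSum _ fun k _ => hint (by fun_prop)]
  simp only [mul_assoc, integral_const_mul]

theorem IsKernelExpansion.integral_remainder_mul_top (h : IsKernelExpansion K lam₁ t φ lam ψ)
    (F : Finset J) (x : I) :
    ∫ y, remainder K lam₁ φ lam ψ F (x, y) * φ y = 0 := by
  rw [integral_remainder_mul, h.integral_kernel_mul_top, h.integral_top_mul_top,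
    Finset.sum_eq_zero]
  · ring
  · intro k _
    have : ∫ y, ψ k y * φ y = 0 := by
      rw [← h.integral_top_mul k]; exact integral_congr_ae (Eventually.of_forall fun _ => mul_comm _ _)
    rw [this]; ring

theorem IsKernelExpansion.integral_remainder_mul_of_mem (h : IsKernelExpansion K lam₁ t φ lam ψ)
    (F : Finset J) {l : J} (hl : l ∈ F) (x : I) :
    ∫ y, remainder K lam₁ φ lam ψ F (x, y) * ψ l y = 0 := by
  rw [integral_remainder_mul, h.integral_kernel_mul, h.integral_top_mul,
    Finset.sum_eq_single_of_mem l hl, h.integral_mul_self]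
  · ring
  · intro k _ hkl
    rw [h.integral_mul_of_ne k l hkl]; ring

theorem IsKernelExpansion.integral_sq_remainder (h : IsKernelExpansion K lam₁ t φ lam ψ)
    (F : Finset J) :
    ∫ x, ∫ y, remainder K lam₁ φ lam ψ F (x, y) ^ 2
      = (∫ x, ∫ y, K (x, y) ^ 2) - lam₁ ^ 2 - ∑ k ∈ F, lam k ^ 2 := by
  have hint : ∀ {f : I → ℝ}, Continuous f → Integrable f (volume : Measure I) :=
    fun hf => integrable_continuous hf
  -- the remainder is orthogonal to the terms that were subtracted
  have h1 : ∀ x, ∫ y, remainder K lam₁ φ lam ψ F (x, y) ^ 2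
      = (∫ y, K (x, y) ^ 2) - lam₁ ^ 2 * (φ x * φ x)
        - ∑ k ∈ F, lam k ^ 2 * (ψ k x * ψ k x) := by
    intro x
    have e1 : ∫ y, remainder K lam₁ φ lam ψ F (x, y) ^ 2
        = (∫ y, remainder K lam₁ φ lam ψ F (x, y) * K (x, y))
          - lam₁ * (φ x * ∫ y, remainder K lam₁ φ lam ψ F (x, y) * φ y)
          - ∑ k ∈ F, lam k * (ψ k x * ∫ y, remainder K lam₁ φ lam ψ F (x, y) * ψ k y) := by
      simp only [← integral_const_mul]
      rw [← integral_finsetSum _ fun k _ => hint (by fun_prop),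
        ← integral_sub (hint (by fun_prop)) (hint (by fun_prop)),
        ← integral_sub (hint (by fun_prop)) (hint (by fun_prop))]
      refine integral_congr_ae (Eventually.of_forall fun y => ?_)
      have : ∑ k ∈ F, lam k * (ψ k x * (remainder K lam₁ φ lam ψ F (x, y) * ψ k y))
          = remainder K lam₁ φ lam ψ F (x, y) * ∑ k ∈ F, lam k * (ψ k x * ψ k y) := by
        rw [Finset.mul_sum]; exact Finset.sum_congr rfl fun k _ => by ring
      simp only [this]
      have e : remainder K lam₁ φ lam ψ F (x, y)
        = K (x, y) - lam₁ * (φ x * φ y) - ∑ k ∈ F, lam k * (ψ k x * ψ k y) := rfl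
      nth_rewrite 1 [sq, e]
      ring
    have e2 := integral_remainder_mul (K := K) (lam₁ := lam₁) (φ := φ) (lam := lam) (ψ := ψ) F
      (K.curry x) x
    have e3 : ∀ g : C(I, ℝ), ∫ y, g y * K.curry x y = ∫ y, K (x, y) * g y := fun g =>
      integral_congr_ae (Eventually.of_forall fun y => mul_comm _ _)
    rw [e3 φ, h.integral_kernel_mul_top] at e2
    simp only [e3 (ψ _), h.integral_kernel_mul] at e2
    have e4 : ∫ y, K (x, y) * K.curry x y = ∫ y, K (x, y) ^ 2 :=
      integral_congr_ae (Eventually.of_forall fun y => (sq _).symm)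
    rw [e4] at e2
    rw [e1, h.integral_remainder_mul_top F x, Finset.sum_eq_zero (s := F)]
    · refine Eq.trans (b := ∫ y, remainder K lam₁ φ lam ψ F (x, y) * K.curry x y) ?_ ?_
      · simp only [mul_zero, sub_zero]; rfl
      · rw [e2]
        congr 1
        · ring
        · exact Finset.sum_congr rfl fun k _ => by ring
    · intro k hk
      rw [h.integral_remainder_mul_of_mem F hk]; ring
  have hc : Continuous fun x => ∫ y, K (x, y) ^ 2 := by
    simpa using continuous_parametric_integral_of_continuous (μ := (volume : Measure I))
      (f := fun x y => K (x, y) ^ 2) (by fun_prop) isCompact_univ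
  simp only [h1]
  rw [integral_sub (hint (by fun_prop)) (hint (by fun_prop)),
    integral_sub (hint (by fun_prop)) (hint (by fun_prop)),
    integral_finsetSum _ fun k _ => hint (by fun_prop)]
  simp only [integral_const_mul, h.integral_top_mul_top, h.integral_mul_self, mul_one]

theorem IsKernelExpansion.tendsto_integral_sq_remainder
    (h : IsKernelExpansion K lam₁ t φ lam ψ) :
    Tendsto (fun F : Finset J => ∫ x, ∫ y, remainder K lam₁ φ lam ψ F (x, y) ^ 2) atTop (𝓝 0) := by
  simp only [h.integral_sq_remainder]
  have h1 : Tendsto (fun F : Finset J => ∑ k ∈ F, lam k ^ 2) atTop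
    (𝓝 ((∫ x, ∫ y, K (x, y) ^ 2) - lam₁ ^ 2)) := h.hasSum_sq
  have h2 := h1.const_sub ((∫ x, ∫ y, K (x, y) ^ 2) - lam₁ ^ 2)
  rwa [sub_self] at h2

theorem IsKernelExpansion.integral_remainder_diag (h : IsKernelExpansion K lam₁ t φ lam ψ)
    (F : Finset J) :
    ∫ x, remainder K lam₁ φ lam ψ F (x, x) = (∫ x, K (x, x)) - lam₁ - ∑ k ∈ F, lam k := by
  have hint : ∀ {f : I → ℝ}, Continuous f → Integrable f (volume : Measure I) :=
    fun hf => integrable_continuous hf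
  simp only [remainder, ContinuousMap.coe_mk]
  rw [integral_sub (hint (by fun_prop)) (hint (by fun_prop)),
    integral_sub (hint (by fun_prop)) (hint (by fun_prop)),
    integral_finsetSum _ fun k _ => hint (by fun_prop)]
  simp only [integral_const_mul, h.integral_top_mul_top, h.integral_mul_self, mul_one]

end Remainder

/-! ### Sample vectors and the normalized kernel matrix -/

/-- The vector `n^{-1/2} (f(u_1), …, f(u_n))` of sampled values of `f`; the points are the first `n`
terms of a sequence. -/
noncomputable def sampleVec (u : ℕ → I) (n : ℕ) (f : C(I, ℝ)) : EuclideanSpace ℝ (Fin n) :=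
  WithLp.toLp 2 fun i => (√(n : ℝ))⁻¹ * f (u i)

/-- The normalized kernel matrix `K_n / n` as an operator. -/
noncomputable def sampleOp (K : C(I × I, ℝ)) (u : ℕ → I) (n : ℕ) :
    EuclideanSpace ℝ (Fin n) →ₗ[ℝ] EuclideanSpace ℝ (Fin n) :=
  (n : ℝ)⁻¹ • (kernelMatrix K fun i : Fin n => u i).toEuclideanLin

/-- The Hilbert–Schmidt norm of the normalized kernel matrix. -/
noncomputable def sampleHS (K : C(I × I, ℝ)) (u : ℕ → I) (n : ℕ) : ℝ :=
  √(((n : ℝ) ^ 2)⁻¹ * ∑ i ∈ Finset.range n, ∑ j ∈ Finset.range n, K (u i, u j) ^ 2)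

theorem inv_sqrt_mul_inv_sqrt (n : ℕ) : (√(n : ℝ))⁻¹ * (√(n : ℝ))⁻¹ = (n : ℝ)⁻¹ := by
  rw [← mul_inv, Real.mul_self_sqrt (Nat.cast_nonneg n)]

theorem inner_sampleVec (u : ℕ → I) (n : ℕ) (f g : C(I, ℝ)) :
    ⟪sampleVec u n f, sampleVec u n g⟫
      = (n : ℝ)⁻¹ * ∑ i ∈ Finset.range n, f (u i) * g (u i) := by
  simp only [PiLp.inner_apply, sampleVec, RCLike.inner_apply, conj_trivial, Finset.sum_range,
    Finset.mul_sum, ← inv_sqrt_mul_inv_sqrt]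
  exact Finset.sum_congr rfl fun i _ => by ring

theorem sampleOp_apply (K : C(I × I, ℝ)) (u : ℕ → I) (n : ℕ) (x : EuclideanSpace ℝ (Fin n))
    (i : Fin n) : sampleOp K u n x i = (n : ℝ)⁻¹ * ∑ j : Fin n, K (u i, u j) * x j := by
  simp [sampleOp, kernelMatrix, Matrix.mulVec, dotProduct]

theorem sampleOp_isSymmetric {K : C(I × I, ℝ)} (hsymm : ∀ x y : I, K (x, y) = K (y, x)) (u : ℕ → I)
    (n : ℕ) : (sampleOp K u n).IsSymmetric := by
  have h := Matrix.isSymmetric_toEuclideanLin_iff.2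
    (isHermitian_kernelMatrix hsymm fun i : Fin n => u i)
  exact h.smul (by simp)

theorem norm_sampleOp_le (K : C(I × I, ℝ)) (u : ℕ → I) (n : ℕ) (x : EuclideanSpace ℝ (Fin n)) :
    ‖sampleOp K u n x‖ ≤ sampleHS K u n * ‖x‖ := by
  refine le_of_sq_le_sq (a := ‖sampleOp K u n x‖) (b := sampleHS K u n * ‖x‖) ?_
    (mul_nonneg (Real.sqrt_nonneg _) (norm_nonneg _))
  rw [mul_pow, sampleHS, Real.sq_sqrt (by positivity), EuclideanSpace.real_norm_sq_eq,
    EuclideanSpace.real_norm_sq_eq, Finset.sum_range, mul_assoc, Finset.sum_mul, Finset.mul_sum]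
  refine Finset.sum_le_sum fun i _ => ?_
  rw [sampleOp_apply, mul_pow, inv_pow, Finset.sum_range]
  exact mul_le_mul_of_nonneg_left (Finset.sum_mul_sq_le_sq_mul_sq _ _ _) (by positivity)

theorem abs_inner_sampleOp_le (K : C(I × I, ℝ)) (u : ℕ → I) (n : ℕ)
    (x : EuclideanSpace ℝ (Fin n)) : |⟪x, sampleOp K u n x⟫| ≤ sampleHS K u n * ‖x‖ ^ 2 := by
  refine (abs_real_inner_le_norm _ _).trans ?_
  calc ‖x‖ * ‖sampleOp K u n x‖ ≤ ‖x‖ * (sampleHS K u n * ‖x‖) :=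
        mul_le_mul_of_nonneg_left (norm_sampleOp_le K u n x) (norm_nonneg _)
    _ = _ := by ring

theorem mul_norm_sq_sampleOp_sampleVec (K : C(I × I, ℝ)) (u : ℕ → I) (n : ℕ) (g : C(I, ℝ)) :
    n * ‖sampleOp K u n (sampleVec u n g)‖ ^ 2 = ((n : ℝ) ^ 2)⁻¹ *
      ∑ i ∈ Finset.range n, (∑ j ∈ Finset.range n, K (u i, u j) * g (u j)) ^ 2 := by
  rcases Nat.eq_zero_or_pos n with rfl | hn
  · simp
  have hn' : (0 : ℝ) < n := by exact_mod_cast hn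
  have : ∀ i : Fin n, sampleOp K u n (sampleVec u n g) i
      = (n : ℝ)⁻¹ * (√(n : ℝ))⁻¹ * ∑ j : Fin n, K (u i, u j) * g (u j) := by
    intro i
    rw [sampleOp_apply, mul_assoc, Finset.mul_sum Finset.univ _ (√(n : ℝ))⁻¹]
    congr 1
    exact Finset.sum_congr rfl fun j _ => by simp only [sampleVec]; ring
  rw [EuclideanSpace.real_norm_sq_eq]
  simp only [this, mul_pow, inv_pow, Real.sq_sqrt hn'.le, Finset.sum_range, ← Finset.mul_sum]
  field_simp

theorem mul_inner_sampleVec_sampleOp (K : C(I × I, ℝ)) (u : ℕ → I) (n : ℕ) (g : C(I, ℝ)) :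
    n * ⟪sampleVec u n g, sampleOp K u n (sampleVec u n g)⟫ = (n : ℝ)⁻¹ *
      ∑ i ∈ Finset.range n, ∑ j ∈ Finset.range n, g (u i) * (K (u i, u j) * g (u j)) := by
  rcases Nat.eq_zero_or_pos n with rfl | hn
  · simp
  have hn' : (n : ℝ) ≠ 0 := by positivity
  have h : ⟪sampleVec u n g, sampleOp K u n (sampleVec u n g)⟫ = (n : ℝ)⁻¹ * ((n : ℝ)⁻¹ *
      ∑ i ∈ Finset.range n, ∑ j ∈ Finset.range n, g (u i) * (K (u i, u j) * g (u j))) := by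
    simp only [PiLp.inner_apply, RCLike.inner_apply, conj_trivial, sampleOp_apply, sampleVec,
      Finset.sum_range]
    rw [← inv_sqrt_mul_inv_sqrt]
    simp only [Finset.mul_sum, Finset.sum_mul]
    exact Finset.sum_congr rfl fun i _ => Finset.sum_congr rfl fun j _ => by ring
  rw [h, mul_inv_cancel_left₀ hn']

theorem sampleOp_eq_expansion {J : Type*} (K : C(I × I, ℝ)) (lam₁ : ℝ) (φ : C(I, ℝ)) (lam : J → ℝ)
    (ψ : J → C(I, ℝ)) (F : Finset J) (u : ℕ → I) (n : ℕ) (x : EuclideanSpace ℝ (Fin n)) :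
    sampleOp K u n x = (lam₁ * ⟪sampleVec u n φ, x⟫) • sampleVec u n φ
      + ∑ k ∈ F, (lam k * ⟪sampleVec u n (ψ k), x⟫) • sampleVec u n (ψ k)
      + sampleOp (remainder K lam₁ φ lam ψ F) u n x := by
  have hin : ∀ (f : C(I, ℝ)) (i : Fin n), ⟪sampleVec u n f, x⟫ * (sampleVec u n f) i
      = (n : ℝ)⁻¹ * ∑ j : Fin n, f (u i) * f (u j) * x j := by
    intro f i
    simp only [PiLp.inner_apply, RCLike.inner_apply, conj_trivial, sampleVec]
    rw [← inv_sqrt_mul_inv_sqrt, Finset.sum_mul, Finset.mul_sum]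
    exact Finset.sum_congr rfl fun j _ => by ring
  ext i
  simp only [PiLp.add_apply, PiLp.smul_apply, smul_eq_mul, WithLp.ofLp_sum, Finset.sum_apply,
    mul_assoc, hin, sampleOp_apply, WithLp.ofLp_smul, Pi.smul_apply]
  simp only [← mul_assoc, mul_comm _ (n : ℝ)⁻¹]
  simp only [mul_assoc, ← Finset.mul_sum, ← mul_add]
  congr 1
  simp only [Finset.mul_sum]
  rw [Finset.sum_comm, ← Finset.sum_add_distrib, ← Finset.sum_add_distrib]
  refine Finset.sum_congr rfl fun j _ => ?_
  simp only [remainder, ContinuousMap.coe_mk, sub_mul, Finset.sum_mul]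
  simp only [← mul_assoc]
  ring

/-- The largest eigenvalue of the normalized kernel matrix. -/
noncomputable def sampleTop (K : C(I × I, ℝ)) (u : ℕ → I) (n : ℕ) : ℝ :=
  largestEigenvalue (kernelMatrix K fun i : Fin n => u i) / n

theorem sampleTop_spec {K : C(I × I, ℝ)} (hsymm : ∀ x y : I, K (x, y) = K (y, x)) (u : ℕ → I)
    {n : ℕ} (hn : 0 < n) :
    (∀ x, ⟪x, sampleOp K u n x⟫ ≤ sampleTop K u n * ‖x‖ ^ 2) ∧
      ∃ y, y ≠ 0 ∧ sampleOp K u n y = sampleTop K u n • y := by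
  have hn' : (0 : ℝ) < n := by exact_mod_cast hn
  obtain ⟨h1, y, hy, hTy⟩ :=
    largestEigenvalue_spec hn (isHermitian_kernelMatrix hsymm fun i : Fin n => u i)
  refine ⟨fun x => ?_, y, hy, ?_⟩
  · rw [sampleOp, LinearMap.smul_apply, inner_smul_right, sampleTop, div_mul_eq_mul_div,
      le_div_iff₀ hn']
    calc (n : ℝ)⁻¹ * ⟪x, (kernelMatrix K fun i : Fin n => u i).toEuclideanLin x⟫ * n
        = ⟪x, (kernelMatrix K fun i : Fin n => u i).toEuclideanLin x⟫ := by field_simp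
      _ ≤ _ := h1 x
  · rw [sampleOp, LinearMap.smul_apply, hTy, smul_smul, sampleTop]
    congr 1
    field_simp

/-- The Hilbert–Schmidt distance between the Gram matrix of the sampled eigenfunctions and the
identity. -/
noncomputable def gramError {J : Type*} [DecidableEq J] (ψ : J → C(I, ℝ)) (F : Finset J) (u : ℕ → I)
    (n : ℕ) : ℝ :=
  √(∑ k ∈ F, ∑ l ∈ F, (⟪sampleVec u n (ψ k), sampleVec u n (ψ l)⟫ - if k = l then 1 else 0) ^ 2)

/-- Bound for the largest eigenvalue in terms of the trial vector `x = v + w`, where `v` samples the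
leading eigenfunction; `D` is the distance of the Rayleigh quotient to the rest of the spectrum. -/
theorem IsKernelExpansion.sampleTop_bounds {J : Type*} [DecidableEq J] {K : C(I × I, ℝ)}
    {lam₁ t : ℝ} {φ : C(I, ℝ)} {lam : J → ℝ} {ψ : J → C(I, ℝ)}
    (h : IsKernelExpansion K lam₁ t φ lam ψ) (F : Finset J) (u : ℕ → I) {n : ℕ} (hn : 0 < n)
    (w : EuclideanSpace ℝ (Fin n)) {x : EuclideanSpace ℝ (Fin n)}
    (hxw : x = sampleVec u n φ + w) (hx : 0 < ‖x‖ ^ 2) {D : ℝ}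
    (hD : D = ⟪x, sampleOp K u n x⟫ / ‖x‖ ^ 2 - (lam₁ * ‖w‖ ^ 2 + t * (1 + gramError ψ F u n)
      + sampleHS (remainder K lam₁ φ lam ψ F) u n)) (hD0 : 0 < D) (θ : ℝ) :
    ⟪x, sampleOp K u n x⟫ / ‖x‖ ^ 2 ≤ sampleTop K u n ∧
      sampleTop K u n ≤ ⟪x, sampleOp K u n x⟫ / ‖x‖ ^ 2
        + ‖sampleOp K u n x - θ • x‖ ^ 2 / (D * ‖x‖ ^ 2) := by
  obtain ⟨h1, y, hy, hTy⟩ := sampleTop_spec h.symm u hn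
  have hx0 : x ≠ 0 := fun h0 => by simp [h0] at hx
  refine ⟨by rw [div_le_iff₀ hx]; exact h1 x, ?_⟩
  rw [hD]
  refine topEigenvalue_le_rayleigh_add (sampleOp_isSymmetric h.symm u n) h1 hy hTy hx0 ?_
    (by linarith) θ
  intro z hz
  refine inner_map_le_of_inner_add_eq_zero F (lam := lam) (e := fun k => sampleVec u n (ψ k))
    (v := sampleVec u n φ) (w := w)
    (R := sampleOp (remainder K lam₁ φ lam ψ F) u n) (γ := gramError ψ F u n)
    (sampleOp_eq_expansion K lam₁ φ lam ψ F u n) (h.sep_pos.trans h.sep_lt).le h.sep_pos.le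
    (fun k _ => h.le_sep k) (fun z => (le_abs_self _).trans (abs_inner_sampleOp_le _ u n z))
    (Real.sqrt_nonneg _) ?_ z (hxw ▸ hz)
  rw [gramError, Real.sq_sqrt (Finset.sum_nonneg fun _ _ => Finset.sum_nonneg fun _ _ =>
    sq_nonneg _)]

/-! ### Stochastic orders of sampled kernels -/

theorem continuous_integral_right {K : I × I → ℝ} (hK : Continuous K) :
    Continuous fun x => ∫ y, K (x, y) := by
  simpa using continuous_parametric_integral_of_continuous (μ := (volume : Measure I))
    (f := fun x y => K (x, y)) (by simpa [Function.uncurry_def] using hK) isCompact_univ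

theorem integral_sq_le_of_abs_le {K H : C(I × I, ℝ)} {c : ℝ} (hc : ∀ p, |H p| ≤ c * |K p|) :
    ∫ x, ∫ y, H (x, y) ^ 2 ≤ c ^ 2 * ∫ x, ∫ y, K (x, y) ^ 2 := by
  have hint : ∀ {f : I → ℝ}, Continuous f → Integrable f (volume : Measure I) :=
    fun hf => integrable_continuous hf
  simp only [← integral_const_mul]
  refine integral_mono (hint (continuous_integral_right (K := fun p => H p ^ 2) (by fun_prop)))
    (hint (continuous_integral_right (K := fun p => c ^ 2 * K p ^ 2) (by fun_prop))) fun x =>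
    integral_mono (hint (by fun_prop)) (hint (by fun_prop)) fun y => ?_
  have := pow_le_pow_left₀ (abs_nonneg _) (hc (x, y)) 2
  rwa [mul_pow, sq_abs, sq_abs] at this

theorem eventually_curry_add_inv_mul_le {κ : Type*} {l : Filter κ} {c : κ → ℝ}
    (hc : Tendsto c l (𝓝 0)) (d : κ → ℝ) {ε : ℝ} (hε : 0 < ε) :
    ∀ᶠ p : κ × ℕ in l.curry atTop, c p.1 + (p.2 : ℝ)⁻¹ * d p.1 ≤ ε := by
  rw [eventually_curry_iff]
  filter_upwards [hc.eventually_lt_const hε] with k hk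
  have h1 : Tendsto (fun n : ℕ => c k + (n : ℝ)⁻¹ * d k) atTop (𝓝 (c k + 0 * d k)) :=
    (tendsto_inv_atTop_nhds_zero_nat.mul_const _).const_add _
  rw [zero_mul, add_zero] at h1
  exact (h1.eventually_lt_const hk).mono fun n hn => hn.le

section SampleOrders

variable {Ω : Type*} [MeasurableSpace Ω] {P : Measure Ω} [IsProbabilityMeasure P] {U : ℕ → Ω → I}

theorem nullInProb_inner_sampleVec_sub (hU : ∀ i, Measurable (U i))
    (hlaw : ∀ i, HasLaw (U i) (volume : Measure I) P) (hind : iIndepFun U P) (f g : C(I, ℝ)) :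
    NullInProb P atTop fun n ω =>
      ⟪sampleVec (U · ω) n f, sampleVec (U · ω) n g⟫ - ∫ x, f x * g x :=
  (nullInProb_average_sub hU hlaw hind (f * g)).congr (Eventually.of_forall fun n ω => by
    rw [inner_sampleVec]; rfl)

theorem IsKernelExpansion.nullInProb_gramError {J : Type*} [DecidableEq J] {K : C(I × I, ℝ)}
    {lam₁ t : ℝ} {φ : C(I, ℝ)} {lam : J → ℝ} {ψ : J → C(I, ℝ)}
    (h : IsKernelExpansion K lam₁ t φ lam ψ) (hU : ∀ i, Measurable (U i))
    (hlaw : ∀ i, HasLaw (U i) (volume : Measure I) P) (hind : iIndepFun U P) (F : Finset J) :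
    NullInProb P atTop fun n ω => gramError ψ F (U · ω) n := by
  refine NullInProb.sqrt (NullInProb.sum fun k _ => NullInProb.sum fun l _ => NullInProb.sq ?_)
  refine (nullInProb_inner_sampleVec_sub hU hlaw hind (ψ k) (ψ l)).congr
    (Eventually.of_forall fun n ω => ?_)
  split_ifs with hkl
  · rw [hkl, h.integral_mul_self]
  · rw [h.integral_mul_of_ne k l hkl]

theorem integrable_sum_sum_sq (hU : ∀ i, Measurable (U i)) (K : C(I × I, ℝ)) (n : ℕ) :
    Integrable (fun ω => ∑ i ∈ Finset.range n, ∑ j ∈ Finset.range n, K (U i ω, U j ω) ^ 2) P :=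
  integrable_finsetSum _ fun i _ => integrable_finsetSum _ fun j _ =>
    (memLp_two_comp_prod hU K i j).integrable_sq

theorem inv_sq_mul_integral_sum_sum_sq_le (hU : ∀ i, Measurable (U i))
    (hlaw : ∀ i, HasLaw (U i) (volume : Measure I) P) (hind : iIndepFun U P) (K : C(I × I, ℝ))
    (n : ℕ) :
    ((n : ℝ) ^ 2)⁻¹ *
        ∫ ω, ∑ i ∈ Finset.range n, ∑ j ∈ Finset.range n, K (U i ω, U j ω) ^ 2 ∂P
      ≤ (∫ x, ∫ y, K (x, y) ^ 2) + (n : ℝ)⁻¹ * ‖K‖ ^ 2 := by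
  rcases Nat.eq_zero_or_pos n with rfl | hn
  · simpa using integral_nonneg fun x => integral_nonneg fun y => sq_nonneg (K (x, y))
  have hn' : (0 : ℝ) < n := by exact_mod_cast hn
  refine (mul_le_mul_of_nonneg_left (integral_sum_sum_sq_le hU hlaw hind K n)
    (by positivity)).trans (le_of_eq ?_)
  field_simp

theorem nullInProb_sampleHS (hU : ∀ i, Measurable (U i))
    (hlaw : ∀ i, HasLaw (U i) (volume : Measure I) P) (hind : iIndepFun U P) {κ : Type*}
    {l : Filter κ} {R : κ → C(I × I, ℝ)}
    (hR : Tendsto (fun k => ∫ x, ∫ y, R k (x, y) ^ 2) l (𝓝 0)) :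
    NullInProb P (l.curry atTop) fun p ω => sampleHS (R p.1) (U · ω) p.2 := by
  refine NullInProb.sqrt (nullInProb_of_integral_le (fun p ω => by positivity)
    (Eventually.of_forall fun p => (integrable_sum_sum_sq hU (R p.1) p.2).const_mul _)
    fun ε hε => ?_)
  filter_upwards [eventually_curry_add_inv_mul_le hR (fun k => ‖R k‖ ^ 2) hε] with p hp
  rw [integral_const_mul]
  exact (inv_sq_mul_integral_sum_sum_sq_le hU hlaw hind (R p.1) p.2).trans hp

/-- The kernel `R(x, y) g(y)`. -/
def rightMul (R : C(I × I, ℝ)) (g : C(I, ℝ)) : C(I × I, ℝ) where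
  toFun p := R p * g p.2

/-- The kernel `g(x) R(x, y) g(y)`. -/
def biMul (R : C(I × I, ℝ)) (g : C(I, ℝ)) : C(I × I, ℝ) where
  toFun p := g p.1 * (R p * g p.2)

theorem abs_rightMul_le (R : C(I × I, ℝ)) (g : C(I, ℝ)) (p : I × I) :
    |rightMul R g p| ≤ ‖g‖ * |R p| := by
  change |R p * g p.2| ≤ _
  rw [abs_mul, mul_comm]
  exact mul_le_mul_of_nonneg_right (g.norm_coe_le_norm _) (abs_nonneg _)

theorem abs_biMul_le (R : C(I × I, ℝ)) (g : C(I, ℝ)) (p : I × I) :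
    |biMul R g p| ≤ ‖g‖ ^ 2 * |R p| := by
  change |g p.1 * (R p * g p.2)| ≤ _
  rw [abs_mul, sq, mul_assoc]
  exact mul_le_mul (g.norm_coe_le_norm _) (abs_rightMul_le R g p) (abs_nonneg _) (norm_nonneg _)

theorem integrable_mul_norm_sq_sampleOp (hU : ∀ i, Measurable (U i)) (R : C(I × I, ℝ)) (g : C(I, ℝ))
    (n : ℕ) :
    Integrable (fun ω => n * ‖sampleOp R (U · ω) n (sampleVec (U · ω) n g)‖ ^ 2) P := by
  simp only [mul_norm_sq_sampleOp_sampleVec]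
  exact (integrable_finsetSum _ fun i _ => (memLp_finsetSum _ fun j _ =>
    memLp_two_comp_prod hU (rightMul R g) i j).integrable_sq).const_mul _

theorem integral_mul_norm_sq_sampleOp_le (hU : ∀ i, Measurable (U i))
    (hlaw : ∀ i, HasLaw (U i) (volume : Measure I) P) (hind : iIndepFun U P) {R : C(I × I, ℝ)}
    {g : C(I, ℝ)} (hRg : ∀ x, ∫ y, R (x, y) * g y = 0) (n : ℕ) :
    ∫ ω, n * ‖sampleOp R (U · ω) n (sampleVec (U · ω) n g)‖ ^ 2 ∂P
      ≤ ‖g‖ ^ 2 * (∫ x, ∫ y, R (x, y) ^ 2) + (n : ℝ)⁻¹ * ‖rightMul R g‖ ^ 2 := by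
  simp only [mul_norm_sq_sampleOp_sampleVec]
  rw [integral_const_mul]
  have h1 := integral_sum_sq_sum_comp hU hlaw hind (h := rightMul R g) hRg n
  have h2 := inv_sq_mul_integral_sum_sum_sq_le hU hlaw hind (rightMul R g) n
  rw [← h1] at h2
  refine h2.trans ?_
  gcongr
  exact integral_sq_le_of_abs_le (abs_rightMul_le R g)

theorem nullInProb_mul_norm_sq_sampleOp (hU : ∀ i, Measurable (U i))
    (hlaw : ∀ i, HasLaw (U i) (volume : Measure I) P) (hind : iIndepFun U P) {κ : Type*}
    {l : Filter κ} {R : κ → C(I × I, ℝ)}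
    (hR : Tendsto (fun k => ∫ x, ∫ y, R k (x, y) ^ 2) l (𝓝 0)) {g : C(I, ℝ)}
    (hRg : ∀ k x, ∫ y, R k (x, y) * g y = 0) :
    NullInProb P (l.curry atTop) fun p ω =>
      p.2 * ‖sampleOp (R p.1) (U · ω) p.2 (sampleVec (U · ω) p.2 g)‖ ^ 2 := by
  refine nullInProb_of_integral_le (fun p ω => by positivity)
    (Eventually.of_forall fun p => integrable_mul_norm_sq_sampleOp hU _ _ _) fun ε hε => ?_
  have h1 := hR.const_mul (‖g‖ ^ 2)
  rw [mul_zero] at h1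
  filter_upwards [eventually_curry_add_inv_mul_le h1 (fun k => ‖rightMul (R k) g‖ ^ 2) hε] with p hp
  exact (integral_mul_norm_sq_sampleOp_le hU hlaw hind (hRg p.1) p.2).trans hp

theorem boundedInProb_mul_norm_sq_sampleOp (hU : ∀ i, Measurable (U i))
    (hlaw : ∀ i, HasLaw (U i) (volume : Measure I) P) (hind : iIndepFun U P) {R : C(I × I, ℝ)}
    {g : C(I, ℝ)} (hRg : ∀ x, ∫ y, R (x, y) * g y = 0) :
    BoundedInProb P atTop fun (n : ℕ) ω =>
      n * ‖sampleOp R (U · ω) n (sampleVec (U · ω) n g)‖ ^ 2 := by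
  refine boundedInProb_of_integral_le (C := ‖g‖ ^ 2 * (∫ x, ∫ y, R (x, y) ^ 2)
    + 1 * ‖rightMul R g‖ ^ 2) (fun n ω => by positivity)
    (Eventually.of_forall fun n => integrable_mul_norm_sq_sampleOp hU _ _ _) ?_
  filter_upwards [eventually_gt_atTop 0] with n hn
  refine (integral_mul_norm_sq_sampleOp_le hU hlaw hind hRg n).trans ?_
  gcongr
  exact inv_le_one_of_one_le₀ (by exact_mod_cast hn)

/-- A `V`-statistic is a `U`-statistic plus its diagonal. -/
theorem mul_inner_sampleOp_eq_diag_add (R : C(I × I, ℝ)) (u : ℕ → I) (n : ℕ) (g : C(I, ℝ)) :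
    n * ⟪sampleVec u n g, sampleOp R u n (sampleVec u n g)⟫
      = (n : ℝ)⁻¹ * ∑ i ∈ Finset.range n, biMul R g (u i, u i)
        + (n : ℝ)⁻¹ * ∑ p ∈ (Finset.range n).offDiag, biMul R g (u p.1, u p.2) := by
  rw [mul_inner_sampleVec_sampleOp, ← mul_add, ← Finset.sum_product', ← Finset.diag_union_offDiag,
    Finset.sum_union (Finset.disjoint_diag_offDiag _), Finset.sum_diag]
  rfl

theorem integrable_sq_inv_mul_sum_offDiag (hU : ∀ i, Measurable (U i)) (H : C(I × I, ℝ)) (n : ℕ) :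
    Integrable (fun ω => ((n : ℝ)⁻¹ *
      ∑ p ∈ (Finset.range n).offDiag, H (U p.1 ω, U p.2 ω)) ^ 2) P := by
  have h : MemLp (fun ω => ∑ p ∈ (Finset.range n).offDiag, H (U p.1 ω, U p.2 ω)) 2 P :=
    memLp_finsetSum _ fun p _ => memLp_two_comp_prod hU H p.1 p.2
  exact (h.const_mul _).integrable_sq

theorem integral_sq_inv_mul_sum_offDiag_le (hU : ∀ i, Measurable (U i))
    (hlaw : ∀ i, HasLaw (U i) (volume : Measure I) P) (hind : iIndepFun U P) {R : C(I × I, ℝ)}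
    (hsymm : ∀ x y, R (x, y) = R (y, x)) {g : C(I, ℝ)} (hRg : ∀ x, ∫ y, R (x, y) * g y = 0)
    (n : ℕ) :
    ∫ ω, ((n : ℝ)⁻¹ * ∑ p ∈ (Finset.range n).offDiag, biMul R g (U p.1 ω, U p.2 ω)) ^ 2 ∂P
      ≤ 2 * (‖g‖ ^ 2) ^ 2 * ∫ x, ∫ y, R (x, y) ^ 2 := by
  have h1 := integral_sq_sum_offDiag hU hlaw hind (h := biMul R g)
    (fun x y => by simp only [biMul, ContinuousMap.coe_mk, hsymm x y]; ring)
    (fun x => by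
      simp only [biMul, ContinuousMap.coe_mk]
      rw [integral_const_mul, hRg, mul_zero]) n
  have h2 := integral_sq_le_of_abs_le (abs_biMul_le R g)
  have h0 : 0 ≤ ∫ x, ∫ y, biMul R g (x, y) ^ 2 :=
    integral_nonneg fun x => integral_nonneg fun y => sq_nonneg _
  simp only [mul_pow]
  rw [integral_const_mul]
  rcases Nat.eq_zero_or_pos n with rfl | hn
  · have := h0.trans h2
    simp only [Finset.range_zero, Finset.offDiag_empty, Finset.sum_empty, CharP.cast_eq_zero,
      inv_zero, integral_const, ne_eq, OfNat.ofNat_ne_zero, not_false_eq_true, zero_pow, mul_zero,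
      smul_zero]
    linarith
  calc ((n : ℝ)⁻¹) ^ 2 *
        ∫ ω, (∑ p ∈ (Finset.range n).offDiag, biMul R g (U p.1 ω, U p.2 ω)) ^ 2 ∂P
      ≤ ((n : ℝ)⁻¹) ^ 2 * (2 * (n : ℝ) ^ 2 * ∫ x, ∫ y, biMul R g (x, y) ^ 2) := by gcongr
    _ = 2 * ∫ x, ∫ y, biMul R g (x, y) ^ 2 := by
        have : (n : ℝ) ≠ 0 := by positivity
        field_simp
    _ ≤ 2 * ((‖g‖ ^ 2) ^ 2 * ∫ x, ∫ y, R (x, y) ^ 2) := by gcongr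
    _ = _ := by ring

theorem nullInProb_mul_inner_sampleOp_sub (hU : ∀ i, Measurable (U i))
    (hlaw : ∀ i, HasLaw (U i) (volume : Measure I) P) (hind : iIndepFun U P) {κ : Type*}
    {l : Filter κ} {R : κ → C(I × I, ℝ)}
    (hR : Tendsto (fun k => ∫ x, ∫ y, R k (x, y) ^ 2) l (𝓝 0))
    (hsymm : ∀ k x y, R k (x, y) = R k (y, x)) {g : C(I, ℝ)}
    (hRg : ∀ k x, ∫ y, R k (x, y) * g y = 0) :
    NullInProb P (l.curry atTop) fun p ω =>
      p.2 * ⟪sampleVec (U · ω) p.2 g, sampleOp (R p.1) (U · ω) p.2 (sampleVec (U · ω) p.2 g)⟫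
        - ∫ x, biMul (R p.1) g (x, x) := by
  have h1 : NullInProb P (l.curry atTop) fun (p : κ × ℕ) ω => (p.2 : ℝ)⁻¹ *
      ∑ i ∈ Finset.range p.2, biMul (R p.1) g (U i ω, U i ω) - ∫ x, biMul (R p.1) g (x, x) :=
    NullInProb.curry fun k =>
      nullInProb_average_sub hU hlaw hind ⟨fun x => biMul (R k) g (x, x), by fun_prop⟩
  have h2 : NullInProb P (l.curry atTop) fun (p : κ × ℕ) ω => (p.2 : ℝ)⁻¹ *
      ∑ q ∈ (Finset.range p.2).offDiag, biMul (R p.1) g (U q.1 ω, U q.2 ω) := by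
    refine nullInProb_of_sq (nullInProb_of_integral_le (fun _ _ => sq_nonneg _)
      (Eventually.of_forall fun p => integrable_sq_inv_mul_sum_offDiag hU _ _) fun ε hε => ?_)
    have h3 := hR.const_mul (2 * (‖g‖ ^ 2) ^ 2)
    rw [mul_zero] at h3
    filter_upwards [eventually_curry_add_inv_mul_le h3 (fun _ => 0) hε] with p hp
    rw [mul_zero, add_zero] at hp
    exact (integral_sq_inv_mul_sum_offDiag_le hU hlaw hind (hsymm p.1) (hRg p.1) p.2).trans hp
  refine (h1.add h2).congr (Eventually.of_forall fun p ω => ?_)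
  rw [mul_inner_sampleOp_eq_diag_add]
  ring

theorem boundedInProb_mul_inner_sampleOp (hU : ∀ i, Measurable (U i))
    (hlaw : ∀ i, HasLaw (U i) (volume : Measure I) P) (hind : iIndepFun U P) {R : C(I × I, ℝ)}
    (hsymm : ∀ x y, R (x, y) = R (y, x)) {g : C(I, ℝ)} (hRg : ∀ x, ∫ y, R (x, y) * g y = 0) :
    BoundedInProb P atTop fun (n : ℕ) ω =>
      n * ⟪sampleVec (U · ω) n g, sampleOp R (U · ω) n (sampleVec (U · ω) n g)⟫ := by
  have h1 := ((nullInProb_average_sub hU hlaw hind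
    ⟨fun x => biMul R g (x, x), by fun_prop⟩).boundedInProb.add
    (boundedInProb_const (∫ x, biMul R g (x, x))))
  have h2 : BoundedInProb P atTop fun (n : ℕ) ω => (n : ℝ)⁻¹ *
      ∑ q ∈ (Finset.range n).offDiag, biMul R g (U q.1 ω, U q.2 ω) :=
    boundedInProb_of_sq (boundedInProb_of_integral_le (fun _ _ => sq_nonneg _)
      (Eventually.of_forall fun n => integrable_sq_inv_mul_sum_offDiag hU _ _)
      (Eventually.of_forall fun n =>
        integral_sq_inv_mul_sum_offDiag_le hU hlaw hind hsymm hRg n))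
  refine (h1.add h2).congr (Eventually.of_forall fun n ω => ?_)
  rw [mul_inner_sampleOp_eq_diag_add]
  simp only [ContinuousMap.coe_mk]
  ring

end SampleOrders

/-! ### Fluctuations of order `√n` -/

section FirstOrder

variable {Ω : Type*} [MeasurableSpace Ω] {P : Measure Ω} [IsProbabilityMeasure P] {U : ℕ → Ω → I}

theorem tendsto_inv_sqrt_atTop : Tendsto (fun n : ℕ => (√(n : ℝ))⁻¹) atTop (𝓝 0) :=
  tendsto_inv_atTop_zero.comp (Real.tendsto_sqrt_atTop.comp tendsto_natCast_atTop_atTop)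

theorem IsKernelExpansion.nullInProb_remainder_sampleHS {J : Type*} {K : C(I × I, ℝ)} {lam₁ t : ℝ}
    {φ : C(I, ℝ)} {lam : J → ℝ} {ψ : J → C(I, ℝ)} (h : IsKernelExpansion K lam₁ t φ lam ψ)
    (hU : ∀ i, Measurable (U i)) (hlaw : ∀ i, HasLaw (U i) (volume : Measure I) P)
    (hind : iIndepFun U P) :
    NullInProb P ((atTop : Filter (Finset J)).curry atTop) fun p ω =>
      sampleHS (remainder K lam₁ φ lam ψ p.1) (U · ω) p.2 :=
  nullInProb_sampleHS hU hlaw hind h.tendsto_integral_sq_remainder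

/-- With the sampled leading eigenfunction as trial vector, the largest eigenvalue of `K_n / n` is
`lam₁` times the empirical second moment of that eigenfunction, up to `o_P(n^{-1/2})`. -/
theorem IsKernelExpansion.nullInProb_sqrt_mul_sampleTop_sub {J : Type*} {K : C(I × I, ℝ)}
    {lam₁ t : ℝ} {φ : C(I, ℝ)} {lam : J → ℝ} {ψ : J → C(I, ℝ)}
    (h : IsKernelExpansion K lam₁ t φ lam ψ)
    (hU : ∀ i, Measurable (U i)) (hlaw : ∀ i, HasLaw (U i) (volume : Measure I) P)
    (hind : iIndepFun U P) :
    NullInProb P atTop fun (n : ℕ) ω =>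
      √(n : ℝ) * (sampleTop K (U · ω) n - lam₁ * ‖sampleVec (U · ω) n φ‖ ^ 2) := by
  classical
  set R₀ := remainder K lam₁ φ lam ψ ∅ with hR₀
  set s : ℕ → Ω → ℝ := fun n ω => ‖sampleVec (U · ω) n φ‖ ^ 2 with hs
  set r : ℕ → Ω → ℝ := fun n ω =>
    ⟪sampleVec (U · ω) n φ, sampleOp R₀ (U · ω) n (sampleVec (U · ω) n φ)⟫ with hr
  set E : ℕ → Ω → ℝ := fun n ω => ‖sampleOp R₀ (U · ω) n (sampleVec (U · ω) n φ)‖ ^ 2 with hE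
  have hs1 : NullInProb P atTop fun n ω => s n ω - 1 := by
    refine (nullInProb_inner_sampleVec_sub hU hlaw hind φ φ).congr
      (Eventually.of_forall fun n ω => ?_)
    rw [real_inner_self_eq_norm_sq, h.integral_top_mul_top]
  have hnr : BoundedInProb P atTop fun n ω => n * r n ω :=
    boundedInProb_mul_inner_sampleOp hU hlaw hind (h.remainder_symm ∅)
      (h.integral_remainder_mul_top ∅)
  have hnE : BoundedInProb P atTop fun n ω => n * E n ω :=
    boundedInProb_mul_norm_sq_sampleOp hU hlaw hind (h.integral_remainder_mul_top ∅)
  have hr0 : NullInProb P atTop r := by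
    refine ((nullInProb_of_tendsto tendsto_inv_atTop_nhds_zero_nat).mul_boundedInProb hnr).congr ?_
    filter_upwards [eventually_gt_atTop 0] with n hn ω
    have : (n : ℝ) ≠ 0 := by positivity
    rw [inv_mul_cancel_left₀ this]
  have hrs : NullInProb P atTop fun n ω => r n ω * (s n ω)⁻¹ := by
    refine hr0.mul_boundedInProb ?_
    exact ((hs1.inv_sub_one.boundedInProb).add (boundedInProb_const 1)).congr
      (Eventually.of_forall fun n ω => by ring)
  -- the rest of the spectrum stays below the Rayleigh quotient
  have hD : NullInProb P ((atTop : Filter (Finset J)).curry atTop) fun p ω =>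
      lam₁ * (s p.2 ω - 1) + r p.2 ω * (s p.2 ω)⁻¹ - t * gramError ψ p.1 (U · ω) p.2
        - sampleHS (remainder K lam₁ φ lam ψ p.1) (U · ω) p.2 :=
    (((hs1.const_mul lam₁).add hrs).comp_snd _ |>.sub
      ((NullInProb.curry fun F => h.nullInProb_gramError hU hlaw hind F).const_mul t)).sub
      (h.nullInProb_remainder_sampleHS hU hlaw hind)
  have hZ := (hs1.abs.comp_snd (atTop : Filter (Finset J))).add hD.abs
  have hg : 0 < lam₁ - t := sub_pos.2 h.sep_lt
  have hδ : 0 < min (1 / 2) ((lam₁ - t) / 2) := lt_min one_half_pos (half_pos hg)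
  have hY : NullInProb P atTop fun (n : ℕ) ω =>
      (√(n : ℝ))⁻¹ * (2 * |n * r n ω| + 4 / (lam₁ - t) * (n * E n ω)) := by
    refine (nullInProb_of_tendsto tendsto_inv_sqrt_atTop).mul_boundedInProb
      (BoundedInProb.add (BoundedInProb.const_mul 2 ?_) (hnE.const_mul _))
    exact hnr.mono (Eventually.of_forall fun n ω => by rw [abs_abs])
  refine NullInProb.of_curry (κ := Finset J) (l := atTop)
    (hZ.mono_of_small hδ (hY.comp_snd _) ?_)
  rw [eventually_curry_iff]
  refine Eventually.of_forall fun F => ?_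
  filter_upwards [eventually_gt_atTop 0] with n hn ω hω
  have hn' : (0 : ℝ) < n := by exact_mod_cast hn
  set Dn := lam₁ * (s n ω - 1) + r n ω * (s n ω)⁻¹ - t * gramError ψ F (U · ω) n
    - sampleHS (remainder K lam₁ φ lam ψ F) (U · ω) n with hDn
  have hω' : |s n ω - 1| + |Dn| ≤ min (1 / 2) ((lam₁ - t) / 2) := (le_abs_self _).trans hω
  have h1 : |s n ω - 1| ≤ 1 / 2 := by
    linarith [min_le_left (1 / 2 : ℝ) ((lam₁ - t) / 2), abs_nonneg Dn]
  have h2 : |Dn| ≤ (lam₁ - t) / 2 := by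
    linarith [min_le_right (1 / 2 : ℝ) ((lam₁ - t) / 2), abs_nonneg (s n ω - 1)]
  have hs2 : 1 / 2 ≤ s n ω := by linarith [(abs_le.1 h1).1]
  have hs0 : 0 < s n ω := by linarith
  set v := sampleVec (U · ω) n φ with hv
  have hTv : sampleOp K (U · ω) n v = (lam₁ * s n ω) • v + sampleOp R₀ (U · ω) n v := by
    rw [sampleOp_eq_expansion K lam₁ φ lam ψ ∅ (U · ω) n v, ← hv, real_inner_self_eq_norm_sq]
    simp [hR₀, hs, hv]
  have hq : ⟪v, sampleOp K (U · ω) n v⟫ / ‖v‖ ^ 2 = lam₁ * s n ω + r n ω * (s n ω)⁻¹ := by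
    rw [hTv, inner_add_right, inner_smul_right, real_inner_self_eq_norm_sq]
    change (lam₁ * s n ω * s n ω + r n ω) / s n ω = _
    field_simp
  have hbd := h.sampleTop_bounds F (U · ω) hn 0 (x := v) (by rw [add_zero]) hs0
    (D := lam₁ - t + Dn) (by rw [hq, norm_zero, hDn]; ring) (by linarith [(abs_le.1 h2).1])
    (lam₁ * s n ω)
  rw [hq, hTv, add_sub_cancel_left] at hbd
  change _ ∧ _ ≤ _ + E n ω / ((lam₁ - t + Dn) * s n ω) at hbd
  have hE0 : 0 ≤ E n ω := sq_nonneg _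
  have hEb : E n ω / ((lam₁ - t + Dn) * s n ω) ≤ 4 / (lam₁ - t) * E n ω := by
    rw [div_mul_eq_mul_div, mul_comm 4, div_le_div_iff₀ (mul_pos (by linarith [(abs_le.1 h2).1]) hs0)
      hg]
    have : (lam₁ - t) / 4 ≤ (lam₁ - t + Dn) * s n ω := by nlinarith [(abs_le.1 h2).1]
    nlinarith
  have hrb : |r n ω * (s n ω)⁻¹| ≤ 2 * |r n ω| := by
    rw [abs_mul, abs_of_pos (inv_pos.2 hs0), mul_comm]
    refine mul_le_mul_of_nonneg_right ?_ (abs_nonneg _)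
    rw [inv_le_comm₀ hs0 two_pos]; linarith
  have hfin : |sampleTop K (U · ω) n - lam₁ * s n ω|
      ≤ 2 * |r n ω| + 4 / (lam₁ - t) * E n ω := by
    have := abs_le.1 hrb
    have h0 : 0 ≤ 4 / (lam₁ - t) * E n ω := by positivity
    rw [abs_le]
    constructor <;> linarith [hbd.1, hbd.2]
  refine le_trans ?_ (le_abs_self _)
  rw [abs_mul, abs_of_nonneg (Real.sqrt_nonneg _), abs_mul, abs_of_pos hn']
  have hsq : (√(n : ℝ))⁻¹ * n = √(n : ℝ) := by
    rw [inv_mul_eq_div, Real.div_sqrt]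
  calc √(n : ℝ) * |sampleTop K (U · ω) n - lam₁ * s n ω|
      ≤ √(n : ℝ) * (2 * |r n ω| + 4 / (lam₁ - t) * E n ω) := by gcongr
    _ = ((√(n : ℝ))⁻¹ * n) * (2 * |r n ω| + 4 / (lam₁ - t) * E n ω) := by rw [hsq]
    _ = _ := by ring

end FirstOrder

/-! ### A trial vector accurate to second order -/

section Trial

variable {E J : Type*} [NormedAddCommGroup E] [InnerProductSpace ℝ E]

/-- First-order correction of the trial vector `v` along the almost orthonormal vectors `e k`, with
coefficients `d k` times the coordinates of `v`. -/
noncomputable def trialCorrection (F : Finset J) (d : J → ℝ) (e : J → E) (v : E) : E :=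
  ∑ k ∈ F, (d k * ⟪v, e k⟫) • e k

variable (F : Finset J) {d lam : J → ℝ} {e : J → E} {v : E} {lam₁ : ℝ} {T R : E →ₗ[ℝ] E}

theorem inner_trialCorrection :
    ⟪v, trialCorrection F d e v⟫ = ∑ k ∈ F, d k * ⟪v, e k⟫ ^ 2 := by
  rw [trialCorrection, inner_sum]
  exact Finset.sum_congr rfl fun k _ => by rw [inner_smul_right]; ring

theorem norm_sq_add_trialCorrection (hv : ‖v‖ = 1) :
    ‖v + trialCorrection F d e v‖ ^ 2 = 1 + 2 * (∑ k ∈ F, d k * ⟪v, e k⟫ ^ 2)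
      + ‖trialCorrection F d e v‖ ^ 2 := by
  rw [norm_add_sq_real, hv, inner_trialCorrection, one_pow]

variable [DecidableEq J]

/-- The error in the coordinates of the correction caused by the `e k` not being orthonormal. -/
noncomputable def gramDefect (F : Finset J) (d : J → ℝ) (e : J → E) (v : E) (k : J) : ℝ :=
  ∑ l ∈ F, d l * ⟪v, e l⟫ * (⟪e k, e l⟫ - if k = l then 1 else 0)

theorem inner_right_trialCorrection {k : J} (hk : k ∈ F) :
    ⟪e k, trialCorrection F d e v⟫ = d k * ⟪v, e k⟫ + gramDefect F d e v k := by
  simp only [trialCorrection, gramDefect, inner_sum, inner_smul_right, mul_sub,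
    Finset.sum_sub_distrib, mul_ite, mul_one, mul_zero, Finset.sum_ite_eq, if_pos hk]
  ring

theorem norm_sq_trialCorrection :
    ‖trialCorrection F d e v‖ ^ 2 = (∑ k ∈ F, d k ^ 2 * ⟪v, e k⟫ ^ 2)
      + ∑ k ∈ F, d k * ⟪v, e k⟫ * gramDefect F d e v k := by
  rw [← real_inner_self_eq_norm_sq]
  nth_rewrite 1 [trialCorrection]
  rw [sum_inner, ← Finset.sum_add_distrib]
  refine Finset.sum_congr rfl fun k hk => ?_
  rw [inner_smul_left, conj_trivial, inner_right_trialCorrection F hk]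
  ring

/-- The choice of `d` cancels the residual up to the Gram defect and the remainder. -/
theorem map_trialVector_sub (hv : ‖v‖ = 1)
    (hT : ∀ x, T x = (lam₁ * ⟪v, x⟫) • v + ∑ k ∈ F, (lam k * ⟪e k, x⟫) • e k + R x)
    (hd : ∀ k, lam₁ * d k = lam k * (1 + d k)) :
    T (v + trialCorrection F d e v) - lam₁ • (v + trialCorrection F d e v)
      = (lam₁ * ∑ k ∈ F, d k * ⟪v, e k⟫ ^ 2) • v
        + ∑ k ∈ F, (lam k * gramDefect F d e v k) • e k
        + R v + R (trialCorrection F d e v) := by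
  have h1 : ∑ k ∈ F, (lam k * ⟪e k, v + trialCorrection F d e v⟫) • e k
      = lam₁ • trialCorrection F d e v + ∑ k ∈ F, (lam k * gramDefect F d e v k) • e k := by
    rw [trialCorrection, Finset.smul_sum, ← Finset.sum_add_distrib]
    refine Finset.sum_congr rfl fun k hk => ?_
    rw [smul_smul, ← add_smul, ← trialCorrection, inner_add_right,
      inner_right_trialCorrection F hk, real_inner_comm v, ← mul_assoc, hd]
    congr 1; ring
  rw [hT, h1, inner_add_right, real_inner_self_eq_norm_sq, hv, inner_trialCorrection, map_add,
    mul_add, add_smul, smul_add]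
  simp only [one_pow, mul_one]
  abel

theorem inner_map_trialVector_sub (hv : ‖v‖ = 1)
    (hT : ∀ x, T x = (lam₁ * ⟪v, x⟫) • v + ∑ k ∈ F, (lam k * ⟪e k, x⟫) • e k + R x)
    (hR : R.IsSymmetric) (hd : ∀ k, lam₁ * d k = lam k * (1 + d k)) :
    ⟪v + trialCorrection F d e v, T (v + trialCorrection F d e v)⟫
        - lam₁ * ‖v + trialCorrection F d e v‖ ^ 2
      = (∑ k ∈ F, lam₁ * d k * ⟪v, e k⟫ ^ 2) + ⟪v, R v⟫
        + (lam₁ * (∑ k ∈ F, d k * ⟪v, e k⟫ ^ 2) ^ 2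
          + ∑ k ∈ F, (lam₁ * d k * ⟪v, e k⟫ * gramDefect F d e v k
            + lam k * gramDefect F d e v k ^ 2)
          + 2 * ⟪trialCorrection F d e v, R v⟫
          + ⟪trialCorrection F d e v, R (trialCorrection F d e v)⟫) := by
  set w := trialCorrection F d e v with hw
  set a := ∑ k ∈ F, d k * ⟪v, e k⟫ ^ 2 with ha
  have hRw : ⟪v, R w⟫ = ⟪w, R v⟫ := by rw [← hR v w, real_inner_comm]
  have h1 : ⟪v + w, T (v + w)⟫ - lam₁ * ‖v + w‖ ^ 2
      = ⟪v + w, T (v + w) - lam₁ • (v + w)⟫ := by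
    rw [inner_sub_right, inner_smul_right, real_inner_self_eq_norm_sq]
  have h2 : ⟪v + w, ∑ k ∈ F, (lam k * gramDefect F d e v k) • e k⟫
      = ∑ k ∈ F, (lam₁ * d k * ⟪v, e k⟫ * gramDefect F d e v k
            + lam k * gramDefect F d e v k ^ 2) := by
    rw [inner_sum]
    refine Finset.sum_congr rfl fun k hk => ?_
    rw [inner_smul_right, inner_add_left, real_inner_comm (e k) w, hw,
      inner_right_trialCorrection F hk, hd]
    ring
  have h3 : ⟪v + w, v⟫ = 1 + a := by
    rw [inner_add_left, real_inner_self_eq_norm_sq, hv, real_inner_comm, hw,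
      inner_trialCorrection, one_pow]
  have h4 : ∑ k ∈ F, lam₁ * d k * ⟪v, e k⟫ ^ 2 = lam₁ * a := by
    rw [ha, Finset.mul_sum]; exact Finset.sum_congr rfl fun k _ => by ring
  rw [h1, map_trialVector_sub F hv hT hd, ← hw, inner_add_right, inner_add_right, inner_add_right,
    h2, inner_smul_right, h3, inner_add_left, inner_add_left, hRw, h4]
  ring

end Trial

/-! ### Fluctuations of order one when the leading eigenfunction is constant -/

section SecondOrder

variable {Ω J : Type*} [MeasurableSpace Ω] {P : Measure Ω} [IsProbabilityMeasure P] {U : ℕ → Ω → I}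
  {K : C(I × I, ℝ)} {lam₁ t : ℝ} {lam : J → ℝ} {ψ : J → C(I, ℝ)}

/-- The empirical mean of `ψ k`, as a coordinate of the sampled constant function. -/
noncomputable def sampleCoord (ψ : J → C(I, ℝ)) (u : ℕ → I) (n : ℕ) (k : J) : ℝ :=
  ⟪sampleVec u n 1, sampleVec u n (ψ k)⟫

/-- `trialCorrection` for the sampled constant function and the sampled functions `ψ k`. -/
noncomputable def sampleCorrection (d : J → ℝ) (ψ : J → C(I, ℝ)) (F : Finset J) (u : ℕ → I)
    (n : ℕ) : EuclideanSpace ℝ (Fin n) :=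
  trialCorrection F d (fun k => sampleVec u n (ψ k)) (sampleVec u n 1)

theorem sampleCoord_eq (ψ : J → C(I, ℝ)) (u : ℕ → I) (n : ℕ) (k : J) :
    sampleCoord ψ u n k = (n : ℝ)⁻¹ * ∑ i ∈ Finset.range n, ψ k (u i) := by
  rw [sampleCoord, inner_sampleVec]; simp

theorem norm_sampleVec_one (u : ℕ → I) {n : ℕ} (hn : 0 < n) : ‖sampleVec u n 1‖ = 1 := by
  have h : ‖sampleVec u n 1‖ ^ 2 = 1 := by
    rw [← real_inner_self_eq_norm_sq, inner_sampleVec]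
    have : (n : ℝ) ≠ 0 := by positivity
    simp [this]
  rwa [pow_eq_one_iff_of_nonneg (norm_nonneg _) two_ne_zero] at h

theorem sqrt_mul_inv_eq (n : ℕ) : √(n : ℝ) * (n : ℝ)⁻¹ = (√(n : ℝ))⁻¹ := by
  rcases Nat.eq_zero_or_pos n with rfl | hn
  · simp
  have hn' : (0 : ℝ) < n := by exact_mod_cast hn
  rw [← inv_sqrt_mul_inv_sqrt, mul_inv_cancel_left₀ (Real.sqrt_pos.2 hn').ne']

theorem IsKernelExpansion.integral_right (h : IsKernelExpansion K lam₁ t 1 lam ψ) (k : J) :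
    ∫ x, ψ k x = 0 := by
  simpa using h.integral_top_mul k

theorem sqrt_mul_sampleCoord (ψ : J → C(I, ℝ)) (u : ℕ → I) (n : ℕ) (k : J) :
    √(n : ℝ) * sampleCoord ψ u n k = (√(n : ℝ))⁻¹ * ∑ i ∈ Finset.range n, ψ k (u i) := by
  rw [sampleCoord_eq, ← mul_assoc, sqrt_mul_inv_eq]

theorem IsKernelExpansion.boundedInProb_sampleCoord (h : IsKernelExpansion K lam₁ t 1 lam ψ)
    (hU : ∀ i, Measurable (U i)) (hlaw : ∀ i, HasLaw (U i) (volume : Measure I) P)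
    (hind : iIndepFun U P) (k : J) :
    BoundedInProb P atTop fun (n : ℕ) ω => √(n : ℝ) * sampleCoord ψ (U · ω) n k :=
  (boundedInProb_inv_sqrt_mul_sum hU hlaw hind (h.integral_right k)).congr
    (Eventually.of_forall fun n ω => sqrt_mul_sampleCoord ψ (U · ω) n k)

theorem integrable_mul_sq_sampleCoord (hU : ∀ i, Measurable (U i)) (n : ℕ)
    (k : J) : Integrable (fun ω => n * sampleCoord ψ (U · ω) n k ^ 2) P := by
  simp only [sampleCoord_eq]
  exact ((memLp_finsetSum _ fun i _ => memLp_two_comp hU (ψ k) i).const_mul _).integrable_sq.const_mul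
    _

theorem IsKernelExpansion.integral_mul_sq_sampleCoord (h : IsKernelExpansion K lam₁ t 1 lam ψ)
    (hU : ∀ i, Measurable (U i)) (hlaw : ∀ i, HasLaw (U i) (volume : Measure I) P)
    (hind : iIndepFun U P) {n : ℕ} (hn : 0 < n) (k : J) :
    ∫ ω, n * sampleCoord ψ (U · ω) n k ^ 2 ∂P = 1 := by
  have hn' : (n : ℝ) ≠ 0 := by positivity
  have h2 : ∫ x, ψ k x ^ 2 = 1 := by simpa [sq] using h.integral_mul_self k
  simp only [sampleCoord_eq, mul_pow]
  rw [integral_const_mul, integral_const_mul,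
    integral_sq_sum_comp hU hlaw hind (h.integral_right k) n, h2]
  field_simp

/-- Weighted sums of the squared normalized coordinates are bounded in probability, uniformly in the
truncation, as soon as the weights are summable. -/
theorem IsKernelExpansion.boundedInProb_sum_sampleCoord (h : IsKernelExpansion K lam₁ t 1 lam ψ)
    (hU : ∀ i, Measurable (U i)) (hlaw : ∀ i, HasLaw (U i) (volume : Measure I) P)
    (hind : iIndepFun U P) {c : J → ℝ} (hc : Summable fun k => |c k|) :
    BoundedInProb P ((atTop : Filter (Finset J)).curry atTop) fun (p : Finset J × ℕ) ω =>
      p.2 * ∑ k ∈ p.1, c k * sampleCoord ψ (U · ω) p.2 k ^ 2 := by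
  have h1 : BoundedInProb P ((atTop : Filter (Finset J)).curry atTop) fun (p : Finset J × ℕ) ω =>
      ∑ k ∈ p.1, |c k| * (p.2 * sampleCoord ψ (U · ω) p.2 k ^ 2) := by
    refine boundedInProb_of_integral_le (C := ∑' k, |c k|)
      (fun p ω => Finset.sum_nonneg fun k _ => by positivity)
      (Eventually.of_forall fun p => integrable_finsetSum _ fun k _ =>
        (integrable_mul_sq_sampleCoord hU p.2 k).const_mul _)
      (eventually_curry_iff.2 (Eventually.of_forall fun F => ?_))
    filter_upwards [eventually_gt_atTop 0] with n hn
    rw [integral_finsetSum _ fun k _ => (integrable_mul_sq_sampleCoord hU n k).const_mul _]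
    refine (Finset.sum_congr rfl fun k _ => ?_).trans_le
      (hc.sum_le_tsum F fun k _ => abs_nonneg (c k))
    rw [integral_const_mul, h.integral_mul_sq_sampleCoord hU hlaw hind hn, mul_one]
  refine h1.mono (Eventually.of_forall fun p ω => ?_)
  refine le_trans ?_ (le_abs_self _)
  rw [Finset.mul_sum]
  refine (Finset.abs_sum_le_sum_abs _ _).trans (Finset.sum_le_sum fun k _ => le_of_eq ?_)
  rw [abs_mul, abs_mul, Nat.abs_cast, abs_of_nonneg (sq_nonneg (sampleCoord ψ (U · ω) p.2 k))]
  ring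

theorem IsKernelExpansion.abs_div_sub_le {φ : C(I, ℝ)} (h : IsKernelExpansion K lam₁ t φ lam ψ)
    (k : J) : |lam k / (lam₁ - lam k)| ≤ (lam₁ - t)⁻¹ * |lam k| := by
  have h1 : 0 < lam₁ - t := sub_pos.2 h.sep_lt
  have h2 : lam₁ - t ≤ lam₁ - lam k := by linarith [h.le_sep k]
  rw [abs_div, abs_of_pos (h1.trans_le h2), div_eq_inv_mul]
  gcongr

theorem IsKernelExpansion.summable_abs_div_sub {φ : C(I, ℝ)}
    (h : IsKernelExpansion K lam₁ t φ lam ψ) (hsum : Summable lam) :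
    Summable fun k => |lam k / (lam₁ - lam k)| :=
  (hsum.abs.mul_left _).of_nonneg_of_le (fun _ => abs_nonneg _) h.abs_div_sub_le

theorem IsKernelExpansion.summable_abs_sq_div_sub {φ : C(I, ℝ)}
    (h : IsKernelExpansion K lam₁ t φ lam ψ) :
    Summable fun k => |(lam k / (lam₁ - lam k)) ^ 2| := by
  refine (h.hasSum_sq.summable.mul_left ((lam₁ - t)⁻¹ ^ 2)).of_nonneg_of_le
    (fun _ => abs_nonneg _) fun k => ?_
  rw [abs_pow, ← sq_abs (lam k), ← mul_pow]
  exact pow_le_pow_left₀ (abs_nonneg _) (h.abs_div_sub_le k) 2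

theorem IsKernelExpansion.mul_div_sub_eq {φ : C(I, ℝ)} (h : IsKernelExpansion K lam₁ t φ lam ψ)
    (k : J) : lam₁ * (lam k / (lam₁ - lam k)) = lam k * (1 + lam k / (lam₁ - lam k)) := by
  have : lam₁ - lam k ≠ 0 := by linarith [h.le_sep k, h.sep_lt]
  field_simp
  ring

variable [DecidableEq J]

/-- `gramDefect` for the sampled constant function and the sampled functions `ψ k`. -/
noncomputable def sampleDefect (d : J → ℝ) (ψ : J → C(I, ℝ)) (F : Finset J) (u : ℕ → I) (n : ℕ)
    (k : J) : ℝ :=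
  gramDefect F d (fun k => sampleVec u n (ψ k)) (sampleVec u n 1) k

theorem IsKernelExpansion.nullInProb_sampleDefect (h : IsKernelExpansion K lam₁ t 1 lam ψ)
    (hU : ∀ i, Measurable (U i)) (hlaw : ∀ i, HasLaw (U i) (volume : Measure I) P)
    (hind : iIndepFun U P) (d : J → ℝ) (F : Finset J) (k : J) :
    NullInProb P atTop fun (n : ℕ) ω => √(n : ℝ) * sampleDefect d ψ F (U · ω) n k := by
  have h1 : NullInProb P atTop fun (n : ℕ) ω => ∑ l ∈ F,
      (⟪sampleVec (U · ω) n (ψ k), sampleVec (U · ω) n (ψ l)⟫ - if k = l then 1 else 0)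
        * (d l * (√(n : ℝ) * sampleCoord ψ (U · ω) n l)) := by
    refine NullInProb.sum fun l _ => NullInProb.mul_boundedInProb ?_
      ((h.boundedInProb_sampleCoord hU hlaw hind l).const_mul _)
    refine (nullInProb_inner_sampleVec_sub hU hlaw hind (ψ k) (ψ l)).congr
      (Eventually.of_forall fun n ω => ?_)
    split_ifs with hkl
    · rw [hkl, h.integral_mul_self]
    · rw [h.integral_mul_of_ne k l hkl]
  refine h1.congr (Eventually.of_forall fun n ω => ?_)
  rw [sampleDefect, gramDefect, Finset.mul_sum]
  exact Finset.sum_congr rfl fun l _ => by rw [sampleCoord]; ring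

/-- `n ‖w‖²` is bounded in probability for the correction `w`. -/
theorem IsKernelExpansion.boundedInProb_mul_norm_sq_sampleCorrection
    (h : IsKernelExpansion K lam₁ t 1 lam ψ)
    (hU : ∀ i, Measurable (U i)) (hlaw : ∀ i, HasLaw (U i) (volume : Measure I) P)
    (hind : iIndepFun U P) {d : J → ℝ} (hd : Summable fun k => |d k ^ 2|) :
    BoundedInProb P ((atTop : Filter (Finset J)).curry atTop) fun (p : Finset J × ℕ) ω =>
      p.2 * ‖sampleCorrection d ψ p.1 (U · ω) p.2‖ ^ 2 := by
  have h1 : NullInProb P ((atTop : Filter (Finset J)).curry atTop) fun (p : Finset J × ℕ) ω =>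
      ∑ k ∈ p.1, √(p.2 : ℝ) * sampleDefect d ψ p.1 (U · ω) p.2 k
        * (d k * (√(p.2 : ℝ) * sampleCoord ψ (U · ω) p.2 k)) :=
    NullInProb.curry fun F => NullInProb.sum fun k _ =>
      (h.nullInProb_sampleDefect hU hlaw hind d F k).mul_boundedInProb
        ((h.boundedInProb_sampleCoord hU hlaw hind k).const_mul _)
  refine ((h.boundedInProb_sum_sampleCoord hU hlaw hind hd).add h1.boundedInProb).congr
    (Eventually.of_forall fun p ω => ?_)
  rw [sampleCorrection, norm_sq_trialCorrection, mul_add]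
  congr 1
  rw [Finset.mul_sum]
  refine Finset.sum_congr rfl fun k _ => ?_
  nth_rewrite 1 [← Real.mul_self_sqrt (Nat.cast_nonneg p.2)]
  rw [sampleDefect, sampleCoord]
  ring

/-- The part of the residual that lies along the sampled `ψ k` is negligible. -/
theorem IsKernelExpansion.nullInProb_mul_norm_sq_sum_sampleDefect
    (h : IsKernelExpansion K lam₁ t 1 lam ψ)
    (hU : ∀ i, Measurable (U i)) (hlaw : ∀ i, HasLaw (U i) (volume : Measure I) P)
    (hind : iIndepFun U P) (d : J → ℝ) (F : Finset J) :
    NullInProb P atTop fun (n : ℕ) ω => n *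
      ‖∑ k ∈ F, (lam k * sampleDefect d ψ F (U · ω) n k) • sampleVec (U · ω) n (ψ k)‖ ^ 2 := by
  have hb : ∀ k, BoundedInProb P atTop fun (n : ℕ) ω => ‖sampleVec (U · ω) n (ψ k)‖ := by
    intro k
    refine boundedInProb_of_sq (((nullInProb_inner_sampleVec_sub hU hlaw hind (ψ k)
      (ψ k)).boundedInProb.add (boundedInProb_const (∫ x, ψ k x * ψ k x))).congr
      (Eventually.of_forall fun n ω => ?_))
    rw [real_inner_self_eq_norm_sq, sub_add_cancel]
  have h1 : NullInProb P atTop fun (n : ℕ) ω => ∑ k ∈ F,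
      |lam k * (√(n : ℝ) * sampleDefect d ψ F (U · ω) n k)| * ‖sampleVec (U · ω) n (ψ k)‖ :=
    NullInProb.sum fun k _ =>
      ((h.nullInProb_sampleDefect hU hlaw hind d F k).const_mul _).abs.mul_boundedInProb (hb k)
  refine h1.sq.mono (Eventually.of_forall fun n ω => ?_)
  rw [abs_of_nonneg (by positivity), abs_of_nonneg (sq_nonneg _)]
  have h2 : ‖∑ k ∈ F, (√(n : ℝ) * (lam k * sampleDefect d ψ F (U · ω) n k)) •
      sampleVec (U · ω) n (ψ k)‖ ≤ ∑ k ∈ F,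
      |lam k * (√(n : ℝ) * sampleDefect d ψ F (U · ω) n k)| * ‖sampleVec (U · ω) n (ψ k)‖ := by
    refine norm_sum_le_of_le _ fun k _ => le_of_eq ?_
    rw [norm_smul, Real.norm_eq_abs]
    congr 2; ring
  refine le_trans (le_of_eq ?_) (pow_le_pow_left₀ (norm_nonneg _) h2 2)
  simp only [mul_smul, ← Finset.smul_sum]
  rw [norm_smul, mul_pow, Real.norm_eq_abs, sq_abs, Real.sq_sqrt (Nat.cast_nonneg n)]

theorem IsKernelExpansion.nullInProb_sum_mul_sampleDefect
    (h : IsKernelExpansion K lam₁ t 1 lam ψ)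
    (hU : ∀ i, Measurable (U i)) (hlaw : ∀ i, HasLaw (U i) (volume : Measure I) P)
    (hind : iIndepFun U P) (d : J → ℝ) (F : Finset J) :
    NullInProb P atTop fun (n : ℕ) ω => n * ∑ k ∈ F,
      (lam₁ * d k * sampleCoord ψ (U · ω) n k * sampleDefect d ψ F (U · ω) n k
        + lam k * sampleDefect d ψ F (U · ω) n k ^ 2) := by
  have h1 : NullInProb P atTop fun (n : ℕ) ω => ∑ k ∈ F,
      (√(n : ℝ) * sampleDefect d ψ F (U · ω) n k
          * (lam₁ * d k * (√(n : ℝ) * sampleCoord ψ (U · ω) n k))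
        + lam k * (√(n : ℝ) * sampleDefect d ψ F (U · ω) n k) ^ 2) :=
    NullInProb.sum fun k _ =>
      ((h.nullInProb_sampleDefect hU hlaw hind d F k).mul_boundedInProb
        ((h.boundedInProb_sampleCoord hU hlaw hind k).const_mul _)).add
      ((h.nullInProb_sampleDefect hU hlaw hind d F k).sq.const_mul _)
  refine h1.congr (Eventually.of_forall fun n ω => ?_)
  rw [Finset.mul_sum]
  refine Finset.sum_congr rfl fun k _ => ?_
  have hsq := Real.sq_sqrt (Nat.cast_nonneg (α := ℝ) n)
  linear_combination -(lam₁ * d k * sampleCoord ψ (U · ω) n k * sampleDefect d ψ F (U · ω) n k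
    + lam k * sampleDefect d ψ F (U · ω) n k ^ 2) * hsq

/-- The second-order trial vector. -/
noncomputable def sampleTrial (d : J → ℝ) (ψ : J → C(I, ℝ)) (F : Finset J) (u : ℕ → I) (n : ℕ) :
    EuclideanSpace ℝ (Fin n) :=
  sampleVec u n 1 + sampleCorrection d ψ F u n

theorem IsKernelExpansion.nullInProb_norm_sq_sampleTrial_sub_one
    (h : IsKernelExpansion K lam₁ t 1 lam ψ)
    (hU : ∀ i, Measurable (U i)) (hlaw : ∀ i, HasLaw (U i) (volume : Measure I) P)
    (hind : iIndepFun U P) {d : J → ℝ} (hd : Summable fun k => |d k|)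
    (hd2 : Summable fun k => |d k ^ 2|) :
    NullInProb P ((atTop : Filter (Finset J)).curry atTop) fun (p : Finset J × ℕ) ω =>
      ‖sampleTrial d ψ p.1 (U · ω) p.2‖ ^ 2 - 1 := by
  have h1 := ((nullInProb_of_tendsto (P := P)
    tendsto_inv_atTop_nhds_zero_nat).comp_snd (atTop : Filter (Finset J))).mul_boundedInProb
    (((h.boundedInProb_sum_sampleCoord hU hlaw hind hd).const_mul 2).add
      (h.boundedInProb_mul_norm_sq_sampleCorrection hU hlaw hind hd2))
  refine h1.congr (eventually_curry_iff.2 (Eventually.of_forall fun F => ?_))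
  filter_upwards [eventually_gt_atTop 0] with n hn ω
  have hn' : (n : ℝ) ≠ 0 := by positivity
  simp only [sampleTrial, sampleCorrection, sampleCoord]
  rw [norm_sq_add_trialCorrection F (norm_sampleVec_one _ hn)]
  field_simp
  ring

/-- The remainder of the expansion contributes only its trace to the quadratic form at the trial
vector. -/
theorem IsKernelExpansion.nullInProb_inner_sampleOp_sampleTrial_sub
    (h : IsKernelExpansion K lam₁ t 1 lam ψ)
    (hU : ∀ i, Measurable (U i)) (hlaw : ∀ i, HasLaw (U i) (volume : Measure I) P)
    (hind : iIndepFun U P) {d : J → ℝ} (hd : Summable fun k => |d k|)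
    (hd2 : Summable fun k => |d k ^ 2|) (hdlam : ∀ k, lam₁ * d k = lam k * (1 + d k)) :
    NullInProb P ((atTop : Filter (Finset J)).curry atTop) fun (p : Finset J × ℕ) ω =>
      p.2 * (⟪sampleTrial d ψ p.1 (U · ω) p.2,
          sampleOp K (U · ω) p.2 (sampleTrial d ψ p.1 (U · ω) p.2)⟫
          - lam₁ * ‖sampleTrial d ψ p.1 (U · ω) p.2‖ ^ 2)
        - (p.2 * ∑ k ∈ p.1, lam₁ * d k * sampleCoord ψ (U · ω) p.2 k ^ 2
          + ((∫ x, K (x, x)) - lam₁ - ∑ k ∈ p.1, lam k)) := by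
  have hn0 := (nullInProb_of_tendsto (P := P)
    tendsto_inv_atTop_nhds_zero_nat).comp_snd (atTop : Filter (Finset J))
  have ha := h.boundedInProb_sum_sampleCoord hU hlaw hind hd
  have hW := h.boundedInProb_mul_norm_sq_sampleCorrection hU hlaw hind hd2
  have hρ := h.nullInProb_remainder_sampleHS hU hlaw hind
  have hRv := nullInProb_mul_inner_sampleOp_sub hU hlaw hind h.tendsto_integral_sq_remainder
    (fun F => h.remainder_symm F) (fun F => h.integral_remainder_mul_top F)
  have hRv2 := nullInProb_mul_norm_sq_sampleOp hU hlaw hind h.tendsto_integral_sq_remainder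
    (fun F => h.integral_remainder_mul_top F)
  have hdef : NullInProb P ((atTop : Filter (Finset J)).curry atTop) fun (p : Finset J × ℕ) ω =>
      p.2 * ∑ k ∈ p.1,
        (lam₁ * d k * sampleCoord ψ (U · ω) p.2 k * sampleDefect d ψ p.1 (U · ω) p.2 k
          + lam k * sampleDefect d ψ p.1 (U · ω) p.2 k ^ 2) :=
    NullInProb.curry fun F => h.nullInProb_sum_mul_sampleDefect hU hlaw hind d F
  have hwRv : NullInProb P ((atTop : Filter (Finset J)).curry atTop) fun (p : Finset J × ℕ) ω =>
      p.2 * ⟪sampleCorrection d ψ p.1 (U · ω) p.2,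
        sampleOp (remainder K lam₁ 1 lam ψ p.1) (U · ω) p.2 (sampleVec (U · ω) p.2 1)⟫ := by
    refine (hRv2.sqrt.mul_boundedInProb hW.sqrt).mono (Eventually.of_forall fun p ω => ?_)
    rw [abs_mul, Nat.abs_cast, ← Real.sqrt_mul (by positivity), abs_of_nonneg (Real.sqrt_nonneg _)]
    refine Real.le_sqrt_of_sq_le ?_
    rw [mul_pow]
    have := pow_le_pow_left₀ (abs_nonneg _) (abs_real_inner_le_norm
      (sampleCorrection d ψ p.1 (U · ω) p.2)
      (sampleOp (remainder K lam₁ 1 lam ψ p.1) (U · ω) p.2 (sampleVec (U · ω) p.2 1))) 2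
    refine (mul_le_mul_of_nonneg_left this (by positivity)).trans (le_of_eq ?_)
    ring
  have hwRw : NullInProb P ((atTop : Filter (Finset J)).curry atTop) fun (p : Finset J × ℕ) ω =>
      p.2 * ⟪sampleCorrection d ψ p.1 (U · ω) p.2,
        sampleOp (remainder K lam₁ 1 lam ψ p.1) (U · ω) p.2
          (sampleCorrection d ψ p.1 (U · ω) p.2)⟫ := by
    refine (hρ.mul_boundedInProb hW).mono (Eventually.of_forall fun p ω => ?_)
    rw [abs_mul, Nat.abs_cast]
    refine le_trans ?_ (le_abs_self _)
    calc _ ≤ (p.2 : ℝ) * (sampleHS _ _ _ * ‖sampleCorrection d ψ p.1 (U · ω) p.2‖ ^ 2) :=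
          mul_le_mul_of_nonneg_left (abs_inner_sampleOp_le _ _ _ _) (by positivity)
      _ = _ := by ring
  refine ((((hRv.add ((hn0.mul_boundedInProb (ha.mul ha)).const_mul lam₁)).add hdef).add
    (hwRv.const_mul 2)).add hwRw).congr (eventually_curry_iff.2 (Eventually.of_forall fun F => ?_))
  filter_upwards [eventually_gt_atTop 0] with n hn ω
  have hn' : (n : ℝ) ≠ 0 := by positivity
  have hτ : ∫ x, biMul (remainder K lam₁ 1 lam ψ F) 1 (x, x)
      = (∫ x, K (x, x)) - lam₁ - ∑ k ∈ F, lam k := by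
    rw [← h.integral_remainder_diag F]
    exact integral_congr_ae (Eventually.of_forall fun x => by simp [biMul])
  simp only [hτ, sampleTrial, sampleCorrection, sampleCoord, sampleDefect]
  rw [inner_map_trialVector_sub F (norm_sampleVec_one _ hn)
    (sampleOp_eq_expansion K lam₁ 1 lam ψ F (U · ω) n)
    (sampleOp_isSymmetric (h.remainder_symm F) _ _) hdlam]
  field_simp
  ring

theorem norm_sq_add_four_le {E : Type*} [SeminormedAddCommGroup E] (a b c d : E) :
    ‖a + b + c + d‖ ^ 2 ≤ 4 * (‖a‖ ^ 2 + ‖b‖ ^ 2 + ‖c‖ ^ 2 + ‖d‖ ^ 2) := by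
  have h : ‖a + b + c + d‖ ≤ ‖a‖ + ‖b‖ + ‖c‖ + ‖d‖ := norm_add₄_le
  refine (pow_le_pow_left₀ (norm_nonneg _) h 2).trans ?_
  nlinarith [sq_nonneg (‖a‖ - ‖b‖), sq_nonneg (‖a‖ - ‖c‖), sq_nonneg (‖a‖ - ‖d‖),
    sq_nonneg (‖b‖ - ‖c‖), sq_nonneg (‖b‖ - ‖d‖), sq_nonneg (‖c‖ - ‖d‖)]

theorem IsKernelExpansion.nullInProb_mul_norm_sq_residual
    (h : IsKernelExpansion K lam₁ t 1 lam ψ)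
    (hU : ∀ i, Measurable (U i)) (hlaw : ∀ i, HasLaw (U i) (volume : Measure I) P)
    (hind : iIndepFun U P) {d : J → ℝ} (hd : Summable fun k => |d k|)
    (hd2 : Summable fun k => |d k ^ 2|) (hdlam : ∀ k, lam₁ * d k = lam k * (1 + d k)) :
    NullInProb P ((atTop : Filter (Finset J)).curry atTop) fun (p : Finset J × ℕ) ω =>
      p.2 * ‖sampleOp K (U · ω) p.2 (sampleTrial d ψ p.1 (U · ω) p.2)
        - lam₁ • sampleTrial d ψ p.1 (U · ω) p.2‖ ^ 2 := by
  have hn0 := (nullInProb_of_tendsto (P := P)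
    tendsto_inv_atTop_nhds_zero_nat).comp_snd (atTop : Filter (Finset J))
  have ha := h.boundedInProb_sum_sampleCoord hU hlaw hind hd
  have hW := h.boundedInProb_mul_norm_sq_sampleCorrection hU hlaw hind hd2
  have hρ := h.nullInProb_remainder_sampleHS hU hlaw hind
  have hRv2 := nullInProb_mul_norm_sq_sampleOp hU hlaw hind h.tendsto_integral_sq_remainder
    (fun F => h.integral_remainder_mul_top F)
  have hdef : NullInProb P ((atTop : Filter (Finset J)).curry atTop) fun (p : Finset J × ℕ) ω =>
      p.2 * ‖∑ k ∈ p.1, (lam k * sampleDefect d ψ p.1 (U · ω) p.2 k) •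
        sampleVec (U · ω) p.2 (ψ k)‖ ^ 2 :=
    NullInProb.curry fun F => h.nullInProb_mul_norm_sq_sum_sampleDefect hU hlaw hind d F
  refine (((((hn0.mul_boundedInProb (ha.mul ha)).const_mul (lam₁ ^ 2)).add hdef).add
    hRv2).add (hρ.sq.mul_boundedInProb hW)).const_mul 4 |>.mono
    (eventually_curry_iff.2 (Eventually.of_forall fun F => ?_))
  filter_upwards [eventually_gt_atTop 0] with n hn ω
  have hn' : (n : ℝ) ≠ 0 := by positivity
  refine le_trans ?_ (le_abs_self _)
  rw [abs_of_nonneg (by positivity)]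
  have h1 : ‖sampleOp (remainder K lam₁ 1 lam ψ F) (U · ω) n
      (sampleCorrection d ψ F (U · ω) n)‖ ^ 2 ≤ sampleHS (remainder K lam₁ 1 lam ψ F) (U · ω) n ^ 2
        * ‖sampleCorrection d ψ F (U · ω) n‖ ^ 2 := by
    rw [← mul_pow]
    exact pow_le_pow_left₀ (norm_nonneg _) (norm_sampleOp_le _ _ _ _) 2
  have h2 := map_trialVector_sub F (norm_sampleVec_one (U · ω) hn)
    (sampleOp_eq_expansion K lam₁ 1 lam ψ F (U · ω) n) hdlam
  have h3 := norm_sq_add_four_le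
    ((lam₁ * ∑ k ∈ F, d k * sampleCoord ψ (U · ω) n k ^ 2) • sampleVec (U · ω) n 1)
    (∑ k ∈ F, (lam k * sampleDefect d ψ F (U · ω) n k) • sampleVec (U · ω) n (ψ k))
    (sampleOp (remainder K lam₁ 1 lam ψ F) (U · ω) n (sampleVec (U · ω) n 1))
    (sampleOp (remainder K lam₁ 1 lam ψ F) (U · ω) n (sampleCorrection d ψ F (U · ω) n))
  rw [norm_smul, norm_sampleVec_one (U · ω) hn, mul_one, Real.norm_eq_abs, sq_abs] at h3
  have h4 : ‖sampleOp K (U · ω) n (sampleTrial d ψ F (U · ω) n)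
        - lam₁ • sampleTrial d ψ F (U · ω) n‖ ^ 2 ≤ _ := (congrArg (fun x => ‖x‖ ^ 2) h2).trans_le h3
  refine (mul_le_mul_of_nonneg_left (h4.trans (mul_le_mul_of_nonneg_left
    (add_le_add_right h1 _) (by norm_num))) (Nat.cast_nonneg n)).trans (le_of_eq ?_)
  field_simp

/-- When the leading eigenfunction is constant, `n` times the deviation of the largest eigenvalue is
a weighted sum of squared normalized sample means, up to the trace of the remainder. -/
theorem IsKernelExpansion.nullInProb_mul_sampleTop_sub
    (h : IsKernelExpansion K lam₁ t 1 lam ψ)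
    (hU : ∀ i, Measurable (U i)) (hlaw : ∀ i, HasLaw (U i) (volume : Measure I) P)
    (hind : iIndepFun U P) (hsum : HasSum lam ((∫ x, K (x, x)) - lam₁)) :
    NullInProb P ((atTop : Filter (Finset J)).curry atTop) fun (p : Finset J × ℕ) ω =>
      p.2 * (sampleTop K (U · ω) p.2 - lam₁)
        - (∑ k ∈ p.1, lam₁ * lam k / (lam₁ - lam k) * (√(p.2 : ℝ) * sampleCoord ψ (U · ω) p.2 k) ^ 2
          + ((∫ x, K (x, x)) - lam₁ - ∑ k ∈ p.1, lam k)) := by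
  set d : J → ℝ := fun k => lam k / (lam₁ - lam k) with hdef
  have hd : Summable fun k => |d k| := h.summable_abs_div_sub hsum.summable
  have hd2 : Summable fun k => |d k ^ 2| := h.summable_abs_sq_div_sub
  have hdlam : ∀ k, lam₁ * d k = lam k * (1 + d k) := h.mul_div_sub_eq
  have hg : 0 < lam₁ - t := sub_pos.2 h.sep_lt
  set l := (atTop : Filter (Finset J)).curry (atTop : Filter ℕ) with hl
  have hn0 := (nullInProb_of_tendsto (P := P)
    tendsto_inv_atTop_nhds_zero_nat).comp_snd (atTop : Filter (Finset J))
  set x : ∀ p : Finset J × ℕ, Ω → EuclideanSpace ℝ (Fin p.2) :=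
    fun p ω => sampleTrial d ψ p.1 (U · ω) p.2 with hx
  set s : Finset J × ℕ → Ω → ℝ := fun p ω => ‖x p ω‖ ^ 2 with hs
  set M : Finset J × ℕ → Ω → ℝ := fun p ω =>
    p.2 * (⟪x p ω, sampleOp K (U · ω) p.2 (x p ω)⟫ - lam₁ * s p ω) with hM
  set N : Finset J × ℕ → Ω → ℝ := fun p ω =>
    p.2 * ‖sampleOp K (U · ω) p.2 (x p ω) - lam₁ • x p ω‖ ^ 2 with hN
  set X : Finset J × ℕ → Ω → ℝ := fun p ω =>
    p.2 * ∑ k ∈ p.1, lam₁ * d k * sampleCoord ψ (U · ω) p.2 k ^ 2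
      + ((∫ x, K (x, x)) - lam₁ - ∑ k ∈ p.1, lam k) with hX
  have hs1 : NullInProb P l fun p ω => s p ω - 1 :=
    h.nullInProb_norm_sq_sampleTrial_sub_one hU hlaw hind hd hd2
  have hMX : NullInProb P l fun p ω => M p ω - X p ω :=
    h.nullInProb_inner_sampleOp_sampleTrial_sub hU hlaw hind hd hd2 hdlam
  have hN0 : NullInProb P l N :=
    h.nullInProb_mul_norm_sq_residual hU hlaw hind hd hd2 hdlam
  have hW := h.boundedInProb_mul_norm_sq_sampleCorrection hU hlaw hind hd2
  have hτ : NullInProb P l fun p _ => (∫ x, K (x, x)) - lam₁ - ∑ k ∈ p.1, lam k := by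
    have h1 : Tendsto (fun F : Finset J => ∑ k ∈ F, lam k) atTop
      (𝓝 ((∫ x, K (x, x)) - lam₁)) := hsum
    have h2 := h1.const_sub ((∫ x, K (x, x)) - lam₁)
    rw [sub_self] at h2
    exact nullInProb_of_tendsto (h2.comp (tendsto_fst.mono_left curry_le_prod))
  have hXb : BoundedInProb P l X := by
    refine (h.boundedInProb_sum_sampleCoord hU hlaw hind ?_).add hτ.boundedInProb
    simpa only [abs_mul] using hd.mul_left |lam₁|
  have hMb : BoundedInProb P l M :=
    (hMX.boundedInProb.add hXb).congr (Eventually.of_forall fun p ω => by ring)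
  have hMs : NullInProb P l fun p ω => M p ω * (s p ω)⁻¹ - X p ω :=
    ((hs1.inv_sub_one.mul_boundedInProb hMb).add hMX).congr
      (Eventually.of_forall fun p ω => by ring)
  -- the rest of the spectrum stays below the Rayleigh quotient
  set D : Finset J × ℕ → Ω → ℝ := fun p ω =>
    (p.2 : ℝ)⁻¹ * (M p ω * (s p ω)⁻¹)
      - lam₁ * ((p.2 : ℝ)⁻¹ * (p.2 * ‖sampleCorrection d ψ p.1 (U · ω) p.2‖ ^ 2))
      - t * gramError ψ p.1 (U · ω) p.2
      - sampleHS (remainder K lam₁ 1 lam ψ p.1) (U · ω) p.2 with hD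
  have hD0 : NullInProb P l D := by
    refine (((hn0.mul_boundedInProb ?_).sub ((hn0.mul_boundedInProb hW).const_mul lam₁)).sub
      ((NullInProb.curry fun F => h.nullInProb_gramError hU hlaw hind F).const_mul t)).sub
      (h.nullInProb_remainder_sampleHS hU hlaw hind)
    exact (hMs.boundedInProb.add hXb).congr (Eventually.of_forall fun p ω => by ring)
  have hY := hMs.abs.add (hN0.const_mul (4 / (lam₁ - t)))
  have hδ : 0 < min (1 / 2) ((lam₁ - t) / 2) := lt_min one_half_pos (half_pos hg)
  refine (hs1.abs.add hD0.abs).mono_of_small hδ hY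
    (eventually_curry_iff.2 (Eventually.of_forall fun F => ?_))
  filter_upwards [eventually_gt_atTop 0] with n hn ω hω
  have hn' : (0 : ℝ) < n := by exact_mod_cast hn
  have hω' : |s (F, n) ω - 1| + |D (F, n) ω| ≤ min (1 / 2) ((lam₁ - t) / 2) :=
    (le_abs_self _).trans hω
  have h1 : |s (F, n) ω - 1| ≤ 1 / 2 := by
    linarith [min_le_left (1 / 2 : ℝ) ((lam₁ - t) / 2), abs_nonneg (D (F, n) ω)]
  have h2 : |D (F, n) ω| ≤ (lam₁ - t) / 2 := by
    linarith [min_le_right (1 / 2 : ℝ) ((lam₁ - t) / 2), abs_nonneg (s (F, n) ω - 1)]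
  have hs2 : 1 / 2 ≤ s (F, n) ω := by linarith [(abs_le.1 h1).1]
  have hs0 : 0 < s (F, n) ω := by linarith
  have hD2 := (abs_le.1 h2).1
  have hq : ⟪x (F, n) ω, sampleOp K (U · ω) n (x (F, n) ω)⟫ / ‖x (F, n) ω‖ ^ 2
      = lam₁ + (n : ℝ)⁻¹ * (M (F, n) ω * (s (F, n) ω)⁻¹) := by
    change _ / s (F, n) ω = _
    simp only [hM]
    field_simp
    ring
  have hbd := h.sampleTop_bounds F (U · ω) hn (sampleCorrection d ψ F (U · ω) n)
    (x := x (F, n) ω) rfl hs0 (D := lam₁ - t + D (F, n) ω)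
    (by rw [hq]; simp only [hD]; field_simp; ring) (by linarith) lam₁
  rw [hq] at hbd
  have hE0 : 0 ≤ N (F, n) ω := by positivity
  have hEb : n * (‖sampleOp K (U · ω) n (x (F, n) ω) - lam₁ • x (F, n) ω‖ ^ 2
      / ((lam₁ - t + D (F, n) ω) * ‖x (F, n) ω‖ ^ 2)) ≤ 4 / (lam₁ - t) * N (F, n) ω := by
    rw [← mul_div_assoc]
    change N (F, n) ω / ((lam₁ - t + D (F, n) ω) * s (F, n) ω) ≤ _
    rw [div_mul_eq_mul_div, mul_comm 4, div_le_div_iff₀ (mul_pos (by linarith) hs0) hg]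
    have : (lam₁ - t) / 4 ≤ (lam₁ - t + D (F, n) ω) * s (F, n) ω := by nlinarith
    nlinarith
  have hX' : X (F, n) ω = ∑ k ∈ F, lam₁ * lam k / (lam₁ - lam k)
      * (√(n : ℝ) * sampleCoord ψ (U · ω) n k) ^ 2
      + ((∫ x, K (x, x)) - lam₁ - ∑ k ∈ F, lam k) := by
    simp only [hX, Finset.mul_sum, mul_pow, Real.sq_sqrt hn'.le, hdef]
    congr 1
    exact Finset.sum_congr rfl fun k _ => by ring
  change |n * (sampleTop K (U · ω) n - lam₁) - _| ≤ _
  rw [← hX']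
  refine le_trans ?_ (le_abs_self _)
  have hlow := mul_le_mul_of_nonneg_left hbd.1 hn'.le
  have hupp := mul_le_mul_of_nonneg_left hbd.2 hn'.le
  rw [mul_add, mul_inv_cancel_left₀ hn'.ne'] at hlow
  rw [mul_add, mul_add, mul_inv_cancel_left₀ hn'.ne'] at hupp
  have h3 := abs_le.1 (le_refl |M (F, n) ω * (s (F, n) ω)⁻¹ - X (F, n) ω|)
  have h4 : 0 ≤ 4 / (lam₁ - t) * N (F, n) ω := by positivity
  rw [abs_le]
  constructor <;> linarith [h3.1, h3.2]

end SecondOrder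

/-! ### Central limit theorems for sampled functions -/

theorem charFun_map_eq_charFun_map_inner {Ω ι : Type*} [MeasurableSpace Ω] {P : Measure Ω} [Fintype ι]
    {X : Ω → EuclideanSpace ℝ ι}
    (hX : AEMeasurable X P) (v : EuclideanSpace ℝ ι) :
    charFun (P.map X) v = charFun (P.map fun ω => ⟪X ω, v⟫) 1 := by
  rw [charFun_apply, charFun_apply, integral_map hX (by fun_prop),
    integral_map (by fun_prop) (by fun_prop)]
  simp

section CentralLimit

variable {Ω Ω' J : Type*} [MeasurableSpace Ω] [MeasurableSpace Ω'] {P : Measure Ω}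
  [IsProbabilityMeasure P] {P' : Measure Ω'} [IsProbabilityMeasure P'] {U : ℕ → Ω → I}
  {K : C(I × I, ℝ)} {lam₁ t : ℝ} {lam : J → ℝ} {ψ : J → C(I, ℝ)}

theorem tendstoInDistribution_sum_comp (hU : ∀ i, Measurable (U i))
    (hlaw : ∀ i, HasLaw (U i) (volume : Measure I) P) (hind : iIndepFun U P) (f : C(I, ℝ))
    {Y : Ω' → ℝ} (hY : HasLaw Y (gaussianReal 0 Var[f; (volume : Measure I)].toNNReal) P') :
    TendstoInDistribution
      (fun (n : ℕ) ω => (√(n : ℝ))⁻¹ * (∑ i ∈ Finset.range n, f (U i ω) - n * ∫ x, f x))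
      atTop Y (fun _ => P) P' := by
  have hid : ∀ i, IdentDistrib (fun ω => f (U i ω)) f P volume := fun i =>
    ((hlaw i).identDistrib HasLaw.id).comp f.continuous.measurable
  have hvar : Var[fun ω => f (U 0 ω); P] = Var[f; (volume : Measure I)] := (hid 0).variance_eq
  have hint : ∫ ω, f (U 0 ω) ∂P = ∫ x, f x := (hid 0).integral_eq
  rw [← hvar] at hY
  have := tendstoInDistribution_inv_sqrt_mul_sum_sub (X := fun i ω => f (U i ω)) hY
    (memLp_two_comp hU f 0) (hind.comp (fun _ => f) fun _ => f.continuous.measurable)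
    fun i => (hid i).trans (hid 0).symm
  rwa [hint] at this

/-- The normalized coordinates converge jointly to independent standard normal variables. -/
theorem IsKernelExpansion.tendstoInDistribution_sampleCoord
    (h : IsKernelExpansion K lam₁ t 1 lam ψ) (hU : ∀ i, Measurable (U i))
    (hlaw : ∀ i, HasLaw (U i) (volume : Measure I) P) (hind : iIndepFun U P) {Z : J → Ω' → ℝ}
    (hZ : ∀ k, HasLaw (Z k) (gaussianReal 0 1) P') (hZind : iIndepFun Z P') (F : Finset J) :
    TendstoInDistribution
      (fun (n : ℕ) ω => (WithLp.toLp 2 fun k : F => √(n : ℝ) * sampleCoord ψ (U · ω) n k :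
        EuclideanSpace ℝ F))
      atTop (fun ω => WithLp.toLp 2 fun k : F => Z k ω) (fun _ => P) P' := by
  classical
  have hmeas : ∀ n : ℕ, AEMeasurable (fun ω =>
      (WithLp.toLp 2 fun k : F => √(n : ℝ) * sampleCoord ψ (U · ω) n k : EuclideanSpace ℝ F)) P := by
    intro n
    refine Measurable.aemeasurable ?_
    simp only [sampleCoord_eq]
    have : ∀ k : J, Measurable (ψ k) := fun k => (ψ k).continuous.measurable
    fun_prop
  have hZm : AEMeasurable (fun ω => (fun k : F => Z k ω)) P' :=
    aemeasurable_pi_iff.2 fun k => (hZ k).aemeasurable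
  have hZm' : AEMeasurable (fun ω =>
      (WithLp.toLp 2 fun k : F => Z k ω : EuclideanSpace ℝ F)) P' := by fun_prop
  have hlawZ : P'.map (fun ω => (WithLp.toLp 2 fun k : F => Z k ω : EuclideanSpace ℝ F))
      = stdGaussian (EuclideanSpace ℝ F) := by
    rw [← map_pi_eq_stdGaussian]
    have h1 := (iIndepFun_iff_map_fun_eq_pi_map fun k : F => (hZ k).aemeasurable).1
      (hZind.precomp (g := fun k : F => (k : J)) Subtype.val_injective)
    simp only [fun k : F => (hZ k).map_eq] at h1
    rw [← h1, AEMeasurable.map_map_of_aemeasurable (by fun_prop) hZm]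
    rfl
  refine ⟨hmeas, hZm', ProbabilityMeasure.tendsto_iff_tendsto_charFun.2 fun v => ?_⟩
  simp only [ProbabilityMeasure.coe_mk]
  rw [hlawZ, charFun_stdGaussian]
  set f : C(I, ℝ) := ∑ k : F, v k • ψ k with hf
  have hfx : ∀ x, f x = ∑ k : F, v k * ψ k x := fun x => by simp [hf]
  have hint : ∀ {g : I → ℝ}, Continuous g → Integrable g (volume : Measure I) :=
    fun hg => integrable_continuous hg
  have hf0 : ∫ x, f x = 0 := by
    simp only [hfx]
    rw [integral_finsetSum _ fun k _ => hint (by fun_prop)]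
    simp only [integral_const_mul, h.integral_right, mul_zero, Finset.sum_const_zero]
  have hvar : Var[f; (volume : Measure I)] = ‖v‖ ^ 2 := by
    rw [variance_of_integral_eq_zero f.continuous.aemeasurable hf0, EuclideanSpace.real_norm_sq_eq]
    have e : ∀ x, f x ^ 2 = ∑ k : F, ∑ l : F, v k * v l * (ψ k x * ψ l x) := by
      intro x
      rw [sq, hfx, Finset.sum_mul_sum]
      exact Finset.sum_congr rfl fun k _ => Finset.sum_congr rfl fun l _ => by ring
    simp only [e]
    rw [integral_finsetSum _ fun k _ => hint (by fun_prop)]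
    refine Finset.sum_congr rfl fun k _ => ?_
    rw [integral_finsetSum _ fun k _ => hint (by fun_prop), Finset.sum_eq_single k]
    · rw [integral_const_mul, h.integral_mul_self]; ring
    · intro l _ hl
      rw [integral_const_mul, h.integral_mul_of_ne _ _ fun h' => hl (Subtype.ext h').symm, mul_zero]
    · simp
  have hclt := (tendstoInDistribution_sum_comp hU hlaw hind f HasLaw.id).tendsto
  have h1 := ProbabilityMeasure.tendsto_iff_tendsto_charFun.1 hclt 1
  simp only [ProbabilityMeasure.coe_mk, Measure.map_id, charFun_gaussianReal, hvar, hf0] at h1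
  convert h1 using 2 with n
  · rw [charFun_map_eq_charFun_map_inner (hmeas n)]
    congr 2
    funext ω
    simp only [PiLp.inner_apply, RCLike.inner_apply, conj_trivial, sqrt_mul_sampleCoord, hfx]
    rw [Finset.sum_comm, mul_zero, sub_zero, Finset.mul_sum]
    refine Finset.sum_congr rfl fun k _ => ?_
    rw [← Finset.mul_sum]; ring
  · rw [Real.coe_toNNReal _ (sq_nonneg _)]
    congr 1
    push_cast
    ring

end CentralLimit

/-! ### Limit laws -/

/-- A series of random variables with summable `L¹` norms converges almost surely and in
probability. -/
theorem ae_summable_and_nullInProb_sum_sub_tsum {Ω J : Type*} [MeasurableSpace Ω] {P : Measure Ω}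
    [Countable J] {A : J → Ω → ℝ} (hA : ∀ k, AEMeasurable (A k) P)
    (h : ∑' k, ∫⁻ ω, ‖A k ω‖ₑ ∂P ≠ ∞) :
    (∀ᵐ ω ∂P, Summable fun k => A k ω) ∧
      NullInProb P atTop fun (F : Finset J) ω => ∑ k ∈ F, A k ω - ∑' k, A k ω := by
  have hsum : ∀ᵐ ω ∂P, Summable fun k => A k ω := by
    rw [← lintegral_tsum fun k => (hA k).enorm] at h
    filter_upwards [ae_lt_top' (AEMeasurable.tsum fun k => (hA k).enorm) h] with ω hω
    exact Summable.of_enorm hω.ne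
  refine ⟨hsum, fun δ hδ ε hε => ?_⟩
  have htail := ENNReal.tendsto_tsum_compl_atTop_zero h
  have hδε : (0 : ℝ≥0∞) < ENNReal.ofReal (δ * ε) := by simpa using mul_pos hδ hε
  filter_upwards [htail.eventually_lt_const hδε] with F hF
  have hle : P {ω | δ < |∑ k ∈ F, A k ω - ∑' k, A k ω|}
      ≤ P {ω | ENNReal.ofReal δ ≤ ∑' k : {k // k ∉ F}, ‖A k ω‖ₑ} := by
    refine measure_mono_ae ?_
    filter_upwards [hsum] with ω hω hlt
    change δ < |_| at hlt
    change ENNReal.ofReal δ ≤ _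
    have e : ∑ k ∈ F, A k ω - ∑' k, A k ω = -∑' k : {k // k ∉ F}, A k ω := by
      rw [← hω.sum_add_tsum_subtype_compl F]; ring
    rw [e, abs_neg] at hlt
    refine le_trans ?_ (enorm_tsum_le_tsum_enorm (f := fun k : {k // k ∉ F} => A k ω))
    rw [Real.enorm_eq_ofReal_abs]
    exact ENNReal.ofReal_le_ofReal hlt.le
  refine ENNReal.toReal_le_of_le_ofReal hε.le (hle.trans ?_)
  have hmeas : AEMeasurable (fun ω => ∑' k : {k // k ∉ F}, ‖A k ω‖ₑ) P :=
    AEMeasurable.tsum fun k => (hA k).enorm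
  refine (meas_ge_le_lintegral_div hmeas (by simpa using hδ) ENNReal.ofReal_ne_top).trans ?_
  rw [lintegral_tsum fun k : {k // k ∉ F} => (hA k).enorm]
  refine ENNReal.div_le_of_le_mul (hF.le.trans_eq ?_)
  rw [mul_comm, ENNReal.ofReal_mul hε.le]

theorem ae_summable_and_nullInProb_chiSquare {Ω' J : Type*} [MeasurableSpace Ω'] {P' : Measure Ω'}
    [Countable J] {c : J → ℝ} (hc : Summable fun k => |c k|) {Z : J → Ω' → ℝ}
    (hZ : ∀ k, HasLaw (Z k) (gaussianReal 0 1) P') :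
    (∀ᵐ ω ∂P', Summable fun k => c k * Z k ω ^ 2) ∧
      NullInProb P' atTop fun (F : Finset J) ω =>
        ∑ k ∈ F, c k * Z k ω ^ 2 - ∑' k, c k * Z k ω ^ 2 := by
  refine ae_summable_and_nullInProb_sum_sub_tsum
    (fun k => ((hZ k).aemeasurable.pow_const 2).const_mul _) ?_
  have hC : ∫⁻ x, ‖x ^ 2‖ₑ ∂gaussianReal 0 1 ≠ ∞ := by
    have h2 : MemLp id 2 (gaussianReal 0 1) := memLp_id_gaussianReal 2
    exact h2.integrable_sq.2.ne
  have h1 : ∀ k, ∫⁻ ω, ‖c k * Z k ω ^ 2‖ₑ ∂P'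
      = ‖c k‖ₑ * ∫⁻ x, ‖x ^ 2‖ₑ ∂gaussianReal 0 1 := by
    intro k
    simp only [enorm_mul]
    rw [lintegral_const_mul' _ _ enorm_ne_top, ← (hZ k).map_eq,
      lintegral_map' (by fun_prop) (hZ k).aemeasurable]
  simp only [h1]
  rw [ENNReal.tsum_mul_right]
  exact ENNReal.mul_ne_top (tsum_enorm_ne_top_iff_summable_norm.2 hc) hC

section LimitLaws

variable {Ω Ω' J : Type*} [MeasurableSpace Ω] [MeasurableSpace Ω'] {P : Measure Ω}
  [IsProbabilityMeasure P] {P' : Measure Ω'} [IsProbabilityMeasure P'] {U : ℕ → Ω → I}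
  {K : C(I × I, ℝ)} {lam₁ t : ℝ} {lam : J → ℝ} {ψ : J → C(I, ℝ)}

theorem measurable_largestEigenvalue_comp (hsymm : ∀ x y : I, K (x, y) = K (y, x))
    (hU : ∀ i, Measurable (U i)) (n : ℕ) :
    Measurable fun ω => largestEigenvalue (kernelMatrix K fun i : Fin n => U i ω) :=
  (measurable_largestEigenvalue hsymm n).comp (measurable_pi_lambda _ fun i => hU i)

/-- The sampled leading eigenfunction reduces the non-degenerate case to the central limit theorem
for `lam₁ φ(U_i)²`. -/
theorem IsKernelExpansion.tendstoInDistribution_gaussian {φ : C(I, ℝ)}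
    (h : IsKernelExpansion K lam₁ t φ lam ψ) (hU : ∀ i, Measurable (U i))
    (hlaw : ∀ i, HasLaw (U i) (volume : Measure I) P) (hind : iIndepFun U P)
    {Y : Ω' → ℝ} (hY : HasLaw Y
      (gaussianReal 0 (lam₁ ^ 2 * Var[fun x => φ x ^ 2; (volume : Measure I)]).toNNReal) P') :
    TendstoInDistribution
      (fun (n : ℕ) ω => √(n : ℝ) *
        (largestEigenvalue (kernelMatrix K fun i : Fin n => U i ω) / n - lam₁))
      atTop Y (fun _ => P) P' := by
  set f : C(I, ℝ) := ⟨fun x => lam₁ * φ x ^ 2, by fun_prop⟩ with hf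
  have hf1 : ∫ x, f x = lam₁ := by
    change ∫ x, lam₁ * φ x ^ 2 = lam₁
    simp only [sq, integral_const_mul, h.integral_top_mul_top, mul_one]
  have hvar : Var[f; (volume : Measure I)] = lam₁ ^ 2 * Var[fun x => φ x ^ 2; volume] :=
    variance_const_mul _ _ _
  rw [← hvar] at hY
  have hclt := tendstoInDistribution_sum_comp hU hlaw hind f hY
  suffices hnull : NullInProb P atTop fun (n : ℕ) ω => √(n : ℝ) *
      (largestEigenvalue (kernelMatrix K fun i : Fin n => U i ω) / n - lam₁)
        - (√(n : ℝ))⁻¹ * (∑ i ∈ Finset.range n, f (U i ω) - n * ∫ x, f x) from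
    tendstoInDistribution_of_approx (κ := Unit) (l := ⊤) (V := fun _ => Y) (fun _ => hclt)
      (by simpa only [sub_self] using nullInProb_zero) (hnull.comp_snd ⊤)
      (fun n => (((measurable_largestEigenvalue_comp h.symm hU n).div_const _).sub_const _
        |>.const_mul _).aemeasurable) hY.aemeasurable
  refine (h.nullInProb_sqrt_mul_sampleTop_sub hU hlaw hind).congr ?_
  filter_upwards [eventually_gt_atTop 0] with n hn ω
  have hn' : (0 : ℝ) < n := by exact_mod_cast hn
  have h1 : lam₁ * ‖sampleVec (U · ω) n φ‖ ^ 2 = (n : ℝ)⁻¹ * ∑ i ∈ Finset.range n, f (U i ω) := by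
    rw [← real_inner_self_eq_norm_sq, inner_sampleVec, mul_left_comm, Finset.mul_sum]
    simp only [← sq]
    rfl
  have h2 := sqrt_mul_inv_eq n
  have h3 : (√(n : ℝ))⁻¹ * n = √(n : ℝ) := by rw [inv_mul_eq_div, Real.div_sqrt]
  rw [h1, hf1, sampleTop]
  linear_combination lam₁ * h3 + (∑ i ∈ Finset.range n, f (U i ω)) * h2

/-- For a constant leading eigenfunction: continuous mapping gives the limit of every truncation,
and the truncation is removed by converging together. -/
theorem IsKernelExpansion.tendstoInDistribution_chiSquare [Countable J]
    (h : IsKernelExpansion K lam₁ t 1 lam ψ) (hU : ∀ i, Measurable (U i))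
    (hlaw : ∀ i, HasLaw (U i) (volume : Measure I) P) (hind : iIndepFun U P)
    (hsum : HasSum lam ((∫ x, K (x, x)) - lam₁)) {Z : J → Ω' → ℝ}
    (hZ : ∀ k, HasLaw (Z k) (gaussianReal 0 1) P') (hZind : iIndepFun Z P') :
    (∀ᵐ ω ∂P', Summable fun k => lam₁ * lam k / (lam₁ - lam k) * Z k ω ^ 2) ∧
    TendstoInDistribution
      (fun (n : ℕ) ω => largestEigenvalue (kernelMatrix K fun i : Fin n => U i ω) - n * lam₁)
      atTop (fun ω => ∑' k, lam₁ * lam k / (lam₁ - lam k) * Z k ω ^ 2) (fun _ => P) P' := by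
  classical
  have hc : Summable fun k => |lam₁ * lam k / (lam₁ - lam k)| := by
    simpa only [mul_div_assoc, abs_mul] using
      (h.summable_abs_div_sub hsum.summable).mul_left |lam₁|
  obtain ⟨h1, h2⟩ := ae_summable_and_nullInProb_chiSquare hc hZ
  refine ⟨h1, ?_⟩
  set τ : Finset J → ℝ := fun F => (∫ x, K (x, x)) - lam₁ - ∑ k ∈ F, lam k with hτ
  have hτ0 : Tendsto τ atTop (𝓝 0) := by
    have := Tendsto.const_sub ((∫ x, K (x, x)) - lam₁) (show Tendsto (fun F : Finset J =>
      ∑ k ∈ F, lam k) atTop (𝓝 ((∫ x, K (x, x)) - lam₁)) from hsum)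
    rwa [sub_self] at this
  refine tendstoInDistribution_of_approx (κ := Finset J) (l := atTop)
    (X := fun F n ω => ∑ k ∈ F, lam₁ * lam k / (lam₁ - lam k)
      * (√(n : ℝ) * sampleCoord ψ (U · ω) n k) ^ 2 + τ F)
    (V := fun F ω => ∑ k ∈ F, lam₁ * lam k / (lam₁ - lam k) * Z k ω ^ 2 + τ F)
    (fun F => ?_) ?_ ?_
    (fun n => ((measurable_largestEigenvalue_comp h.symm hU n).sub_const _).aemeasurable)
    (AEMeasurable.tsum fun k => ((hZ k).aemeasurable.pow_const 2).const_mul _)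
  · have := (h.tendstoInDistribution_sampleCoord hU hlaw hind hZ hZind F).continuous_comp
      (g := fun z : EuclideanSpace ℝ F => ∑ k : F, lam₁ * lam k / (lam₁ - lam k) * z k ^ 2 + τ F)
      (by fun_prop)
    convert this using 2 with n
    · funext ω
      exact congrArg (· + τ F) (Finset.sum_coe_sort F fun k => lam₁ * lam k / (lam₁ - lam k)
        * (√(n : ℝ) * sampleCoord ψ (U · ω) n k) ^ 2).symm
    · exact congrArg (· + τ F) (Finset.sum_coe_sort F fun k => lam₁ * lam k / (lam₁ - lam k)
        * Z k _ ^ 2).symm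
  · exact (h2.add (nullInProb_of_tendsto hτ0)).congr (Eventually.of_forall fun F ω => by ring)
  · refine (h.nullInProb_mul_sampleTop_sub hU hlaw hind hsum).congr
      (eventually_curry_iff.2 (Eventually.of_forall fun F => ?_))
    filter_upwards [eventually_gt_atTop 0] with n hn ω
    have hn' : (n : ℝ) ≠ 0 := by positivity
    simp only [hτ, sampleTop]
    rw [mul_sub _ _ lam₁, mul_div_cancel₀ _ hn']

end LimitLaws

end RandomKernel

theorem corollary2p4
    -- the kernel: symmetric, bounded by one, Lipschitz, with a spectral gap
    (K : C(I × I, ℝ)) (hsymm : ∀ x y : I, K (x, y) = K (y, x))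
    (hbound : ∀ x y : I, |K (x, y)| ≤ 1)
    (L : ℝ≥0) (hLip : LipschitzWith L K)
    (hgap : 0 < |posEigenvalue K 1 - posEigenvalue K 2|)
    -- the normalized eigenfunction of the largest eigenvalue
    (φ₁ : L2) (hφnorm : ‖φ₁‖ = 1) (hφ : kernelOp K φ₁ = posEigenvalue K 1 • φ₁)
    -- independent uniform random variables
    {Ω : Type*} [MeasurableSpace Ω] (P : Measure Ω) [IsProbabilityMeasure P]
    (U : ℕ → Ω → I) (hUlaw : ∀ i, HasLaw (U i) (volume : Measure I) P) (hUindep : iIndepFun U P) :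
    (¬ AEConstant φ₁ →
      TendstoInDistribution
        (fun (n : ℕ) (ω : Ω) =>
          √(n : ℝ) * (largestEigenvalue (kernelMatrix K fun i : Fin n => U i ω) / (n : ℝ)
            - posEigenvalue K 1))
        atTop (id : ℝ → ℝ) (fun _ => P)
        (gaussianReal 0
          (posEigenvalue K 1 ^ 2 * Var[fun x : I => φ₁ x ^ 2; (volume : Measure I)]).toNNReal)) ∧
    (AEConstant φ₁ → Summable (fun i : EigenIndex K => |eigenvalue K i|) →
      -- independent standard normal random variables, one for each nonzero eigenvalue
      ∀ {Ω' : Type*} [MeasurableSpace Ω'] (P' : Measure Ω') [IsProbabilityMeasure P']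
        (Z : EigenIndex K → Ω' → ℝ), (∀ i, HasLaw (Z i) (gaussianReal 0 1) P') →
        iIndepFun Z P' →
      (∀ᵐ ω ∂P', Summable fun i : {i : EigenIndex K // eigenvalue K i ≠ posEigenvalue K 1} =>
        posEigenvalue K 1 * eigenvalue K i / (posEigenvalue K 1 - eigenvalue K i) * Z i ω ^ 2) ∧
      TendstoInDistribution
        (fun (n : ℕ) (ω : Ω) =>
          largestEigenvalue (kernelMatrix K fun i : Fin n => U i ω)
            - (n : ℝ) * posEigenvalue K 1)
        atTop
        (fun ω : Ω' => ∑' i : {i : EigenIndex K // eigenvalue K i ≠ posEigenvalue K 1},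
          posEigenvalue K 1 * eigenvalue K i / (posEigenvalue K 1 - eigenvalue K i) * Z i ω ^ 2)
        (fun _ => P) P') := by
  -- `HasLaw` provides a.e. measurability only: pass to measurable versions of the `U i`
  obtain ⟨U', hU', hUU'⟩ : ∃ U' : ℕ → Ω → I, (∀ i, Measurable (U' i)) ∧ ∀ i, U i =ᵐ[P] U' i :=
    ⟨fun i => (hUlaw i).aemeasurable.mk, fun i => (hUlaw i).aemeasurable.measurable_mk,
      fun i => (hUlaw i).aemeasurable.ae_eq_mk⟩
  have hlaw : ∀ i, HasLaw (U' i) (volume : Measure I) P := fun i => (hUlaw i).congr (hUU' i).symm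
  have hind : iIndepFun U' P := hUindep.congr hUU'
  have hae : ∀ᵐ ω ∂P, ∀ i, U i ω = U' i ω := ae_all_iff.2 hUU'
  have hpos : posEigenvalue K 1 ≠ 0 := by
    obtain ⟨_, t, ht0, ht1, -⟩ := exists_index_eq_posEigenvalue hsymm hgap
    exact (ht0.trans ht1).ne'
  refine ⟨fun _ => ?_, ?_⟩
  · obtain ⟨t, h⟩ := isKernelExpansion_eigenfun hsymm hgap hφnorm hφ
    have hφae : φ₁ =ᵐ[volume] (posEigenvalue K 1)⁻¹ • integralFun K φ₁ := by
      nth_rewrite 1 [← contLp_inv_smul_integralFun hpos hφ]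
      exact contLp_ae_eq _
    have hvar : Var[fun x : I => φ₁ x ^ 2; (volume : Measure I)]
        = Var[fun x : I => ((posEigenvalue K 1)⁻¹ • integralFun K φ₁) x ^ 2; volume] :=
      variance_congr (hφae.mono fun x hx => by simp only [hx]; rfl)
    rw [hvar]
    refine (h.tendstoInDistribution_gaussian hU' hlaw hind HasLaw.id).congr (fun n => ?_)
      EventuallyEq.rfl
    filter_upwards [hae] with ω hω
    simp only [hω]
  · rintro ⟨c, hc⟩ hsum Ω' _ P' _ Z hZ hZind
    -- the constant function one is a normalized eigenfunction as well
    have hc0 : φ₁ = c • contLp 1 := by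
      refine Lp.ext ?_
      filter_upwards [hc, Lp.coeFn_smul c (contLp 1), contLp_ae_eq 1] with x h1 h2 h3
      rw [h1, h2, Pi.smul_apply, h3]
      simp
    have hc1 : c ≠ 0 := by
      rintro rfl
      rw [hc0, zero_smul, norm_zero] at hφnorm
      exact zero_ne_one hφnorm
    have hone : kernelOp K (contLp 1) = posEigenvalue K 1 • contLp 1 := by
      have h1 := congrArg (c⁻¹ • ·) hφ
      simpa only [hc0, map_smul, smul_comm (posEigenvalue K 1) c, inv_smul_smul₀ hc1] using h1
    have hone1 : ‖contLp 1‖ = 1 := by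
      have h1 : ‖contLp 1‖ ^ 2 = 1 := by
        rw [← real_inner_self_eq_norm_sq, inner_contLp]; simp
      rwa [pow_eq_one_iff_of_nonneg (norm_nonneg _) two_ne_zero] at h1
    have hφ1 : (posEigenvalue K 1)⁻¹ • integralFun K (contLp 1) = 1 :=
      contLp_injective (contLp_inv_smul_integralFun hpos hone)
    obtain ⟨t, h⟩ := isKernelExpansion_eigenfun hsymm hgap hone1 hone
    rw [hφ1] at h
    have := countable_eigenIndex hsymm
    obtain ⟨h1, h2⟩ := h.tendstoInDistribution_chiSquare hU' hlaw hind
      (hasSum_eigenvalue_ne hsymm hgap hsum) (fun k => hZ k)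
      (hZind.precomp Subtype.val_injective)
    refine ⟨h1, h2.congr (fun n => ?_) EventuallyEq.rfl⟩
    filter_upwards [hae] with ω hω
    simp only [hω]
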